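/- **Notation.** Let $\mathbb T$ be the unit circle, $D_r=\{z\in\mathbb C:|z|<r\}$ and $\Delta_r=\{z\in\mathbb C:|z|>1/r\}$. For a Borel probability measure $\mu$ on $\mathbb T^2$ let $\mu^{(1)},\mu^{(2)}$ be its marginals, and let $\mu^*$ be its coordinate-reflection, $d\mu^*(s,t)=d\mu(s,1/t)$. Let $\mathscr P^\times$ be the set of all such $\mu$ with $\int s\,d\mu\ne0$, $\int t\,d\mu\neq0$ and $\int st\,d\mu\ne0$. For a probability measure $\nu$ on $\mathbb T$ with nonzero mean put $\psi_\nu(z)=\int\frac{zx}{1-zx}\,d\nu(x)$ and $\eta_\nu=\psi_\nu/(1+\psi_\nu)$. For small $r\in(0,1)$ let $\eta_\nu^{-1}$ be the holomorphic inverse of $\eta_\nu$ on $D_r\cup\Delta_r$ that maps $D_r$ into $D_1$, $\Delta_r$ into $\Delta_1$, $0$ to $0$ and $\infty$ to $\infty$, and let $\psi_\nu^{-1}(z)=\eta_\nu^{-1}(z/(1+z))$. Let $$H_\mu(z,w)=\int_{\mathbb T^2}\frac{d\mu(s,t)}{(1-zs)(1-wt)}.$$ For $\mu$ with nonzero marginal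 means put $$S_\mu(z,w)=\frac{1+z}{z}\,\frac{1+w}{w}\left[1-\frac{1+z+w}{H_\mu(\psi_{\mu^{(1)}}^{-1}(z),\psi_{\mu^{(2)}}^{-1}(w))}\right],$$ $$S^{\rm op}_\mu(z,w)=\frac{w(z+1)}{z(w+1)}\left[1+\frac{z-w}{H_\mu(\psi_{\mu^{(1)}}^{-1}(z),\psi_{\mu^{(2)}}^{-1}(w))-z-1}\right],$$ with the removable singularities on $\{z=0\}\cup\{w=0\}$ removed, and $$\Sigma_\mu(z,w)=S_\mu\Big(\frac z{1-z},\frac w{1-w}\Big),\qquad \Sigma^{\rm op}_\mu(z,w)=S^{\rm op}_\mu\Big(\frac z{1-z},\frac w{1-w}\Big).$$ For probability measures $\mu_1,\mu_2$ on $\mathbb T^2$ let $(H,\xi)$ be the free product of the Hilbert spaces $L^2(\mu_1),L^2(\mu_2)$ with the constant functions $1$ as specified unit vectors. Let $u_i$ be the left variable on $H$ of the operator of multiplication by $s$ on $L^2(\mu_i)$, and $v_i$ the right variable on $H$ of the operator of multiplication by $t$ on $L^2(\mu_i)$. The opposite bi-free convolution $\mu_1\boxtimes\boxtimes^{\rm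 op}\mu_2$ is the distribution, in the vector state of $\xi$, of the pair $(u_1u_2,\,v_2v_1)$ of commuting unitaries; it is a well-defined probability measure on $\mathbb T^2$. **Proposition 2.8.** 1. For each $\mu\in\mathscr P^\times$ there is $r=r(\mu)\in(0,1)$ such that $\Sigma^{\rm op}_\mu$ and $S^{\rm op}_\mu$ are well-defined and holomorphic in the bidisk $D_r\times D_r$. 2. For each $\mu\in\mathscr P^\times$ the number $r$ in (1) can be chosen so that also, for all $(z,w)\in D_r\times D_r$ with $w\ne0$, both sides of the following identity are defined and $$\Sigma^{\rm op}_{\mu^*}(z,w)=\Sigma_\mu(z,1/w).$$ 3. If $\mu_1,\mu_2\in\mathscr P^\times$, then there is $r\in(0,1)$ such that $\Sigma^{\rm op}_{\mu_1\boxtimes\boxtimes^{\rm op}\mu_2}$ is well-defined and holomorphic in $D_r\times D_r$, and $$\Sigma^{\rm op}_{\mu_1\boxtimes\boxtimes^{\rm op}\mu_2}(z,w)=\Sigma^{\rm op}_{\mu_1}(z,w)\,\Sigma^{\rm op}_{\mu_2}(z,w),\qquad (z,w)\in D_r\times D_r.$$ -/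

import Mathlib

open MeasureTheory Filter Topology ENNReal

noncomputable section

namespace BiFree

/-! ### The free product of Hilbert spaces with specified unit vectors -/

section FreeProduct

/-- An orthonormal (Hilbert) basis of `K` that contains the specified vector `ξ`. The index `none`
belongs to `ξ`; the indices `some j` enumerate an orthonormal basis of `K ⊖ ℂ ξ`. -/
structure PointedBasis (K : Type) [NormedAddCommGroup K] [InnerProductSpace ℂ K] (ξ : K) where
  /-- index set of the orthonormal basis of the orthogonal complement of `ξ` -/
  J : Type
  /-- the Hilbert basis -/
  b : HilbertBasis (Option J) ℂ K
  b_none : b none = ξ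

theorem PointedBasis.nonempty {K : Type} [NormedAddCommGroup K] [InnerProductSpace ℂ K]
    [CompleteSpace K] {ξ : K} (hξ : ‖ξ‖ = 1) : Nonempty (PointedBasis K ξ) := by
  classical
  have h1 : Orthonormal ℂ ((↑) : ({ξ} : Set K) → K) := by
    refine ⟨fun i => ?_, fun i j hij => (hij (Subsingleton.elim _ _)).elim⟩
    rw [i.2]; exact hξ
  obtain ⟨w, b, hw, hb⟩ := h1.exists_hilbertBasis_extension
  have hξw : ξ ∈ w := hw rfl
  let f : Option {x : w // x ≠ ⟨ξ, hξw⟩} → w := fun o => o.elim ⟨ξ, hξw⟩ (fun x => x.1)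
  have hf : Function.Injective f := by
    rintro (_ | x) (_ | y) h
    · rfl
    · exact (y.2 h.symm).elim
    · exact (x.2 h).elim
    · exact congrArg some (Subtype.ext h)
  have hfs : Function.Surjective f := by
    intro x
    by_cases hx : x = ⟨ξ, hξw⟩
    · exact ⟨none, hx.symm⟩
    · exact ⟨some ⟨x, hx⟩, rfl⟩
  have hr : Set.range (b ∘ f) = Set.range b := hfs.range_comp b
  refine ⟨⟨_, HilbertBasis.mk (v := b ∘ f) (b.orthonormal.comp f hf) ?_, ?_⟩⟩
  · rw [hr, b.dense_span]
  · rw [HilbertBasis.coe_mk, Function.comp, hb]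
    rfl

variable {ι : Type}

/-- Alternating words: finite lists of letters, neighbouring letters having different indices.
The word `[(i₁, j₁), …, (iₙ, jₙ)]` labels the vector `e_{j₁} ⊗ ⋯ ⊗ e_{jₙ}` of the summand
`(H_{i₁} ⊖ ℂ ξ_{i₁}) ⊗ ⋯ ⊗ (H_{iₙ} ⊖ ℂ ξ_{iₙ})` of the free product, the empty word labels the
vacuum vector. -/
abbrev Word (J : ι → Type) : Type :=
  {l : List (Σ i, J i) // l.IsChain (fun x y => x.1 ≠ y.1)}

/-- The alternating words whose first letter does not have index `i`. -/
abbrev WordNot (J : ι → Type) (i : ι) : Type :=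
  {w : Word J // ∀ x ∈ w.1.head?, i ≠ x.1}

/-- Put a letter of index `i`, or nothing, in front of a word that does not begin with `i`. -/
def Word.cons {J : ι → Type} {i : ι} : Option (J i) × WordNot J i → Word J
  | (none, m) => m.1
  | (some a, m) => ⟨⟨i, a⟩ :: m.1.1, List.isChain_cons.2 ⟨m.2, m.1.2⟩⟩

theorem Word.cons_bijective {J : ι → Type} {i : ι} :
    Function.Bijective (Word.cons (J := J) (i := i)) := by
  constructor
  · rintro ⟨_ | a, m⟩ ⟨_ | a', m'⟩ h
    · have h' : m.1 = m'.1 := h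
      rw [Subtype.ext h']
    · have h' : m.1.1 = ⟨i, a'⟩ :: m'.1.1 := congrArg Subtype.val h
      exact (m.2 ⟨i, a'⟩ (by rw [h']; simp) rfl).elim
    · have h' : ⟨i, a⟩ :: m.1.1 = m'.1.1 := congrArg Subtype.val h
      exact (m'.2 ⟨i, a⟩ (by rw [← h']; simp) rfl).elim
    · have h' : (⟨i, a⟩ :: m.1.1 : List (Σ i, J i)) = ⟨i, a'⟩ :: m'.1.1 := congrArg Subtype.val h
      have h1 := (List.cons.inj h').1
      have h2 := (List.cons.inj h').2
      have h3 : a = a' := by simpa using h1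
      rw [h3, Subtype.ext (Subtype.ext h2)]
  · rintro ⟨l, hl⟩
    by_cases h : ∀ x ∈ l.head?, i ≠ x.1
    · exact ⟨(none, ⟨⟨l, hl⟩, h⟩), rfl⟩
    · push Not at h
      obtain ⟨x, hx, rfl⟩ := h
      cases l with
      | nil => simp at hx
      | cons y t =>
        have hxy : y = x := by simpa using hx
        subst hxy
        have := List.isChain_cons.1 hl
        exact ⟨(some y.2, ⟨⟨t, this.2⟩, this.1⟩), rfl⟩

/-- Splitting off a first letter of index `i` (if there is one):
the labels of the unitary `V_i : H_i ⊗ H(ℓ, i) → H`. -/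
def Word.leftEquiv (J : ι → Type) (i : ι) : Option (J i) × WordNot J i ≃ Word J :=
  Equiv.ofBijective Word.cons Word.cons_bijective

/-- Reversal of words. -/
def Word.rev (J : ι → Type) : Word J ≃ Word J where
  toFun w := ⟨w.1.reverse, List.isChain_reverse.2 (w.2.imp fun _ _ => Ne.symm)⟩
  invFun w := ⟨w.1.reverse, List.isChain_reverse.2 (w.2.imp fun _ _ h => h.symm)⟩
  left_inv _ := Subtype.ext (List.reverse_reverse _)
  right_inv _ := Subtype.ext (List.reverse_reverse _)

/-- Splitting off a last letter of index `i` (if there is one): the pair `(a, m)` goes to the word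
`m.reverse ++ [a]`. These are the labels of the unitary `W_i : H(r, i) ⊗ H_i → H`; a word that does
not end in a letter of index `i` is represented by its reversal `m`. -/
def Word.rightEquiv (J : ι → Type) (i : ι) : Option (J i) × WordNot J i ≃ Word J :=
  (Word.leftEquiv J i).trans (Word.rev J)

/-- The Hilbert space `ℓ²(W)`. -/
abbrev L2 (W : Type) : Type := lp (fun _ : W => ℂ) 2

theorem summable_norm_sq {W : Type} (f : L2 W) : Summable fun w => ‖f w‖ ^ 2 := by
  simpa using (lp.memℓp f).summable (by norm_num)

theorem tsum_norm_sq {W : Type} (f : L2 W) : ∑' w, ‖f w‖ ^ 2 = ‖f‖ ^ 2 := by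
  simpa using (lp.norm_rpow_eq_tsum (p := 2) (by norm_num) f).symm

theorem memℓp_two {W : Type} {f : W → ℂ} (h : Summable fun w => ‖f w‖ ^ 2) : Memℓp f 2 :=
  memℓp_gen (by simpa using h)

section Amplification

variable {A M W K : Type} [NormedAddCommGroup K] [InnerProductSpace ℂ K]

/-- The slice `a ↦ f (e (a, m))` of a vector `f ∈ ℓ²(W)`, where `e : A × M ≃ W`. -/
def slice (e : A × M ≃ W) (m : M) : L2 W →ₗ[ℂ] L2 A where
  toFun f := ⟨fun a => f (e (a, m)), memℓp_two <|
    (summable_norm_sq f).comp_injective (i := fun a => e (a, m))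
      fun _ _ h => (Prod.mk.inj (e.injective h)).1⟩
  map_add' _ _ := rfl
  map_smul' _ _ := rfl

theorem ampl_bound (b : HilbertBasis A ℂ K) (e : A × M ≃ W) (T : K →L[ℂ] K) (f : L2 W) :
    (Summable fun w : W =>
      ‖b.repr (T (b.repr.symm (slice e (e.symm w).2 f))) (e.symm w).1‖ ^ 2) ∧
    ∑' w : W, ‖b.repr (T (b.repr.symm (slice e (e.symm w).2 f))) (e.symm w).1‖ ^ 2
      ≤ (‖T‖ * ‖f‖) ^ 2 := by
  set g : W → ℝ := fun w =>
    ‖b.repr (T (b.repr.symm (slice e (e.symm w).2 f))) (e.symm w).1‖ ^ 2 with hg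
  let e' : M × A ≃ W := (Equiv.prodComm M A).trans e
  have hge : ∀ m a, g (e' (m, a)) = ‖b.repr (T (b.repr.symm (slice e m f))) a‖ ^ 2 := by
    intro m a; simp [hg, e']
  have hfs : Summable fun p : M × A => ‖f (e' p)‖ ^ 2 :=
    (summable_norm_sq f).comp_injective e'.injective
  have hf2 := (summable_prod_of_nonneg (f := fun p : M × A => ‖f (e' p)‖ ^ 2)
    (fun _ => by positivity)).1 hfs
  have hsl : ∀ m, ∑' a, ‖f (e' (m, a))‖ ^ 2 = ‖slice e m f‖ ^ 2 := fun m =>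
    tsum_norm_sq (slice e m f)
  have hle : ∀ m, ∑' a, g (e' (m, a)) ≤ ‖T‖ ^ 2 * ∑' a, ‖f (e' (m, a))‖ ^ 2 := by
    intro m
    simp_rw [hge, hsl, tsum_norm_sq]
    rw [← mul_pow, LinearIsometryEquiv.norm_map]
    gcongr
    exact (T.le_opNorm _).trans (by rw [LinearIsometryEquiv.norm_map])
  have hs2 : Summable fun m => ∑' a, g (e' (m, a)) :=
    Summable.of_nonneg_of_le (fun m => tsum_nonneg fun _ => by positivity) hle
      (hf2.2.mul_left _)
  have hs : Summable fun p : M × A => g (e' p) :=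
    (summable_prod_of_nonneg (f := fun p : M × A => g (e' p)) (fun _ => by positivity)).2
      ⟨fun m => by simpa only [hge] using summable_norm_sq _, hs2⟩
  refine ⟨e'.summable_iff.1 hs, ?_⟩
  calc ∑' w, g w = ∑' p : M × A, g (e' p) := (e'.tsum_eq g).symm
    _ = ∑' m, ∑' a, g (e' (m, a)) := hs.tsum_prod
    _ ≤ ∑' m, ‖T‖ ^ 2 * ∑' a, ‖f (e' (m, a))‖ ^ 2 := hs2.tsum_le_tsum hle (hf2.2.mul_left _)
    _ = ‖T‖ ^ 2 * ∑' p : M × A, ‖f (e' p)‖ ^ 2 := by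
        rw [tsum_mul_left, hfs.tsum_prod]
    _ = ‖T‖ ^ 2 * ∑' w, ‖f w‖ ^ 2 := by rw [e'.tsum_eq fun w => ‖f w‖ ^ 2]
    _ = (‖T‖ * ‖f‖) ^ 2 := by rw [tsum_norm_sq, mul_pow]

/-- The operator `T ⊗ I` on `K ⊗ ℓ²(M) = ℓ²(A) ⊗ ℓ²(M) = ℓ²(A × M) = ℓ²(W)`, where `K = ℓ²(A)`
through the Hilbert basis `b` and `ℓ²(A × M) = ℓ²(W)` through the bijection `e`: the operator `T`
acts on every slice `f (e (·, m))`. -/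
def ampl (b : HilbertBasis A ℂ K) (e : A × M ≃ W) (T : K →L[ℂ] K) : L2 W →L[ℂ] L2 W :=
  LinearMap.mkContinuous
    { toFun := fun f => ⟨fun w =>
        b.repr (T (b.repr.symm (slice e (e.symm w).2 f))) (e.symm w).1,
        memℓp_two (ampl_bound b e T f).1⟩
      map_add' := fun f g => by
        ext w
        simp only [map_add, lp.coeFn_add, Pi.add_apply]
      map_smul' := fun c f => by
        ext w
        simp only [map_smul, lp.coeFn_smul, Pi.smul_apply]
        rfl } ‖T‖ fun f => by
    refine le_of_sq_le_sq ?_ (by positivity)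
    rw [← tsum_norm_sq]
    exact (ampl_bound b e T f).2

end Amplification

variable {K : ι → Type} [∀ i, NormedAddCommGroup (K i)] [∀ i, InnerProductSpace ℂ (K i)]
  {ξ : ∀ i, K i}

/-- The free product Hilbert space of the pairs `(K i, ξ i)`, with the orthonormal basis of
elementary tensors (labelled by the alternating words) that comes from orthonormal bases of
the spaces `K i` containing `ξ i`. -/
abbrev FreeProd (B : ∀ i, PointedBasis (K i) (ξ i)) : Type := L2 (Word fun i => (B i).J)

/-- The vacuum vector of the free product, labelled by the empty word. -/
def vacuum (B : ∀ i, PointedBasis (K i) (ξ i)) : FreeProd B := by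
  classical exact lp.single 2 (⟨[], List.IsChain.nil⟩ : Word fun i => (B i).J) (1 : ℂ)

/-- The left variable `λ_i(T) = V_i (T ⊗ I) V_i⁻¹`. -/
def leftVar (B : ∀ i, PointedBasis (K i) (ξ i)) (i : ι) (T : K i →L[ℂ] K i) :
    FreeProd B →L[ℂ] FreeProd B :=
  ampl (B i).b (Word.leftEquiv (fun i => (B i).J) i) T

/-- The right variable `ρ_i(T) = W_i (I ⊗ T) W_i⁻¹`. -/
def rightVar (B : ∀ i, PointedBasis (K i) (ξ i)) (i : ι) (T : K i →L[ℂ] K i) :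
    FreeProd B →L[ℂ] FreeProd B :=
  ampl (B i).b (Word.rightEquiv (fun i => (B i).J) i) T

end FreeProduct

/-! ### Probability measures on the torus and the opposite bi-free convolution -/

instance instMeasurableSpaceCircle : MeasurableSpace Circle := borel Circle

instance instBorelSpaceCircle : BorelSpace Circle := ⟨rfl⟩

/-- The torus `𝕋²`. -/
abbrev Torus : Type := Circle × Circle

/-- The coordinate function `(s, t) ↦ s`. -/
def coordS : C(Torus, ℂ) := ⟨fun p => (p.1 : ℂ), by fun_prop⟩

/-- The coordinate function `(s, t) ↦ t`. -/
def coordT : C(Torus, ℂ) := ⟨fun p => (p.2 : ℂ), by fun_prop⟩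

/-- The Hilbert space `L²(μ)`. -/
abbrev HilbertL2 (μ : ProbabilityMeasure Torus) : Type := Lp ℂ 2 (μ : Measure Torus)

/-- The constant function one in `L²(μ)`. -/
def oneL2 (μ : ProbabilityMeasure Torus) : HilbertL2 μ := Lp.const 2 (μ : Measure Torus) (1 : ℂ)

theorem norm_oneL2 (μ : ProbabilityMeasure Torus) : ‖oneL2 μ‖ = 1 := by
  simp [oneL2, Lp.norm_const]

/-- The operator of multiplication by the continuous function `f` on `L²(μ)`. -/
def mulOp (μ : ProbabilityMeasure Torus) (f : C(Torus, ℂ)) : HilbertL2 μ →L[ℂ] HilbertL2 μ :=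
  (ContinuousLinearMap.mul ℂ ℂ).holderL (μ : Measure Torus) ∞ 2 2
    (ContinuousMap.toLp ∞ (μ : Measure Torus) ℂ f)

/-- A choice of an orthonormal basis of `L²(μ)` that contains the constant function one. -/
def basisL2 (μ : ProbabilityMeasure Torus) : PointedBasis (HilbertL2 μ) (oneL2 μ) :=
  (PointedBasis.nonempty (norm_oneL2 μ)).some

/-- `ν` is the distribution of the pair `(U, V)` of commuting unitaries with respect to the vector
state of `Ω`: all the joint `*`-moments agree. Such a measure on the torus is unique. -/
def IsJointLaw {H : Type} [NormedAddCommGroup H] [InnerProductSpace ℂ H] [CompleteSpace H]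
    (U V : H →L[ℂ] H) (Ω : H) (ν : ProbabilityMeasure Torus) : Prop :=
  ∀ p p' q q' : ℕ,
    ∫ x : Torus, (x.1 : ℂ) ^ p * star (x.1 : ℂ) ^ p' * ((x.2 : ℂ) ^ q * star (x.2 : ℂ) ^ q') ∂ν
      = inner ℂ Ω ((U ^ p * star U ^ p' * (V ^ q * star V ^ q')) Ω)

/-- `ν` is the law of `(u₁ u₂, v₂ v₁)`, where `uᵢ = λ_i(Sᵢ)` and `vᵢ = ρ_i(Tᵢ)` are the left and
right variables on the free product of `L²(μ₁)` and `L²(μ₂)` (with the constants one as specified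
vectors), and `Sᵢ`, `Tᵢ` are the multiplications by the coordinates `s`, `t` on `L²(μᵢ)`. -/
def IsOppConv (μ₁ μ₂ ν : ProbabilityMeasure Torus) : Prop :=
  let μ : Fin 2 → ProbabilityMeasure Torus := ![μ₁, μ₂]
  let B : ∀ i, PointedBasis (HilbertL2 (μ i)) (oneL2 (μ i)) := fun i => basisL2 (μ i)
  let u := fun i => leftVar B i (mulOp (μ i) coordS)
  let v := fun i => rightVar B i (mulOp (μ i) coordT)
  IsJointLaw (u 0 * u 1) (v 1 * v 0) (vacuum B) ν

instance : Nonempty (ProbabilityMeasure Torus) := ⟨⟨Measure.dirac 1, inferInstance⟩⟩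

/-- The opposite bi-free convolution of `μ₁` and `μ₂`. -/
def oppConv (μ₁ μ₂ : ProbabilityMeasure Torus) : ProbabilityMeasure Torus :=
  Classical.epsilon (IsOppConv μ₁ μ₂)

/-- First marginal law. -/
def marg₁ (μ : ProbabilityMeasure Torus) : ProbabilityMeasure Circle :=
  μ.map (f := Prod.fst) measurable_fst.aemeasurable

/-- Second marginal law. -/
def marg₂ (μ : ProbabilityMeasure Torus) : ProbabilityMeasure Circle :=
  μ.map (f := Prod.snd) measurable_snd.aemeasurable

/-- The coordinate-reflection `dμ*(s, t) = dμ(s, 1/t)`. -/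
def reflect (μ : ProbabilityMeasure Torus) : ProbabilityMeasure Torus :=
  μ.map (f := fun p : Torus => (p.1, p.2⁻¹)) (Continuous.measurable (by fun_prop)).aemeasurable

/-- The mean of a probability measure on the circle. -/
def mean (ν : ProbabilityMeasure Circle) : ℂ := ∫ x : Circle, (x : ℂ) ∂ν

/-- The class of probability measures on the torus with nonzero marginal means and nonzero
moment `∫ s t dμ(s, t)`. -/
def PTimes : Set (ProbabilityMeasure Torus) :=
  {μ | mean (marg₁ μ) ≠ 0 ∧ mean (marg₂ μ) ≠ 0 ∧ ∫ p : Torus, (p.1 : ℂ) * (p.2 : ℂ) ∂μ ≠ 0}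

/-! ### The transforms -/

/-- The disk `D_r`. -/
def D (r : ℝ) : Set ℂ := {z | ‖z‖ < r}

/-- The neighbourhood `Δ_r` of infinity. -/
def Δ (r : ℝ) : Set ℂ := {z | 1 / r < ‖z‖}

/-- The one-dimensional `ψ`-transform (on the complement of the unit circle). -/
def psi (ν : ProbabilityMeasure Circle) (z : ℂ) : ℂ :=
  ∫ x : Circle, z * (x : ℂ) / (1 - z * (x : ℂ)) ∂ν

/-- The `η`-transform. -/
def eta (ν : ProbabilityMeasure Circle) (z : ℂ) : ℂ := psi ν z / (1 + psi ν z)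

/-- `g` is, on `D_r ∪ Δ_r`, the holomorphic inverse of the `η`-transform of `ν` that maps `0` to
`0` and `∞` to `∞`. -/
def IsEtaInv (ν : ProbabilityMeasure Circle) (r : ℝ) (g : ℂ → ℂ) : Prop :=
  DifferentiableOn ℂ g (D r ∪ Δ r) ∧ Set.MapsTo g (D r) (D 1) ∧ Set.MapsTo g (Δ r) (Δ 1) ∧
    g 0 = 0 ∧ Tendsto g (Bornology.cobounded ℂ) (Bornology.cobounded ℂ) ∧
    ∀ z ∈ D r ∪ Δ r, eta ν (g z) = z

/-- The inverse `η`-transform `η_ν⁻¹` near `0` and near `∞`. -/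
def etaInv (ν : ProbabilityMeasure Circle) : ℂ → ℂ :=
  Classical.epsilon fun g => ∃ r : ℝ, 0 < r ∧ r < 1 ∧ IsEtaInv ν r g

/-- The inverse `ψ_ν⁻¹(z) = η_ν⁻¹(z / (1 + z))`, near `0` and near `-1 = ψ_ν(∞)`. -/
def psiInv (ν : ProbabilityMeasure Circle) (z : ℂ) : ℂ := etaInv ν (z / (1 + z))

/-- The number `ζ` is in the domain of `ψ_ν⁻¹`. -/
def PsiInvDefinedAt (ν : ProbabilityMeasure Circle) (ζ : ℂ) : Prop :=
  1 + ζ ≠ 0 ∧ ∃ r : ℝ, 0 < r ∧ r < 1 ∧ IsEtaInv ν r (etaInv ν) ∧ ζ / (1 + ζ) ∈ D r ∪ Δ r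

/-- The transform `H_μ`. -/
def H (μ : ProbabilityMeasure Torus) (z w : ℂ) : ℂ :=
  ∫ p : Torus, 1 / ((1 - z * (p.1 : ℂ)) * (1 - w * (p.2 : ℂ))) ∂μ

/-- Extension of a function from `{z ≠ 0, w ≠ 0}` to the two coordinate axes by its limits: the
removable singularities are removed. -/
def extendAxes (f : ℂ × ℂ → ℂ) (p : ℂ × ℂ) : ℂ :=
  open scoped Classical in
  if p.1 ≠ 0 ∧ p.2 ≠ 0 then f p else extendFrom {q : ℂ × ℂ | q.1 ≠ 0 ∧ q.2 ≠ 0} f p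

/-- The bi-free partial `S`-transform. -/
def STransform (μ : ProbabilityMeasure Torus) : ℂ × ℂ → ℂ :=
  extendAxes fun p =>
    (1 + p.1) / p.1 * ((1 + p.2) / p.2) *
      (1 - (1 + p.1 + p.2) / H μ (psiInv (marg₁ μ) p.1) (psiInv (marg₂ μ) p.2))

/-- The opposite bi-free partial `S`-transform. -/
def SopTransform (μ : ProbabilityMeasure Torus) : ℂ × ℂ → ℂ :=
  extendAxes fun p =>
    p.2 * (p.1 + 1) / (p.1 * (p.2 + 1)) *
      (1 + (p.1 - p.2) / (H μ (psiInv (marg₁ μ) p.1) (psiInv (marg₂ μ) p.2) - p.1 - 1))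

/-- The change of variables `(z, w) ↦ (z / (1 - z), w / (1 - w))`. -/
def changeVar (p : ℂ × ℂ) : ℂ × ℂ := (p.1 / (1 - p.1), p.2 / (1 - p.2))

/-- The bi-free partial `Σ`-transform. -/
def SigmaTransform (μ : ProbabilityMeasure Torus) (p : ℂ × ℂ) : ℂ := STransform μ (changeVar p)

/-- The opposite bi-free partial `Σ`-transform. -/
def SigmaOpTransform (μ : ProbabilityMeasure Torus) (p : ℂ × ℂ) : ℂ := SopTransform μ (changeVar p)

/-- The inverses in the formula of the `S`-transform are defined at `p`, and its denominator does
not vanish. -/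
def SDefinedAt (μ : ProbabilityMeasure Torus) (p : ℂ × ℂ) : Prop :=
  PsiInvDefinedAt (marg₁ μ) p.1 ∧ PsiInvDefinedAt (marg₂ μ) p.2 ∧
    H μ (psiInv (marg₁ μ) p.1) (psiInv (marg₂ μ) p.2) ≠ 0

/-- The inverses in the formula of the opposite `S`-transform are defined at `p`, and, off the
coordinate axes (where the singularities are removable), its denominator does not vanish. -/
def SopDefinedAt (μ : ProbabilityMeasure Torus) (p : ℂ × ℂ) : Prop :=
  PsiInvDefinedAt (marg₁ μ) p.1 ∧ PsiInvDefinedAt (marg₂ μ) p.2 ∧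
    (p.1 ≠ 0 → p.2 ≠ 0 →
      H μ (psiInv (marg₁ μ) p.1) (psiInv (marg₂ μ) p.2) - p.1 - 1 ≠ 0)

end BiFree

end

noncomputable section

namespace BiFree

/-! ### Amplified operators `T ⊗ I` on `ℓ²` and when two of them commute. -/

section Amplification

variable {A M W K : Type} [NormedAddCommGroup K] [InnerProductSpace ℂ K]

/-! Everything is expressed through centred resolvents. Let Z and W be the inverse η-transforms of
the two marginals of μ at z and w. Then a = (1-z)(1-Zs)⁻¹ - 1 and b = (1-w)(1-Wt)⁻¹ - 1 have mean
zero, and κ = ∫ a b dμ = (1-z)(1-w) H_μ(Z, W) - 1 (`kappa`). In these terms Σ^op = w(κ+z) /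
(z(κ+w)).

Holomorphy: κ+w and κ+z are (1-z)(1-w) times H(Z,W)-H(Z,0) and H(Z,W)-H(0,W). The first difference
is divisible by W, the second by Z, so the quotient becomes (Z/z)/(W/w) times a quotient of divided
differences of H. Its denominator at the origin is governed by the nonzero mean of the second
marginal (`exists_isSigmaOp`).

Reflection: 1/(1-t/V) = 1 - 1/(1-V/t) on the circle gives H_μ(Z,1/V) = H_μ(Z,0) - H_{μ*}(Z,V), and
η_ν(1/z) is the reciprocal of η at z of the reflected measure. Substituting both turns the formula
for Σ_μ(z,1/w) into w(κ+z)/(z(κ+w)) with κ taken for μ* (`IsSigmaOp.sDefinedAt`).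

Multiplicativity: left and right variables commute and agree on the vacuum, so v₂v₁ may be replaced
by the product t₁t₂ of left variables in all moments ⟨ξ, (u₁u₂)^p (v₂v₁)^q ξ⟩ (`IsOppConv.moment`).
What remains is a computation with two free pairs. If Z = Z₁Z₂/z, then (1-Z u₁u₂)⁻¹ = (1-z)⁻¹
(1+A₂)(1-A₁A₂/z)⁻¹(1+A₁), with A_i the centred resolvents (`resolvent_mul`). Alternating centred
products have vanishing expectation, so pairing this with the analogous factorization in w leaves
the 2×2 system e₁ = 1+κ₁e₂/z, e₂ = 1+κ₂e₁/w, and κ = κ₁e₂+κ₂e₁ for the convolution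
(`FreeFrame.pairing`). Hence κ+z = e₁(κ₂+z), κ+w = e₂(κ₁+w) and z e₁(κ₂+w) = w e₂(κ₁+z), which is
multiplicativity of Σ^op (`sigma_mul_algebra`). -/

theorem slice_apply (e : A × M ≃ W) (m : M) (f : L2 W) (a : A) : slice e m f a = f (e (a, m)) :=
  rfl

theorem slice_ampl (b : HilbertBasis A ℂ K) (e : A × M ≃ W) (T : K →L[ℂ] K) (f : L2 W) (m : M) :
    slice e m (ampl b e T f) = b.repr (T (b.repr.symm (slice e m f))) := by
  ext a
  change b.repr (T (b.repr.symm (slice e (e.symm (e (a, m))).2 f))) (e.symm (e (a, m))).1 = _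
  rw [e.symm_apply_apply]

theorem ampl_apply (b : HilbertBasis A ℂ K) (e : A × M ≃ W) (T : K →L[ℂ] K) (f : L2 W) (a : A)
    (m : M) : ampl b e T f (e (a, m)) = b.repr (T (b.repr.symm (slice e m f))) a := by
  rw [← slice_ampl]; rfl

theorem ext_slice (e : A × M ≃ W) {f g : L2 W} (h : ∀ m, slice e m f = slice e m g) : f = g := by
  ext w
  obtain ⟨⟨a, m⟩, rfl⟩ := e.surjective w
  rw [← slice_apply, h, slice_apply]

/-- Amplification as a homomorphism of algebras. -/
def amplHom (b : HilbertBasis A ℂ K) (e : A × M ≃ W) :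
    (K →L[ℂ] K) →ₐ[ℂ] (L2 W →L[ℂ] L2 W) :=
  AlgHom.ofLinearMap
    { toFun := ampl b e
      map_add' := fun T S => by
        ext1 f
        refine ext_slice e fun m => ?_
        change _ = slice e m (ampl b e T f + ampl b e S f)
        simp only [slice_ampl, _root_.add_apply, map_add]
      map_smul' := fun c T => by
        ext1 f
        refine ext_slice e fun m => ?_
        simp only [slice_ampl, _root_.smul_apply, map_smul, RingHom.id_apply] }
    (by
      ext1 f
      refine ext_slice e fun m => ?_
      simp [slice_ampl])
    (fun T S => by
      ext1 f
      refine ext_slice e fun m => ?_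
      simp [slice_ampl])

theorem norm_ampl_le (b : HilbertBasis A ℂ K) (e : A × M ≃ W) (T : K →L[ℂ] K) :
    ‖ampl b e T‖ ≤ ‖T‖ :=
  LinearMap.mkContinuous_norm_le _ (norm_nonneg _) _

open scoped Classical in
theorem slice_single (e : A × M ≃ W) (a : A) (m n : M) :
    slice e n (lp.single 2 (e (a, m)) (1 : ℂ)) = if n = m then lp.single 2 a (1 : ℂ) else 0 := by
  ext a'
  rw [slice_apply, lp.single_apply]
  split_ifs with h
  · subst h
    rw [lp.single_apply]
    by_cases h' : a' = a
    · subst h'; simp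
    · rw [Pi.single_eq_of_ne h', Pi.single_eq_of_ne]
      exact fun h => h' (Prod.mk.inj (e.injective h)).1
  · rw [Pi.single_eq_of_ne]
    · rfl
    · exact fun h' => h (Prod.mk.inj (e.injective h')).2

open scoped Classical in
theorem ampl_single (b : HilbertBasis A ℂ K) (e : A × M ≃ W) (T : K →L[ℂ] K) (a a' : A)
    (m m' : M) : ampl b e T (lp.single 2 (e (a, m)) (1 : ℂ)) (e (a', m'))
      = if m' = m then b.repr (T (b a)) a' else 0 := by
  rw [ampl_apply, slice_single]
  split_ifs
  · rw [HilbertBasis.repr_symm_single]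
  · simp

/-- Replace the `A`-component of `w : W ≃ A × M`. -/
def replace (e : A × M ≃ W) (a : A) (w : W) : W := e (a, (e.symm w).2)

theorem replace_apply (e : A × M ≃ W) (a a' : A) (m : M) : replace e a (e (a', m)) = e (a, m) := by
  simp [replace]

variable {A' M' K' : Type} [NormedAddCommGroup K'] [InnerProductSpace ℂ K']

-- If the two replacements are independent at `w`, then `w` has two separate tensor legs. The matrix
-- coefficient of the product between `w` and `w₀` is then one coefficient per leg when `w₀` differs
-- from `w` in these legs only, and zero otherwise.
open scoped Classical in
theorem ampl_ampl_single (b : HilbertBasis A ℂ K) (e : A × M ≃ W) (T : K →L[ℂ] K)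
    (b' : HilbertBasis A' ℂ K') (e' : A' × M' ≃ W) (S : K' →L[ℂ] K') (w w₀ : W)
    (hp : ∀ a, (e'.symm (replace e a w)).1 = (e'.symm w).1)
    (hc : ∀ a a', replace e a (replace e' a' w) = replace e' a' (replace e a w)) :
    (∀ a a', replace e' a' (replace e a w) = w₀ →
      ampl b e T (ampl b' e' S (lp.single 2 w₀ (1 : ℂ))) w
        = b.repr (T (b a)) (e.symm w).1 * b'.repr (S (b' a')) (e'.symm w).1) ∧
    ((∀ a a', replace e' a' (replace e a w) ≠ w₀) →
      ampl b e T (ampl b' e' S (lp.single 2 w₀ (1 : ℂ))) w = 0) := by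
  have key : ∀ a, ampl b' e' S (lp.single 2 w₀ (1 : ℂ)) (replace e a w)
      = if (e'.symm (replace e a w)).2 = (e'.symm w₀).2 then
        b'.repr (S (b' (e'.symm w₀).1)) (e'.symm w).1 else 0 := by
    intro a
    have := ampl_single b' e' S (e'.symm w₀).1 (e'.symm (replace e a w)).1
      (e'.symm w₀).2 (e'.symm (replace e a w)).2
    rw [Prod.mk.eta, Equiv.apply_symm_apply, Prod.mk.eta, Equiv.apply_symm_apply, hp] at this
    exact this
  have hw : ampl b e T (ampl b' e' S (lp.single 2 w₀ (1 : ℂ))) w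
      = b.repr (T (b.repr.symm (slice e (e.symm w).2 (ampl b' e' S (lp.single 2 w₀ (1 : ℂ))))))
        (e.symm w).1 := rfl
  constructor
  · rintro a a' rfl
    have : slice e (e.symm w).2 (ampl b' e' S (lp.single 2 (replace e' a' (replace e a w)) (1 : ℂ)))
        = b'.repr (S (b' a')) (e'.symm w).1 • lp.single 2 a (1 : ℂ) := by
      ext a₁
      rw [slice_apply]
      change ampl b' e' S _ (replace e a₁ w) = _
      rw [key]
      by_cases h : a₁ = a
      · subst h
        simp [replace]
      · rw [if_neg]
        · simp [lp.single_apply, Pi.single_eq_of_ne h]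
        · intro h'
          apply h
          -- Only the slice entry `a` survives: after commuting the replacements, the `e`-leg is
          -- outermost and injectivity of `e` forces `a₁ = a`.
          have h1 : replace e' a' (replace e a₁ w) = replace e' a' (replace e a w) := by
            conv_lhs => rw [replace, h']
            simp [replace]
          rw [← hc, ← hc] at h1
          exact (Prod.mk.inj (e.injective h1)).1
    rw [hw, this]
    simp [mul_comm]
  · intro h
    have : slice e (e.symm w).2 (ampl b' e' S (lp.single 2 w₀ (1 : ℂ))) = 0 := by
      ext a₁
      rw [slice_apply]
      change ampl b' e' S _ (replace e a₁ w) = _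
      rw [key, if_neg]
      · rfl
      · intro h'
        -- If the remaining legs agreed, `w₀` would be reached from `w` by `a₁` and by its own
        -- `e'`-leg.
        apply h a₁ (e'.symm w₀).1
        rw [replace, h']
        simp
    rw [hw, this]
    simp

/-- A continuous linear functional on `ℓ²` is determined by its values on the basis vectors. -/
theorem clm_ext_single {E : Type*} [NormedAddCommGroup E] [NormedSpace ℂ E]
    {F G : L2 W →L[ℂ] E} [DecidableEq W]
    (h : ∀ w, F (lp.single 2 w (1 : ℂ)) = G (lp.single 2 w (1 : ℂ))) : F = G := by
  refine lp.ext_continuousLinearMap (by simp) fun w => ?_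
  ext1
  simpa using h w

/-- Evaluation of a vector in `ℓ²(W)` at a point. -/
def evalCLM (w : W) : L2 W →L[ℂ] ℂ :=
  LinearMap.mkContinuous
    { toFun := fun f => f w
      map_add' := fun _ _ => rfl
      map_smul' := fun _ _ => rfl } 1 fun f => by
    rw [one_mul]
    exact lp.norm_apply_le_norm (by simp) f w

theorem evalCLM_apply (w : W) (f : L2 W) : evalCLM w f = f w := rfl

/-- Operators acting on different tensor legs commute. The hypotheses concern the single word `w`,
because in the free product the legs are separate at most words but not at all of them. -/
theorem ampl_ampl_comm_apply (b : HilbertBasis A ℂ K) (e : A × M ≃ W) (T : K →L[ℂ] K)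
    (b' : HilbertBasis A' ℂ K') (e' : A' × M' ≃ W) (S : K' →L[ℂ] K') (w : W)
    (hp : ∀ a, (e'.symm (replace e a w)).1 = (e'.symm w).1)
    (hp' : ∀ a, (e.symm (replace e' a w)).1 = (e.symm w).1)
    (hc : ∀ a a', replace e a (replace e' a' w) = replace e' a' (replace e a w)) (f : L2 W) :
    ampl b e T (ampl b' e' S f) w = ampl b' e' S (ampl b e T f) w := by
  classical
  suffices (evalCLM w).comp ((ampl b e T).comp (ampl b' e' S))
      = (evalCLM w).comp ((ampl b' e' S).comp (ampl b e T)) from DFunLike.congr_fun this f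
  refine clm_ext_single fun w₀ => ?_
  simp only [ContinuousLinearMap.comp_apply, evalCLM_apply]
  have h1 := ampl_ampl_single b e T b' e' S w w₀ hp hc
  have h2 := ampl_ampl_single b' e' S b e T w w₀ hp' (fun a a' => (hc a' a).symm)
  by_cases h : ∃ a a', replace e' a' (replace e a w) = w₀
  · obtain ⟨a, a', h⟩ := h
    rw [h1.1 a a' h, h2.1 a' a (by rw [hc, h]), mul_comm]
  · push Not at h
    rw [h1.2 h, h2.2 fun a a' => by rw [hc]; exact h a' a]

end Amplification

/-! ### Alternating words split at both ends. -/

section Words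

variable {ι : Type} {J : ι → Type}

/-- The empty word or the word with one letter. -/
def Word.opt {i : ι} : Option (J i) → List (Σ i, J i)
  | none => []
  | some a => [⟨i, a⟩]

theorem Word.leftEquiv_val (i : ι) (a : Option (J i)) (m : WordNot J i) :
    (Word.leftEquiv J i (a, m)).1 = Word.opt a ++ m.1.1 := by
  cases a <;> rfl

theorem Word.rightEquiv_val (i : ι) (a : Option (J i)) (m : WordNot J i) :
    (Word.rightEquiv J i (a, m)).1 = m.1.1.reverse ++ Word.opt a := by
  cases a
  · exact (List.append_nil _).symm
  · exact List.reverse_cons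

theorem Word.mem_head?_opt {i : ι} (a : Option (J i)) {x} (hx : x ∈ (Word.opt a).head?) :
    x.1 = i := by
  cases a
  · simp [Word.opt] at hx
  · simp [Word.opt] at hx
    rw [← hx]

theorem Word.mem_getLast?_opt {i : ι} (a : Option (J i)) {x} (hx : x ∈ (Word.opt a).getLast?) :
    x.1 = i := by
  cases a
  · simp [Word.opt] at hx
  · simp [Word.opt] at hx
    rw [← hx]

theorem Word.isChain_opt {i : ι} (a : Option (J i)) :
    (Word.opt a).IsChain (fun x y => x.1 ≠ y.1) := by
  cases a <;> simp [Word.opt]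

/-- The condition on a word `m` that makes `a ++ m ++ a'` alternating, whatever letters `a`
of index `i` and `a'` of index `j`. -/
structure Word.IsMid (i j : ι) (m : List (Σ i, J i)) : Prop where
  chain : m.IsChain (fun x y => x.1 ≠ y.1)
  head : ∀ x ∈ m.head?, i ≠ x.1
  last : ∀ x ∈ m.getLast?, j ≠ x.1
  ne : m ≠ [] ∨ i ≠ j

theorem Word.IsMid.reverse {i j : ι} {m : List (Σ i, J i)} (hm : Word.IsMid i j m) :
    Word.IsMid j i m.reverse where
  chain := List.isChain_reverse.2 (hm.chain.imp fun _ _ => Ne.symm)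
  head := by simpa using hm.last
  last := by simpa using hm.head
  ne := by simpa [ne_comm] using hm.ne

theorem Word.IsMid.chain_left {i j : ι} {m : List (Σ i, J i)} (hm : Word.IsMid i j m)
    (a' : Option (J j)) : (m ++ Word.opt a').IsChain (fun x y => x.1 ≠ y.1) :=
  List.isChain_append.2 ⟨hm.chain, Word.isChain_opt a', fun x hx y hy => by
    rw [Word.mem_head?_opt a' hy]; exact (hm.last x hx).symm⟩

theorem Word.IsMid.head_left {i j : ι} {m : List (Σ i, J i)} (hm : Word.IsMid i j m)
    (a' : Option (J j)) : ∀ x ∈ (m ++ Word.opt a').head?, i ≠ x.1 := by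
  intro x hx
  cases m with
  | nil =>
    rw [Word.mem_head?_opt a' hx]
    exact hm.ne.resolve_left (by simp)
  | cons y t => exact hm.head x hx

theorem Word.IsMid.chain_glue {i j : ι} {m : List (Σ i, J i)} (hm : Word.IsMid i j m)
    (a : Option (J i)) (a' : Option (J j)) :
    (Word.opt a ++ (m ++ Word.opt a')).IsChain (fun x y => x.1 ≠ y.1) :=
  List.isChain_append.2 ⟨Word.isChain_opt a, hm.chain_left a', fun x hx y hy => by
    rw [Word.mem_getLast?_opt a hx]; exact hm.head_left a' y hy⟩

/-- The word `a ++ m ++ a'`. -/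
def Word.glue {i j : ι} {m : List (Σ i, J i)} (hm : Word.IsMid i j m) (a : Option (J i))
    (a' : Option (J j)) : Word J :=
  ⟨Word.opt a ++ (m ++ Word.opt a'), hm.chain_glue a a'⟩

theorem Word.opt_reverse {i : ι} (a : Option (J i)) : (Word.opt a).reverse = Word.opt a := by
  cases a <;> rfl

theorem Word.glue_eq_left {i j : ι} {m : List (Σ i, J i)} (hm : Word.IsMid i j m)
    (a : Option (J i)) (a' : Option (J j)) : Word.glue hm a a'
      = Word.leftEquiv J i (a, ⟨⟨m ++ Word.opt a', hm.chain_left a'⟩, hm.head_left a'⟩) :=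
  Subtype.ext (Word.leftEquiv_val i a
    ⟨⟨m ++ Word.opt a', hm.chain_left a'⟩, hm.head_left a'⟩).symm

theorem Word.glue_eq_right {i j : ι} {m : List (Σ i, J i)} (hm : Word.IsMid i j m)
    (a : Option (J i)) (a' : Option (J j)) : Word.glue hm a a'
      = Word.rightEquiv J j (a', ⟨⟨m.reverse ++ Word.opt a, hm.reverse.chain_left a⟩,
        hm.reverse.head_left a⟩) := by
  refine Subtype.ext ?_
  rw [Word.rightEquiv_val, List.reverse_append, List.reverse_reverse, Word.opt_reverse,
    List.append_assoc]
  rfl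

theorem Word.replace_left_glue {i j : ι} {m : List (Σ i, J i)} (hm : Word.IsMid i j m)
    (a b : Option (J i)) (a' : Option (J j)) :
    replace (Word.leftEquiv J i) b (Word.glue hm a a') = Word.glue hm b a' := by
  rw [Word.glue_eq_left, replace_apply, ← Word.glue_eq_left]

theorem Word.replace_right_glue {i j : ι} {m : List (Σ i, J i)} (hm : Word.IsMid i j m)
    (a : Option (J i)) (a' b : Option (J j)) :
    replace (Word.rightEquiv J j) b (Word.glue hm a a') = Word.glue hm a b := by
  rw [Word.glue_eq_right, replace_apply, ← Word.glue_eq_right]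

theorem Word.symm_left_glue {i j : ι} {m : List (Σ i, J i)} (hm : Word.IsMid i j m)
    (a : Option (J i)) (a' : Option (J j)) :
    ((Word.leftEquiv J i).symm (Word.glue hm a a')).1 = a := by
  rw [Word.glue_eq_left, Equiv.symm_apply_apply]

theorem Word.symm_right_glue {i j : ι} {m : List (Σ i, J i)} (hm : Word.IsMid i j m)
    (a : Option (J i)) (a' : Option (J j)) :
    ((Word.rightEquiv J j).symm (Word.glue hm a a')).1 = a' := by
  rw [Word.glue_eq_right, Equiv.symm_apply_apply]

/-- The empty word, as a word that does not begin with a letter of index `i`. -/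
def WordNot.nil (J : ι → Type) (i : ι) : WordNot J i := ⟨⟨[], List.IsChain.nil⟩, by simp⟩

theorem Word.left_nil_eq_right_nil (i : ι) (a : Option (J i)) :
    Word.leftEquiv J i (a, WordNot.nil J i) = Word.rightEquiv J i (a, WordNot.nil J i) := by
  refine Subtype.ext ?_
  rw [Word.leftEquiv_val, Word.rightEquiv_val]
  simp [WordNot.nil]

/-- A left and a right variable touch different letters of a word, except when `i = j` and the word
has at most one letter, of index `i`. There both act on the same leg, which is why this case is
listed apart. -/
theorem Word.exists_glue (i j : ι) (w : Word J) :
    (∃ (m : List (Σ i, J i)) (hm : Word.IsMid i j m) (a : Option (J i)) (a' : Option (J j)),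
      w = Word.glue hm a a') ∨
    (i = j ∧ ∃ a : Option (J i), w = Word.leftEquiv J i (a, WordNot.nil J i)) := by
  obtain ⟨⟨a, m⟩, rfl⟩ := (Word.leftEquiv J i).surjective w
  obtain ⟨⟨a', n⟩, hn⟩ := (Word.rightEquiv J j).surjective m.1
  have hn' : m.1.1 = n.1.1.reverse ++ Word.opt a' := by rw [← hn, Word.rightEquiv_val]
  by_cases hne : n.1.1.reverse = [] ∧ i = j
  · right
    obtain ⟨h1, rfl⟩ := hne
    refine ⟨rfl, a, ?_⟩
    congr 2
    refine Subtype.ext (Subtype.ext ?_)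
    rw [h1, List.nil_append] at hn'
    cases a' with
    | none => exact hn'
    -- The rest `m` cannot be a single letter of index `i`, since it does not begin with `i`.
    | some x => exact (m.2 ⟨i, x⟩ (by rw [hn']; simp [Word.opt]) rfl).elim
  · left
    refine ⟨n.1.1.reverse, ⟨List.isChain_reverse.2 (n.1.2.imp fun _ _ => Ne.symm), ?_, ?_, ?_⟩,
      a, a', ?_⟩
    · intro x hx
      refine m.2 x ?_
      rw [hn']
      cases h : n.1.1.reverse with
      | nil => rw [h] at hx; simp at hx
      | cons y t => rw [h] at hx; exact hx
    · simpa using n.2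
    · tauto
    · refine Subtype.ext ?_
      rw [Word.leftEquiv_val]
      exact congrArg (Word.opt a ++ ·) hn'

end Words

/-! ### Left and right variables on the free product, and centring by the first letter. -/

section FreeProduct

variable {ι : Type} {K : ι → Type} [∀ i, NormedAddCommGroup (K i)]
  [∀ i, InnerProductSpace ℂ (K i)] {ξ : ∀ i, K i} (B : ∀ i, PointedBasis (K i) (ξ i))

theorem leftVar_rightVar_apply_glue (i j : ι) (T : K i →L[ℂ] K i) (S : K j →L[ℂ] K j)
    {m : List (Σ i, (B i).J)} (hm : Word.IsMid (J := fun i => (B i).J) i j m)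
    (a : Option (B i).J) (a' : Option (B j).J) (f : FreeProd B) :
    leftVar B i T (rightVar B j S f) (Word.glue hm a a')
      = rightVar B j S (leftVar B i T f) (Word.glue hm a a') := by
  refine ampl_ampl_comm_apply _ _ _ _ _ _ _ ?_ ?_ ?_ f
  · intro x
    rw [Word.replace_left_glue, Word.symm_right_glue, Word.symm_right_glue]
  · intro x
    rw [Word.replace_right_glue, Word.symm_left_glue, Word.symm_left_glue]
  · intro x y
    rw [Word.replace_left_glue, Word.replace_right_glue, Word.replace_right_glue,
      Word.replace_left_glue]

theorem commute_leftVar_rightVar_of_ne {i j : ι} (hij : i ≠ j) (T : K i →L[ℂ] K i)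
    (S : K j →L[ℂ] K j) : Commute (leftVar B i T) (rightVar B j S) := by
  ext f w
  obtain ⟨m, hm, a, a', rfl⟩ := (Word.exists_glue i j w).resolve_right fun h => hij h.1
  exact leftVar_rightVar_apply_glue B i j T S hm a a' f

theorem slice_left_nil_eq (i : ι) (f : FreeProd B) :
    slice (Word.leftEquiv (fun i => (B i).J) i) (WordNot.nil _ i) f
      = slice (Word.rightEquiv (fun i => (B i).J) i) (WordNot.nil _ i) f := by
  ext a
  rw [slice_apply, slice_apply, Word.left_nil_eq_right_nil]

/-- With equal indices the variables may meet on the same letter. This happens on the copy of `K i`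
inside the free product, where they act as `T` and `S` themselves; elsewhere they act on separate
legs. -/
theorem commute_leftVar_rightVar {i : ι} {T S : K i →L[ℂ] K i} (h : Commute T S) :
    Commute (leftVar B i T) (rightVar B i S) := by
  ext f w
  obtain ⟨m, hm, a, a', rfl⟩ | ⟨-, a, rfl⟩ := Word.exists_glue i i w
  · exact leftVar_rightVar_apply_glue B i i T S hm a a' f
  · change leftVar B i T (rightVar B i S f) _ = rightVar B i S (leftVar B i T f) _
    conv_rhs => rw [Word.left_nil_eq_right_nil, rightVar, ampl_apply, ← slice_left_nil_eq, leftVar,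
      slice_ampl]
    conv_lhs => rw [leftVar, ampl_apply, slice_left_nil_eq, rightVar, slice_ampl,
      ← slice_left_nil_eq]
    have := DFunLike.congr_fun h.eq
      ((B i).b.repr.symm (slice (Word.leftEquiv (fun i => (B i).J) i) (WordNot.nil _ i) f))
    change T (S _) = S (T _) at this
    simp [this]

theorem vacuum_eq (i : ι) [DecidableEq (Word fun i => (B i).J)] : vacuum B
    = lp.single 2 (Word.leftEquiv (fun i => (B i).J) i (none, WordNot.nil _ i)) (1 : ℂ) := by
  rw [vacuum]
  congr!

open scoped Classical in
theorem leftVar_vacuum_apply (i : ι) (T : K i →L[ℂ] K i) (a : Option (B i).J)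
    (m : WordNot (fun i => (B i).J) i) :
    leftVar B i T (vacuum B) (Word.leftEquiv (fun i => (B i).J) i (a, m))
      = if m = WordNot.nil _ i then (B i).b.repr (T ((B i).b none)) a else 0 := by
  rw [@vacuum_eq _ _ _ _ _ B i fun _ _ => Classical.propDecidable _]
  refine (ampl_single (B i).b (Word.leftEquiv (fun i => (B i).J) i) T none a
    (WordNot.nil _ i) m).trans ?_
  split_ifs <;> rfl

open scoped Classical in
theorem rightVar_vacuum_apply (i : ι) (T : K i →L[ℂ] K i) (a : Option (B i).J)
    (m : WordNot (fun i => (B i).J) i) :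
    rightVar B i T (vacuum B) (Word.rightEquiv (fun i => (B i).J) i (a, m))
      = if m = WordNot.nil _ i then (B i).b.repr (T ((B i).b none)) a else 0 := by
  rw [@vacuum_eq _ _ _ _ _ B i fun _ _ => Classical.propDecidable _, Word.left_nil_eq_right_nil]
  refine (ampl_single (B i).b (Word.rightEquiv (fun i => (B i).J) i) T none a
    (WordNot.nil _ i) m).trans ?_
  split_ifs <;> rfl

/-- Both sides are `T ξ_i` inside the copy of `K i` spanned by the words with at most one letter, on
which splitting from the left and from the right coincide. -/
theorem rightVar_vacuum (i : ι) (T : K i →L[ℂ] K i) :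
    rightVar B i T (vacuum B) = leftVar B i T (vacuum B) := by
  classical
  ext w
  obtain ⟨⟨a, m⟩, rfl⟩ := (Word.leftEquiv (fun i => (B i).J) i).surjective w
  rw [leftVar_vacuum_apply]
  split_ifs with h
  · subst h
    rw [Word.left_nil_eq_right_nil, rightVar_vacuum_apply, if_pos rfl]
  · obtain ⟨⟨a', m'⟩, h'⟩ := (Word.rightEquiv (fun i => (B i).J) i).surjective
      (Word.leftEquiv (fun i => (B i).J) i (a, m))
    rw [← h', rightVar_vacuum_apply, if_neg]
    rintro rfl
    rw [← Word.left_nil_eq_right_nil] at h'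
    exact h (Prod.mk.inj ((Word.leftEquiv (fun i => (B i).J) i).injective h')).2.symm

/-- The vectors supported on the words that begin with a letter of index `i`. -/
def headIs (i : ι) : Submodule ℂ (FreeProd B) where
  carrier := {f | ∀ m, f (Word.leftEquiv (fun i => (B i).J) i (none, m)) = 0}
  add_mem' hf hg m := by rw [lp.coeFn_add, Pi.add_apply, hf, hg, add_zero]
  zero_mem' _ := rfl
  smul_mem' c f hf m := by rw [lp.coeFn_smul, Pi.smul_apply, hf, smul_zero]

/-- The vectors supported on the words that do not begin with a letter of index `i`. -/
def headIsNot (i : ι) : Submodule ℂ (FreeProd B) where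
  carrier := {f | ∀ a m, f (Word.leftEquiv (fun i => (B i).J) i (some a, m)) = 0}
  add_mem' hf hg a m := by rw [lp.coeFn_add, Pi.add_apply, hf, hg, add_zero]
  zero_mem' _ _ := rfl
  smul_mem' c f hf a m := by rw [lp.coeFn_smul, Pi.smul_apply, hf, smul_zero]

theorem isClosed_headIs (i : ι) : IsClosed (headIs B i : Set (FreeProd B)) := by
  have : (headIs B i : Set (FreeProd B)) = ⋂ m : WordNot (fun i => (B i).J) i,
      {f | evalCLM (Word.leftEquiv (fun i => (B i).J) i (none, m)) f = 0} := by
    ext f; simp [headIs, evalCLM_apply]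
  rw [this]
  exact isClosed_iInter fun m => isClosed_eq (ContinuousLinearMap.continuous _) continuous_const

theorem isClosed_headIsNot (i : ι) : IsClosed (headIsNot B i : Set (FreeProd B)) := by
  have : (headIsNot B i : Set (FreeProd B)) = ⋂ a, ⋂ m : WordNot (fun i => (B i).J) i,
      {f | evalCLM (Word.leftEquiv (fun i => (B i).J) i (some a, m)) f = 0} := by
    ext f; simp [headIsNot, evalCLM_apply]
  rw [this]
  exact isClosed_iInter fun a => isClosed_iInter fun m =>
    isClosed_eq (ContinuousLinearMap.continuous _) continuous_const

theorem headIs_le_headIsNot {i j : ι} (hij : i ≠ j) : headIs B i ≤ headIsNot B j := by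
  intro f hf a m
  have := hf ⟨Word.leftEquiv (fun i => (B i).J) j (some a, m), by
    rw [Word.leftEquiv_val]
    simpa [Word.opt] using hij⟩
  exact this

theorem vacuum_mem (i : ι) : vacuum B ∈ headIsNot B i := by
  classical
  intro a m
  rw [vacuum_eq B i, lp.single_apply, Pi.single_eq_of_ne]
  intro h
  simpa using (Word.leftEquiv (fun i => (B i).J) i).injective h

theorem inner_vacuum (f : FreeProd B) : inner ℂ (vacuum B) f = f ⟨[], List.IsChain.nil⟩ := by
  classical
  rw [vacuum, lp.inner_single_left]
  simp

theorem inner_vacuum_headIs {i : ι} {f : FreeProd B} (hf : f ∈ headIs B i) :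
    inner ℂ (vacuum B) f = 0 := by
  rw [inner_vacuum]
  exact hf (WordNot.nil _ i)

theorem inner_vacuum_vacuum : inner ℂ (vacuum B) (vacuum B) = (1 : ℂ) := by
  classical
  rw [inner_vacuum, vacuum, lp.single_apply_self]

theorem norm_vacuum : ‖vacuum B‖ = 1 := by
  classical
  rw [vacuum, lp.norm_single (by norm_num), norm_one]

/-- Such an `f` is `ξ_i ⊗ f`, so the left variable gives `T ξ_i ⊗ f`; subtracting the
`ξ_i`-component of `T ξ_i` leaves a centred first letter. This is the only form in which freeness is
used later. -/
theorem leftVar_sub_smul_mem (i : ι) (T : K i →L[ℂ] K i) {f : FreeProd B}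
    (hf : f ∈ headIsNot B i) :
    leftVar B i T f - (inner ℂ (ξ i) (T (ξ i)) : ℂ) • f ∈ headIs B i := by
  classical
  intro m
  -- Each slice of `f` is a multiple of the basis vector belonging to `ξ_i`.
  have hs : slice (Word.leftEquiv (fun i => (B i).J) i) m f
      = f (Word.leftEquiv (fun i => (B i).J) i (none, m)) • lp.single 2 none (1 : ℂ) := by
    ext a
    rw [slice_apply]
    cases a with
    | none => simp
    | some a => rw [hf a m]; simp [lp.single_apply]
  rw [lp.coeFn_sub, lp.coeFn_smul, Pi.sub_apply, Pi.smul_apply, leftVar, ampl_apply, hs]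
  simp only [map_smul, HilbertBasis.repr_symm_single, (B i).b_none, lp.coeFn_smul, Pi.smul_apply,
    HilbertBasis.repr_apply_apply, smul_eq_mul]
  ring

end FreeProduct

end BiFree

end

noncomputable section

namespace BiFree

/-! ### Multiplication operators on `L²(μ)`. -/

section MulOp

variable (μ : ProbabilityMeasure Torus)

theorem coeFn_mulOp (f : C(Torus, ℂ)) (g : HilbertL2 μ) :
    mulOp μ f g =ᵐ[(μ : Measure Torus)] fun x => f x * g x := by
  have h1 := (ContinuousLinearMap.mul ℂ ℂ).coeFn_holder (r := 2)
    (ContinuousMap.toLp ∞ (μ : Measure Torus) ℂ f) g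
  have h2 := ContinuousMap.coeFn_toLp (p := ∞) (𝕜 := ℂ) (μ : Measure Torus) f
  refine EventuallyEq.trans h1 ?_
  filter_upwards [h2] with x hx
  rw [hx]
  rfl

/-- The representation of the continuous functions by multiplication operators. -/
def mulHom : C(Torus, ℂ) →ₐ[ℂ] (HilbertL2 μ →L[ℂ] HilbertL2 μ) :=
  AlgHom.ofLinearMap
    { toFun := mulOp μ
      map_add' := fun f g => by simp [mulOp]
      map_smul' := fun c f => by simp [mulOp] }
    (by
      ext1 g
      refine Lp.ext ((coeFn_mulOp μ 1 g).trans ?_)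
      exact .of_forall fun x => one_mul _)
    (fun f f' => by
      ext1 g
      refine Lp.ext ((coeFn_mulOp μ (f * f') g).trans ?_)
      refine EventuallyEq.trans ?_ (coeFn_mulOp μ f (mulOp μ f' g)).symm
      filter_upwards [coeFn_mulOp μ f' g] with x hx
      rw [hx, ContinuousMap.mul_apply, mul_assoc])

theorem norm_mulOp_le (f : C(Torus, ℂ)) : ‖mulOp μ f‖ ≤ ‖f‖ := by
  have h1 : ‖(ContinuousMap.toLp ∞ (μ : Measure Torus) ℂ : C(Torus, ℂ) →L[ℂ] _)‖ ≤ 1 := by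
    refine (ContinuousMap.toLp_norm_le (E := ℂ) (p := ∞) (μ : Measure Torus) (𝕜 := ℂ)).trans ?_
    simp
  have h2 : ‖(ContinuousLinearMap.mul ℂ ℂ).holderL (μ : Measure Torus) ∞ 2 2‖ ≤ 1 :=
    ((ContinuousLinearMap.mul ℂ ℂ).norm_holderL_le).trans (ContinuousLinearMap.opNorm_mul_le ℂ ℂ)
  calc ‖mulOp μ f‖ ≤ ‖(ContinuousLinearMap.mul ℂ ℂ).holderL (μ : Measure Torus) ∞ 2 2‖
        * ‖ContinuousMap.toLp ∞ (μ : Measure Torus) ℂ f‖ := ContinuousLinearMap.le_opNorm _ _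
    _ ≤ 1 * (1 * ‖f‖) := by
        gcongr
        exact (ContinuousLinearMap.le_opNorm _ _).trans (by gcongr)
    _ = ‖f‖ := by ring

theorem inner_mulOp_oneL2 (f : C(Torus, ℂ)) :
    inner ℂ (oneL2 μ) (mulOp μ f (oneL2 μ)) = ∫ x, f x ∂(μ : Measure Torus) := by
  rw [MeasureTheory.L2.inner_def]
  refine integral_congr_ae ?_
  have h : oneL2 μ =ᵐ[(μ : Measure Torus)] fun _ => (1 : ℂ) := Lp.coeFn_const ..
  filter_upwards [coeFn_mulOp μ f (oneL2 μ), h] with x h1 h2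
  rw [h1, h2]
  simp

end MulOp

/-! ### Existence of the joint law of commuting unitaries. -/

section JointLaw

open scoped CompactlySupported

variable {H : Type} [NormedAddCommGroup H] [InnerProductSpace ℂ H] [CompleteSpace H]

/-- A state on the continuous functions on a compact space is given by a measure. -/
theorem exists_measure_of_starAlgHom {X : Type} [TopologicalSpace X] [CompactSpace X] [T2Space X]
    [MeasurableSpace X] [BorelSpace X] (π : C(X, ℂ) →⋆ₐ[ℂ] (H →L[ℂ] H)) {Ω : H} (hΩ : ‖Ω‖ = 1) :
    ∃ m : Measure X, IsProbabilityMeasure m ∧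
      ∀ f : C(X, ℂ), ∫ x, f x ∂m = inner ℂ Ω (π f Ω) := by
  let ofR : C(X, ℝ) → C(X, ℂ) := fun f => ⟨fun x => (f x : ℂ), by fun_prop⟩
  have hreal : ∀ f : C(X, ℝ), ((inner ℂ Ω (π (ofR f) Ω) : ℂ).re : ℂ) = inner ℂ Ω (π (ofR f) Ω) := by
    intro f
    rw [← Complex.conj_eq_iff_re, inner_conj_symm, ← ContinuousLinearMap.adjoint_inner_right,
      ← ContinuousLinearMap.star_eq_adjoint, ← map_star]
    congr 3
    ext x
    simp [ofR]
  have hadd : ∀ f g : C(X, ℝ), ofR (f + g) = ofR f + ofR g := by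
    intro f g; ext x; simp [ofR]
  have hsmul : ∀ (c : ℝ) (f : C(X, ℝ)), ofR (c • f) = (c : ℂ) • ofR f := by
    intro c f; ext x; simp [ofR]
  have hpos : ∀ f : C(X, ℝ), 0 ≤ f → 0 ≤ (inner ℂ Ω (π (ofR f) Ω) : ℂ).re := by
    intro f hf
    -- Positivity: `f` is the square of its root `g`, so the state takes the value `‖π(g) Ω‖²` on
    -- it, and Riesz–Markov applies.
    let g : C(X, ℝ) := ⟨fun x => Real.sqrt (f x), by fun_prop⟩
    have : ofR f = star (ofR g) * ofR g := by
      ext x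
      simp only [ofR, g, ContinuousMap.coe_mk, ContinuousMap.mul_apply, ContinuousMap.star_apply]
      simp only [RCLike.star_def, Complex.conj_ofReal]
      rw [← Complex.ofReal_mul, show √(f x) * √(f x) = f x from Real.mul_self_sqrt (hf x)]
    rw [this, map_mul, map_star, ContinuousLinearMap.star_eq_adjoint]
    change 0 ≤ (inner ℂ Ω (ContinuousLinearMap.adjoint (π (ofR g)) (π (ofR g) Ω)) : ℂ).re
    rw [ContinuousLinearMap.adjoint_inner_right, inner_self_eq_norm_sq_to_K]
    norm_cast
    exact sq_nonneg _
  let Λ : C_c(X, ℝ) →ₚ[ℝ] ℝ :=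
    { toFun := fun f => (inner ℂ Ω (π (ofR f.toContinuousMap) Ω) : ℂ).re
      map_add' := fun f g => by
        change (inner ℂ Ω (π (ofR (f.toContinuousMap + g.toContinuousMap)) Ω) : ℂ).re = _
        rw [hadd, map_add, _root_.add_apply, inner_add_right, Complex.add_re]
      map_smul' := fun c f => by
        change (inner ℂ Ω (π (ofR (c • f.toContinuousMap)) Ω) : ℂ).re = _
        rw [hsmul, map_smul, _root_.smul_apply, inner_smul_right, Complex.re_ofReal_mul]
        rfl
      monotone' := fun f g hfg => by
        have h := hpos (g.toContinuousMap - f.toContinuousMap) fun x => sub_nonneg.2 (hfg x)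
        have h2 : ofR g.toContinuousMap
            = ofR (g.toContinuousMap - f.toContinuousMap) + ofR f.toContinuousMap := by
          rw [← hadd, sub_add_cancel]
        change (inner ℂ Ω (π (ofR f.toContinuousMap) Ω) : ℂ).re
          ≤ (inner ℂ Ω (π (ofR g.toContinuousMap) Ω) : ℂ).re
        rw [h2, map_add, _root_.add_apply, inner_add_right, Complex.add_re]
        linarith }
  let m := RealRMK.rieszMeasure Λ
  have hm : ∀ f : C(X, ℝ), ((∫ x, f x ∂m : ℝ) : ℂ) = inner ℂ Ω (π (ofR f) Ω) := by
    intro f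
    rw [← hreal]
    exact congrArg _ (RealRMK.integral_rieszMeasure Λ ⟨f, HasCompactSupport.of_compactSpace _⟩)
  have hfin : IsFiniteMeasure m := inferInstance
  refine ⟨m, ?_, ?_⟩
  · have h1 := hm 1
    have h2 : ofR 1 = 1 := by ext x; simp [ofR]
    rw [h2, map_one, one_apply_eq_self, inner_self_eq_norm_sq_to_K, hΩ] at h1
    simp at h1
    constructor
    rw [measureReal_def] at h1
    have h3 : (m Set.univ).toReal = 1 := by exact_mod_cast h1
    rwa [ENNReal.toReal_eq_one_iff] at h3
  · intro f
    let re : C(X, ℝ) := ⟨fun x => (f x).re, by fun_prop⟩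
    let im : C(X, ℝ) := ⟨fun x => (f x).im, by fun_prop⟩
    have hf : f = ofR re + Complex.I • ofR im := by
      ext x
      simp [ofR, re, im, mul_comm Complex.I, Complex.re_add_im]
    have hint : Integrable (fun x => f x) m :=
      (BoundedContinuousFunction.mkOfCompact f).integrable m
    have h4 := integral_re_add_im hint
    rw [← h4]
    conv_rhs => rw [hf, map_add, map_smul, _root_.add_apply, _root_.smul_apply, inner_add_right,
      inner_smul_right, ← hm, ← hm]
    rw [mul_comm Complex.I]
    rfl

/-- Commuting unitaries have a joint law. -/
theorem exists_isJointLaw {U V : H →L[ℂ] H} (hU : U ∈ unitary (H →L[ℂ] H))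
    (hV : V ∈ unitary (H →L[ℂ] H)) (hUV : Commute U V) {Ω : H} (hΩ : ‖Ω‖ = 1) :
    ∃ ν, IsJointLaw U V Ω ν := by
  -- Unitarity gives commutation with the adjoints directly, without Fuglede's theorem.
  have hUsV : Commute (star U) V := by
    have h1 := hU.1
    have h2 := hU.2
    calc star U * V = star U * V * (U * star U) := by rw [h2, mul_one]
      _ = star U * (U * V) * star U := by rw [hUV.eq]; simp only [mul_assoc]
      _ = V * star U := by rw [← mul_assoc, h1, one_mul]
  have hUVs : Commute U (star V) := by simpa using hUsV.star_star
  have hUU : Commute U (star U) := hU.2.trans hU.1.symm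
  have hVV : Commute V (star V) := hV.2.trans hV.1.symm
  -- The double commutant of the pair is norm closed and commutative, hence a commutative C*-algebra
  -- to which Gelfand's theorem applies.
  let G : StarSubalgebra ℂ (H →L[ℂ] H) :=
    StarSubalgebra.centralizer ℂ (StarSubalgebra.centralizer ℂ ({U, V} : Set (H →L[ℂ] H)))
  have hGset : (G : Set (H →L[ℂ] H))
      = (({U, V} : Set (H →L[ℂ] H)) ∪ star {U, V}).centralizer.centralizer :=
    StarSubalgebra.coe_centralizer_centralizer ℂ _
  have hGcl : IsClosed (G : Set (H →L[ℂ] H)) := by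
    rw [hGset]
    exact Set.isClosed_centralizer _
  have hGcomm : ∀ x y : G, x * y = y * x := by
    rintro ⟨x, hx⟩ ⟨y, hy⟩
    rw [← SetLike.mem_coe, hGset] at hx hy
    refine Subtype.ext (Set.centralizer_centralizer_comm_of_comm ?_ x hx y hy)
    have hs : star ({U, V} : Set (H →L[ℂ] H)) = {star U, star V} := by
      rw [← Set.image_star, Set.image_pair]
    rw [hs]
    rintro a ((rfl | rfl) | (rfl | rfl)) b ((rfl | rfl) | (rfl | rfl))
    all_goals first
      | rfl
      | exact hUV.eq | exact hUV.symm.eq | exact hUsV.eq | exact hUsV.symm.eq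
      | exact hUVs.eq | exact hUVs.symm.eq | exact hUU.eq | exact hUU.symm.eq
      | exact hVV.eq | exact hVV.symm.eq | exact hUV.star_star.eq | exact hUV.star_star.symm.eq
  have hsub : ({U, V} : Set (H →L[ℂ] H)) ⊆ G := by
    rw [hGset]
    exact Set.subset_union_left.trans Set.subset_centralizer_centralizer
  let : CommCStarAlgebra G := { StarSubalgebra.cstarAlgebra G with mul_comm := hGcomm }
  let u : G := ⟨U, hsub (by simp)⟩
  let v : G := ⟨V, hsub (by simp)⟩
  let X := WeakDual.characterSpace ℂ G
  let T : G ≃⋆ₐ[ℂ] C(X, ℂ) := gelfandStarTransform G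
  let : MeasurableSpace X := borel X
  have : BorelSpace X := ⟨rfl⟩
  let π : C(X, ℂ) →⋆ₐ[ℂ] (H →L[ℂ] H) := (G.subtype).comp (T.symm : C(X, ℂ) →⋆ₐ[ℂ] G)
  have hπ : ∀ g : G, π (T g) = g := fun g => by
    change ((T.symm (T g) : G) : H →L[ℂ] H) = g
    rw [T.symm_apply_apply]
  obtain ⟨m, hm, hmf⟩ := exists_measure_of_starAlgHom π hΩ
  have hnorm : ∀ g : G, star g * g = 1 → ∀ x : X, ‖T g x‖ = 1 := by
    intro g hg x
    have h1 : star (T g) * T g = 1 := by rw [← map_star, ← map_mul, hg, map_one]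
    have h2 := DFunLike.congr_fun h1 x
    simp only [ContinuousMap.mul_apply, ContinuousMap.star_apply, ContinuousMap.one_apply,
      RCLike.star_def] at h2
    rw [mul_comm, Complex.mul_conj, Complex.normSq_eq_norm_sq] at h2
    have h3 : ‖T g x‖ ^ 2 = 1 := by exact_mod_cast h2
    exact (pow_eq_one_iff_of_nonneg (norm_nonneg _) (by norm_num)).1 h3
  have hu := hnorm u (Subtype.ext hU.1)
  have hv := hnorm v (Subtype.ext hV.1)
  -- The Gelfand transforms of `U` and `V` are unimodular, so they map the character space to the
  -- torus; the law is the image of the Riesz measure.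
  let F : X → Torus := fun x =>
    (⟨T u x, mem_sphere_zero_iff_norm.2 (hu x)⟩, ⟨T v x, mem_sphere_zero_iff_norm.2 (hv x)⟩)
  have hF : Continuous F :=
    (Continuous.subtype_mk (T u).continuous _).prodMk (Continuous.subtype_mk (T v).continuous _)
  have hFm : AEMeasurable F m := hF.measurable.aemeasurable
  refine ⟨⟨m.map F, Measure.isProbabilityMeasure_map hFm⟩, ?_⟩
  intro p p' q q'
  change ∫ x : Torus, _ ∂(m.map F) = _
  rw [integral_map hFm (Continuous.aestronglyMeasurable (by fun_prop))]
  have := hmf (T (u ^ p * star u ^ p' * (v ^ q * star v ^ q')))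
  rw [hπ] at this
  refine Eq.trans ?_ this
  simp only [map_mul, map_pow, map_star]
  rfl

end JointLaw

end BiFree

end

noncomputable section

namespace BiFree

/-! ### Resolvents of products and expectations of alternating centred operators. -/

section Neumann

variable {E : Type*} [NormedAddCommGroup E] [NormedSpace ℂ E] [CompleteSpace E]

/-- The Neumann series. Its partial sums preserve every `T`-invariant subspace, and closedness
carries this over to the inverse; later the subspaces are those defined by the first letter. -/
theorem exists_inverse_one_sub {T : E →L[ℂ] E} (hT : ‖T‖ < 1) :
    ∃ P : E →L[ℂ] E, (1 - T) * P = 1 ∧ P * (1 - T) = 1 ∧ HasSum (fun n => T ^ n) P ∧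
      ∀ M : Submodule ℂ E, IsClosed (M : Set E) → (∀ v ∈ M, T v ∈ M) → ∀ v ∈ M, P v ∈ M := by
  have hs : Summable fun n : ℕ => T ^ n := summable_geometric_of_norm_lt_one hT
  refine ⟨∑' n, T ^ n, mul_neg_geom_series T hT, geom_series_mul_neg T hT, hs.hasSum, ?_⟩
  intro M hM hTM v hv
  have hn : ∀ n : ℕ, (T ^ n) v ∈ M := by
    intro n
    induction n with
    | zero => simpa using hv
    | succ n ih => rw [pow_succ']; exact hTM _ ih
  have h1 : HasSum (fun n : ℕ => (T ^ n) v) ((∑' n, T ^ n : E →L[ℂ] E) v) :=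
    hs.hasSum.mapL (ContinuousLinearMap.apply ℂ E v)
  refine hM.mem_of_tendsto h1 (.of_forall fun s => M.sum_mem fun n _ => hn n)

end Neumann

/-- The factorization of the resolvent of a product. -/
theorem resolvent_mul {R : Type*} [Ring R] [Algebra ℂ R] {s₁ s₂ A₁ A₂ P : R} {Z₁ Z₂ Z z : ℂ}
    (hz : z ≠ 0) (hz1 : z ≠ 1) (hZ : Z * z = Z₁ * Z₂)
    (h₁ : (1 - Z₁ • s₁) * (1 + A₁) = (1 - z) • (1 : R))
    (h₂ : (1 + A₂) * (1 - Z₂ • s₂) = (1 - z) • (1 : R))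
    (h₂' : (1 - Z₂ • s₂) * (1 + A₂) = (1 - z) • (1 : R))
    (hP : (1 - z⁻¹ • (A₁ * A₂)) * P = 1) :
    (1 - Z • (s₁ * s₂)) * ((1 - z)⁻¹ • ((1 + A₂) * P * (1 + A₁))) = 1 := by
  have hc : (1 - z) * z ≠ 0 := mul_ne_zero (sub_ne_zero.2 hz1.symm) hz
  have hG : (z • (1 : R) - A₁ * A₂) * P = z • (1 : R) := by
    have : z • (1 : R) - A₁ * A₂ = z • (1 - z⁻¹ • (A₁ * A₂)) := by
      rw [smul_sub, smul_smul, mul_inv_cancel₀ hz, one_smul]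
    rw [this, smul_mul_assoc, hP]
  set r₁ := 1 - Z₁ • s₁ with hr₁
  set r₂ := 1 - Z₂ • s₂ with hr₂
  have e₁ : r₁ * A₁ = (1 - z) • (1 : R) - r₁ := by rw [← h₁]; noncomm_ring
  have e₂ : A₂ * r₂ = (1 - z) • (1 : R) - r₂ := by rw [← h₂]; noncomm_ring
  have hs : z • (Z • (s₁ * s₂)) = (1 - r₁) * (1 - r₂) := by
    rw [hr₁, hr₂, _root_.sub_sub_cancel, _root_.sub_sub_cancel, smul_mul_smul_comm, smul_smul, mul_comm z, hZ]
  -- Multiplying out, `r₁ A₁` and `A₂ r₂` are scalars minus `r₁`, `r₂`, and what is left is `(1 -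
  -- r₁)(1 - r₂) = Z₁ Z₂ s₁ s₂ = z Z s₁ s₂`.
  have key : r₁ * (z • (1 : R) - A₁ * A₂) * r₂ = ((1 - z) * z) • (1 - Z • (s₁ * s₂)) := by
    have : r₁ * (z • (1 : R) - A₁ * A₂) * r₂ = z • (r₁ * r₂) - (r₁ * A₁) * (A₂ * r₂) := by
      simp only [mul_sub, sub_mul, mul_smul_comm, smul_mul_assoc, mul_one, mul_assoc]
    rw [this, e₁, e₂, mul_smul, smul_sub z, hs]
    simp only [mul_sub, sub_mul, mul_smul_comm, smul_mul_assoc, mul_one, one_mul, smul_sub,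
      sub_smul, one_smul]
    abel
  have h3 : ((1 - z) * z) • ((1 - Z • (s₁ * s₂)) * ((1 + A₂) * P * (1 + A₁)))
      = ((1 - z) * z) • ((1 - z) • (1 : R)) := by
    rw [← smul_mul_assoc, ← key]
    calc r₁ * (z • (1 : R) - A₁ * A₂) * r₂ * ((1 + A₂) * P * (1 + A₁))
        = r₁ * (z • (1 : R) - A₁ * A₂) * (r₂ * (1 + A₂)) * P * (1 + A₁) := by
          simp only [mul_assoc]
      _ = (1 - z) • (r₁ * ((z • (1 : R) - A₁ * A₂) * P) * (1 + A₁)) := by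
          rw [h₂']
          simp only [mul_smul_comm, smul_mul_assoc, mul_one, mul_assoc]
      _ = ((1 - z) * z) • ((1 - z) • (1 : R)) := by
          rw [hG, mul_smul_comm, mul_one, smul_mul_assoc, h₁, mul_smul]
  have h4 := smul_right_injective R hc h3
  rw [mul_smul_comm, h4, smul_smul, inv_mul_cancel₀ (sub_ne_zero.2 hz1.symm), one_smul]

/-- Two families of operators that act like two free algebras: `M₁`, `M₂` play the role of the
vectors that begin with a centred vector of the respective index, `N₁`, `N₂` of those that do not. -/
structure FreeFrame (E : Type*) [NormedAddCommGroup E] [NormedSpace ℂ E] where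
  (Ω : E) (φ : E →L[ℂ] ℂ) (M₁ M₂ N₁ N₂ : Submodule ℂ E)
  φΩ : φ Ω = 1
  closed₁ : IsClosed (M₁ : Set E)
  closedN₂ : IsClosed (N₂ : Set E)
  le₁ : M₁ ≤ N₂
  le₂ : M₂ ≤ N₁
  mem₁ : Ω ∈ N₁
  mem₂ : Ω ∈ N₂
  zero₁ : ∀ v ∈ M₁, φ v = 0
  zero₂ : ∀ v ∈ M₂, φ v = 0

variable {E : Type*} [NormedAddCommGroup E] [NormedSpace ℂ E]

/-- In the Neumann expansion, `g` is `φ` applied to the empty product and the alternating products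
whose rightmost factor is `A₂`, `h` the same for `A₁`. Peeling off the rightmost factor gives the
two recursions. The functionals kill `M₁` and `M₂` respectively because alternation keeps the
vectors centred. -/
theorem FreeFrame.row (F : FreeFrame E) {A₁ A₂ P : E →L[ℂ] E} {z : ℂ}
    (hA₁ : ∀ v ∈ F.N₁, A₁ v ∈ F.M₁) (hA₂ : ∀ v ∈ F.N₂, A₂ v ∈ F.M₂) (hz : z ≠ 0)
    (hP : P * (1 - z⁻¹ • (A₁ * A₂)) = 1) (hPM : ∀ v ∈ F.M₁, P v ∈ F.M₁) :
    ∃ g h : E →L[ℂ] ℂ, (∀ v ∈ F.M₁, g v = 0) ∧ (∀ v ∈ F.M₂, h v = 0) ∧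
      (∀ v, g v = F.φ v + h (A₂ v)) ∧ (∀ v, h v = F.φ v + z⁻¹ * g (A₁ v)) ∧
      ∀ v, F.φ (((1 + A₂) * P * (1 + A₁)) v) = g v + z * (h v - F.φ v) := by
  let g : E →L[ℂ] ℂ := F.φ ∘L ((1 + A₂) * P)
  let h : E →L[ℂ] ℂ := F.φ + z⁻¹ • (g ∘L A₁)
  have hh : ∀ v, h v = F.φ v + z⁻¹ * g (A₁ v) := fun v => rfl
  have hg0 : ∀ v ∈ F.M₁, g v = 0 := by
    intro v hv
    change F.φ (P v + A₂ (P v)) = 0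
    rw [map_add, F.zero₁ _ (hPM v hv), F.zero₂ _ (hA₂ _ (F.le₁ (hPM v hv))), add_zero]
  refine ⟨g, h, hg0, ?_, ?_, hh, ?_⟩
  · intro v hv
    rw [hh, F.zero₂ v hv, hg0 _ (hA₁ v (F.le₂ hv)), mul_zero, add_zero]
  · intro v
    have h1 : (1 + A₂) * P = 1 + A₂ + z⁻¹ • ((1 + A₂) * P * A₁ * A₂) := by
      have h2 : P = 1 + z⁻¹ • (P * (A₁ * A₂)) := by
        rw [mul_sub, mul_one, mul_smul_comm] at hP
        rw [← hP, sub_add_cancel]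
      conv_lhs => rw [h2, mul_add, mul_one, mul_smul_comm]
      simp only [mul_assoc]
    have h2 : g v = F.φ ((1 + A₂ + z⁻¹ • ((1 + A₂) * P * A₁ * A₂)) v) := by rw [← h1]; rfl
    rw [h2, hh]
    change F.φ (v + A₂ v + z⁻¹ • ((1 + A₂) * P) (A₁ (A₂ v))) = _
    rw [map_add, map_add, map_smul, add_assoc]
    rfl
  · intro v
    rw [hh, add_sub_cancel_left, mul_inv_cancel_left₀ hz]
    change F.φ (((1 + A₂) * P) (v + A₁ v)) = _
    rw [map_add, map_add]
    rfl

/-- The counterpart of `FreeFrame.row` for vectors: `d` collects `Ω` and the alternating products on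
`Ω` with leftmost factor `B₁`, and `y` those with leftmost factor `B₂`. -/
theorem FreeFrame.column (F : FreeFrame E) {B₁ B₂ Q : E →L[ℂ] E} {w : ℂ}
    (hB₁ : ∀ v ∈ F.N₁, B₁ v ∈ F.M₁) (hB₂ : ∀ v ∈ F.N₂, B₂ v ∈ F.M₂) (hw : w ≠ 0)
    (hQ : (1 - w⁻¹ • (B₁ * B₂)) * Q = 1) (hQN : ∀ v ∈ F.N₂, Q v ∈ F.N₂) :
    ∃ d y : E, d = F.Ω + B₁ y ∧ y = F.Ω + w⁻¹ • B₂ d ∧ d ∈ F.N₂ ∧ y ∈ F.N₁ ∧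
      ((1 + B₂) * Q * (1 + B₁)) F.Ω = d + w • (y - F.Ω) := by
  let d := Q ((1 + B₁) F.Ω)
  have hd : d ∈ F.N₂ := hQN _ (F.N₂.add_mem F.mem₂ (F.le₁ (hB₁ _ F.mem₁)))
  let y := F.Ω + w⁻¹ • B₂ d
  have h1 : d = (1 + B₁) F.Ω + w⁻¹ • B₁ (B₂ d) := by
    have := DFunLike.congr_fun hQ ((1 + B₁) F.Ω)
    change d - w⁻¹ • B₁ (B₂ d) = _ at this
    rw [sub_eq_iff_eq_add] at this
    exact this
  refine ⟨d, y, ?_, rfl, hd, F.N₁.add_mem F.mem₁ (F.N₁.smul_mem _ (F.le₂ (hB₂ d hd))), ?_⟩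
  · rw [map_add, map_smul, ← add_assoc]
    exact h1
  · change d + B₂ d = _
    rw [add_sub_cancel_left, smul_smul, mul_inv_cancel₀ hw, one_smul]

/-- The joint resolvent of products of free pairs. -/
theorem FreeFrame.pairing (F : FreeFrame E) {A₁ A₂ P B₁ B₂ Q : E →L[ℂ] E} {z w κ₁ κ₂ : ℂ}
    (hA₁ : ∀ v ∈ F.N₁, A₁ v ∈ F.M₁) (hA₂ : ∀ v ∈ F.N₂, A₂ v ∈ F.M₂) (hz : z ≠ 0)
    (hB₁ : ∀ v ∈ F.N₁, B₁ v ∈ F.M₁) (hB₂ : ∀ v ∈ F.N₂, B₂ v ∈ F.M₂) (hw : w ≠ 0)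
    (hAB₁ : ∀ v ∈ F.N₁, A₁ (B₁ v) - κ₁ • v ∈ F.M₁)
    (hAB₂ : ∀ v ∈ F.N₂, A₂ (B₂ v) - κ₂ • v ∈ F.M₂)
    (hP : P * (1 - z⁻¹ • (A₁ * A₂)) = 1) (hPM : ∀ v ∈ F.M₁, P v ∈ F.M₁)
    (hQ : (1 - w⁻¹ • (B₁ * B₂)) * Q = 1) (hQN : ∀ v ∈ F.N₂, Q v ∈ F.N₂) :
    ∃ e₁ e₂ : ℂ, e₁ = 1 + z⁻¹ * κ₁ * e₂ ∧ e₂ = 1 + w⁻¹ * κ₂ * e₁ ∧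
      F.φ (((1 + A₂) * P * (1 + A₁)) (((1 + B₂) * Q * (1 + B₁)) F.Ω)) = 1 + κ₁ * e₂ + κ₂ * e₁ ∧
      F.φ (((1 + A₂) * P * (1 + A₁)) F.Ω) = 1 ∧ F.φ (((1 + B₂) * Q * (1 + B₁)) F.Ω) = 1 := by
  obtain ⟨g, h, hg, hh, hgh, hhg, hrow⟩ := F.row hA₁ hA₂ hz hP hPM
  obtain ⟨d, y, hdy, hyd, hd, hy, hcol⟩ := F.column hB₁ hB₂ hw hQ hQN
  have hgΩ : g F.Ω = 1 := by rw [hgh, F.φΩ, hh _ (hA₂ _ F.mem₂), add_zero]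
  have hhΩ : h F.Ω = 1 := by rw [hhg, F.φΩ, hg _ (hA₁ _ F.mem₁), mul_zero, add_zero]
  have hgd : g d = 1 := by rw [hdy, map_add, hgΩ, hg _ (hB₁ y hy), add_zero]
  have hhy : h y = 1 := by
    rw [hyd, map_add, hhΩ, map_smul, hh _ (hB₂ d hd), smul_zero, add_zero]
  have hφd : F.φ d = 1 := by rw [hdy, map_add, F.φΩ, F.zero₁ _ (hB₁ y hy), add_zero]
  have hφy : F.φ y = 1 := by
    rw [hyd, map_add, F.φΩ, map_smul, F.zero₂ _ (hB₂ d hd), smul_zero, add_zero]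
  -- The only place where the two families meet: `A₁ B₁ y` is `κ₁ y` up to a vector in `M₁`, which
  -- `g` does not see.
  have hgAB : g (A₁ (B₁ y)) = κ₁ * g y := by
    have := hg _ (hAB₁ y hy)
    rwa [map_sub, map_smul, sub_eq_zero] at this
  have hhAB : h (A₂ (B₂ d)) = κ₂ * h d := by
    have := hh _ (hAB₂ d hd)
    rwa [map_sub, map_smul, sub_eq_zero] at this
  have e₁ : h d = 1 + z⁻¹ * κ₁ * g y := by
    conv_lhs => rw [hdy, map_add, hhΩ, hhg, F.zero₁ _ (hB₁ y hy), hgAB]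
    ring
  have e₂ : g y = 1 + w⁻¹ * κ₂ * h d := by
    rw [hgh, hφy]
    conv_lhs => rw [hyd, map_add, map_add, map_smul, map_smul, hhAB, hh _ (hA₂ _ F.mem₂)]
    rw [smul_eq_mul]
    ring
  -- The unknowns of the system are the mixed values `h d` and `g y`. The values `g d`, `h y`, `φ
  -- d`, `φ y` are all one.
  refine ⟨h d, g y, e₁, e₂, ?_, ?_, ?_⟩
  · rw [hcol, map_add, map_add, map_smul, map_smul, map_sub, map_sub, hrow, hrow, hrow, hgd, hφd,
      hgΩ, hhΩ, hhy, hφy, F.φΩ, smul_eq_mul]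
    have e₁' : z * (h d - 1) = κ₁ * g y := by rw [e₁]; field_simp; ring
    have e₂' : w * (g y - 1) = κ₂ * h d := by
      conv_lhs => rw [e₂]
      field_simp; ring
    linear_combination e₁' + e₂'
  · rw [hrow, hgΩ, hhΩ, F.φΩ]; ring
  · rw [hcol, map_add, map_smul, map_sub, hφd, hφy, F.φΩ, sub_self, smul_zero, add_zero]

end BiFree

end

noncomputable section

namespace BiFree

/-! ### Resolvents of the coordinate functions and the transform `H`. -/

section Resolvent

variable {X : Type} [TopologicalSpace X] [CompactSpace X]

/-- The resolvent `p ↦ (1 - Z x(p))⁻¹` in the algebra of continuous functions. -/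
def res (x : C(X, ℂ)) (Z : ℂ) : C(X, ℂ) := Ring.inverse (1 - Z • x)

variable {x : C(X, ℂ)} {Z : ℂ}

theorem norm_smul_lt_one {E : Type*} [SeminormedAddCommGroup E] [NormedSpace ℂ E] {x : E}
    (hx : ‖x‖ ≤ 1) (hZ : ‖Z‖ < 1) : ‖Z • x‖ < 1 := by
  rw [norm_smul]
  nlinarith [norm_nonneg Z, norm_nonneg x]

theorem isUnit_one_sub_smul (hx : ‖x‖ ≤ 1) (hZ : ‖Z‖ < 1) : IsUnit (1 - Z • x) :=
  isUnit_one_sub_of_norm_lt_one (norm_smul_lt_one hx hZ)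

theorem mul_res (hx : ‖x‖ ≤ 1) (hZ : ‖Z‖ < 1) : (1 - Z • x) * res x Z = 1 :=
  Ring.mul_inverse_cancel _ (isUnit_one_sub_smul hx hZ)

theorem one_sub_mul_ne_zero (hx : ‖x‖ ≤ 1) (hZ : ‖Z‖ < 1) (p : X) : 1 - Z * x p ≠ 0 := by
  have h : (1 - Z * x p) * res x Z p = 1 := by simpa using DFunLike.congr_fun (mul_res hx hZ) p
  exact left_ne_zero_of_mul_eq_one h

theorem res_apply (hx : ‖x‖ ≤ 1) (hZ : ‖Z‖ < 1) (p : X) : res x Z p = (1 - Z * x p)⁻¹ := by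
  have h : (1 - Z * x p) * res x Z p = 1 := by simpa using DFunLike.congr_fun (mul_res hx hZ) p
  exact eq_inv_of_mul_eq_one_right h

theorem res_zero : res x 0 = 1 := by simp [res]

theorem hasSum_res (hx : ‖x‖ ≤ 1) (hZ : ‖Z‖ < 1) : HasSum (fun n : ℕ => (Z • x) ^ n) (res x Z) := by
  have h := norm_smul_lt_one hx hZ
  have h1 : HasSum (fun n : ℕ => (Z • x) ^ n) (∑' n : ℕ, (Z • x) ^ n) :=
    (summable_geometric_of_norm_lt_one h).hasSum
  have h2 : (1 - Z • x) * ∑' n : ℕ, (Z • x) ^ n = 1 := mul_neg_geom_series _ h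
  rwa [← (isUnit_one_sub_smul hx hZ).mul_left_cancel ((mul_res hx hZ).trans h2.symm)] at h1

theorem differentiableAt_res (hx : ‖x‖ ≤ 1) (hZ : ‖Z‖ < 1) : DifferentiableAt ℂ (res x) Z := by
  obtain ⟨u, hu⟩ := isUnit_one_sub_smul hx hZ
  have h1 : DifferentiableAt ℂ (Ring.inverse : C(X, ℂ) → C(X, ℂ)) (1 - Z • x) := by
    rw [← hu]
    exact differentiableAt_inverse ⟨u, rfl⟩
  exact h1.comp (f := fun Z => 1 - Z • x) Z (by fun_prop)

/-- The integral as a functional on the continuous functions. -/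
def integralL [MeasurableSpace X] [BorelSpace X] (ν : Measure X) [IsProbabilityMeasure ν] :
    C(X, ℂ) →L[ℂ] ℂ :=
  LinearMap.mkContinuous
    { toFun := fun f => ∫ x, f x ∂ν
      map_add' := fun f g => integral_add
        ((BoundedContinuousFunction.mkOfCompact f).integrable ν)
        ((BoundedContinuousFunction.mkOfCompact g).integrable ν)
      map_smul' := fun c f => integral_const_mul c _ } 1 fun f => by
    refine (norm_integral_le_of_norm_le_const (C := ‖f‖) (.of_forall fun x => ?_)).trans ?_
    · exact f.norm_coe_le_norm x
    · simp

theorem integralL_apply [MeasurableSpace X] [BorelSpace X] (ν : Measure X)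
    [IsProbabilityMeasure ν] (f : C(X, ℂ)) : integralL ν f = ∫ x, f x ∂ν := rfl

end Resolvent

theorem norm_coordS : ‖coordS‖ ≤ 1 :=
  (ContinuousMap.norm_le _ zero_le_one).2 fun x => (Circle.norm_coe x.1).le

theorem norm_coordT : ‖coordT‖ ≤ 1 :=
  (ContinuousMap.norm_le _ zero_le_one).2 fun x => (Circle.norm_coe x.2).le

theorem H_eq_integralL (μ : ProbabilityMeasure Torus) {Z W : ℂ} (hZ : ‖Z‖ < 1) (hW : ‖W‖ < 1) :
    H μ Z W = integralL (μ : Measure Torus) (res coordS Z * res coordT W) := by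
  rw [integralL_apply]
  refine integral_congr_ae (.of_forall fun p => ?_)
  change _ = res coordS Z p * res coordT W p
  rw [res_apply norm_coordS hZ, res_apply norm_coordT hW]
  simp [coordS, coordT, mul_comm]

/-- Both sides are the same double power series in `Z` and `W`, summed first over the powers of `W`,
then over those of `Z`. Right inverses suffice, since they must equal the Neumann sums. -/
theorem H_eq_of_moments {E : Type*} [NormedAddCommGroup E] [NormedSpace ℂ E] [CompleteSpace E]
    (ν : ProbabilityMeasure Torus) {S T RS RT : E →L[ℂ] E} (φ : E →L[ℂ] ℂ) (Ω : E)
    (hmom : ∀ p q : ℕ, ∫ x : Torus, (x.1 : ℂ) ^ p * (x.2 : ℂ) ^ q ∂ν = φ ((S ^ p) ((T ^ q) Ω)))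
    (hS : ‖S‖ ≤ 1) (hT : ‖T‖ ≤ 1) {Z W : ℂ} (hZ : ‖Z‖ < 1) (hW : ‖W‖ < 1)
    (hRS : (1 - Z • S) * RS = 1) (hRT : (1 - W • T) * RT = 1) :
    H ν Z W = φ (RS (RT Ω)) := by
  have hsum : ∀ {S RS : E →L[ℂ] E} {Z : ℂ}, ‖S‖ ≤ 1 → ‖Z‖ < 1 → (1 - Z • S) * RS = 1 →
      HasSum (fun n : ℕ => (Z • S) ^ n) RS := by
    intro S RS Z hS hZ hRS
    obtain ⟨P, h1, h2, h3, -⟩ := exists_inverse_one_sub (norm_smul_lt_one hS hZ)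
    rwa [left_inv_eq_right_inv h2 hRS] at h3
  rw [H_eq_integralL ν hZ hW]
  have hq : ∀ p : ℕ, integralL (ν : Measure Torus) ((Z • coordS) ^ p * res coordT W)
      = φ (((Z • S) ^ p) (RT Ω)) := by
    intro p
    have h1 : HasSum (fun q : ℕ => integralL (ν : Measure Torus)
        ((Z • coordS) ^ p * (W • coordT) ^ q))
        (integralL (ν : Measure Torus) ((Z • coordS) ^ p * res coordT W)) :=
      ((hasSum_res norm_coordT hW).mul_left _).mapL _
    have h2 : HasSum (fun q : ℕ => φ (((Z • S) ^ p) (((W • T) ^ q) Ω)))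
        (φ (((Z • S) ^ p) (RT Ω))) :=
      (hsum hT hW hRT).mapL (φ ∘L ((Z • S) ^ p) ∘L ContinuousLinearMap.apply ℂ E Ω)
    refine h1.unique ?_
    convert h2 using 2 with q
    rw [smul_pow, smul_pow, smul_mul_smul_comm, map_smul, smul_pow, smul_pow, _root_.smul_apply,
      _root_.smul_apply, map_smul, map_smul, map_smul, smul_smul, ← hmom]
    rfl
  have h1 : HasSum (fun p : ℕ => integralL (ν : Measure Torus)
      ((Z • coordS) ^ p * res coordT W))
      (integralL (ν : Measure Torus) (res coordS Z * res coordT W)) :=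
    ((hasSum_res norm_coordS hZ).mul_right _).mapL _
  have h2 : HasSum (fun p : ℕ => φ (((Z • S) ^ p) (RT Ω))) (φ (RS (RT Ω))) :=
    (hsum hS hZ hRS).mapL (φ ∘L ContinuousLinearMap.apply ℂ E (RT Ω))
  simp only [hq] at h1
  exact h1.unique h2

/-! ### Representations on the free product of `L²(μ₁)` and `L²(μ₂)`. -/

section Representation

variable (μ : Fin 2 → ProbabilityMeasure Torus)

/-- The free product of the spaces `L²(μ i)`. -/
abbrev FreeL2 : Type := FreeProd fun i => basisL2 (μ i)

/-- The vacuum vector of the free product of the spaces `L²(μ i)`. -/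
abbrev vac : FreeL2 μ := vacuum fun i => basisL2 (μ i)

/-- The representation of the continuous functions by left variables. -/
def leftRep (i : Fin 2) : C(Torus, ℂ) →ₐ[ℂ] (FreeL2 μ →L[ℂ] FreeL2 μ) :=
  (amplHom (basisL2 (μ i)).b (Word.leftEquiv (fun i => (basisL2 (μ i)).J) i)).comp (mulHom (μ i))

/-- The representation of the continuous functions by right variables. -/
def rightRep (i : Fin 2) : C(Torus, ℂ) →ₐ[ℂ] (FreeL2 μ →L[ℂ] FreeL2 μ) :=
  (amplHom (basisL2 (μ i)).b (Word.rightEquiv (fun i => (basisL2 (μ i)).J) i)).comp (mulHom (μ i))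

theorem norm_leftRep_le (i : Fin 2) (f : C(Torus, ℂ)) : ‖leftRep μ i f‖ ≤ ‖f‖ :=
  (norm_ampl_le _ _ _).trans (norm_mulOp_le _ _)

theorem norm_rightRep_le (i : Fin 2) (f : C(Torus, ℂ)) : ‖rightRep μ i f‖ ≤ ‖f‖ :=
  (norm_ampl_le _ _ _).trans (norm_mulOp_le _ _)

theorem commute_leftRep_rightRep (i j : Fin 2) (f g : C(Torus, ℂ)) :
    Commute (leftRep μ i f) (rightRep μ j g) := by
  by_cases hij : i = j
  · subst hij
    exact commute_leftVar_rightVar _ ((Commute.all f g).map (mulHom (μ i)))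
  · exact commute_leftVar_rightVar_of_ne _ hij _ _

theorem rightRep_vac (i : Fin 2) (f : C(Torus, ℂ)) :
    rightRep μ i f (vac μ) = leftRep μ i f (vac μ) :=
  rightVar_vacuum _ _ _

theorem leftRep_sub_mem (i : Fin 2) (f : C(Torus, ℂ)) {v : FreeL2 μ}
    (hv : v ∈ headIsNot (fun i => basisL2 (μ i)) i) :
    leftRep μ i f v - (∫ x, f x ∂(μ i : Measure Torus)) • v
      ∈ headIs (fun i => basisL2 (μ i)) i := by
  have := leftVar_sub_smul_mem (fun i => basisL2 (μ i)) i (mulOp (μ i) f) hv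
  rwa [inner_mulOp_oneL2] at this

theorem leftRep_mem (i : Fin 2) {f : C(Torus, ℂ)} (hf : ∫ x, f x ∂(μ i : Measure Torus) = 0)
    {v : FreeL2 μ} (hv : v ∈ headIsNot (fun i => basisL2 (μ i)) i) :
    leftRep μ i f v ∈ headIs (fun i => basisL2 (μ i)) i := by
  have := leftRep_sub_mem μ i f hv
  rwa [hf, zero_smul, sub_zero] at this

/-- The frame of the free product of two spaces `L²(μ i)`. -/
def freeFrame : FreeFrame (FreeL2 μ) where
  Ω := vac μ
  φ := innerSL ℂ (vac μ)
  M₁ := headIs (fun i => basisL2 (μ i)) 0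
  M₂ := headIs (fun i => basisL2 (μ i)) 1
  N₁ := headIsNot (fun i => basisL2 (μ i)) 0
  N₂ := headIsNot (fun i => basisL2 (μ i)) 1
  φΩ := inner_vacuum_vacuum _
  closed₁ := isClosed_headIs _ _
  closedN₂ := isClosed_headIsNot _ _
  le₁ := headIs_le_headIsNot _ (by decide)
  le₂ := headIs_le_headIsNot _ (by decide)
  mem₁ := vacuum_mem _ _
  mem₂ := vacuum_mem _ _
  zero₁ _ hv := inner_vacuum_headIs _ hv
  zero₂ _ hv := inner_vacuum_headIs _ hv

/-- A contraction with a contractive inverse is isometric. This yields unitarity of the variables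
from the algebra and norm properties of the representations, without computing adjoints. -/
theorem mem_unitary_of_norm_le_one {E : Type*} [NormedAddCommGroup E] [InnerProductSpace ℂ E]
    [CompleteSpace E] {U U' : E →L[ℂ] E} (h : U * U' = 1) (h' : U' * U = 1) (hU : ‖U‖ ≤ 1)
    (hU' : ‖U'‖ ≤ 1) : U ∈ unitary (E →L[ℂ] E) := by
  have h1 : star U * U = 1 := by
    refine (ContinuousLinearMap.norm_map_iff_adjoint_comp_self U).1 fun v => le_antisymm ?_ ?_
    · simpa using U.le_of_opNorm_le hU v
    · have h2 : U' (U v) = v := DFunLike.congr_fun h' v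
      simpa [h2] using U'.le_of_opNorm_le hU' (U v)
  have h2 : star U = U' := left_inv_eq_right_inv h1 h
  exact ⟨h1, by rw [h2, h]⟩

theorem star_mul_coordS : star coordS * coordS = 1 := by
  ext x
  simp [coordS, Complex.conj_mul', Circle.norm_coe]

theorem star_mul_coordT : star coordT * coordT = 1 := by
  ext x
  simp [coordT, Complex.conj_mul', Circle.norm_coe]

variable {μ}

theorem isOppConv_oppConv (μ₁ μ₂ : ProbabilityMeasure Torus) :
    IsOppConv μ₁ μ₂ (oppConv μ₁ μ₂) := by
  refine Classical.epsilon_spec (p := IsOppConv μ₁ μ₂) ?_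
  let μ : Fin 2 → ProbabilityMeasure Torus := ![μ₁, μ₂]
  have hu : ∀ i, leftRep μ i coordS ∈ unitary (FreeL2 μ →L[ℂ] FreeL2 μ) := fun i =>
    mem_unitary_of_norm_le_one (U' := leftRep μ i (star coordS))
      (by rw [← map_mul, mul_comm, star_mul_coordS, map_one])
      (by rw [← map_mul, star_mul_coordS, map_one])
      ((norm_leftRep_le μ i _).trans norm_coordS)
      ((norm_leftRep_le μ i _).trans ((norm_star _).trans_le norm_coordS))
  have hv : ∀ i, rightRep μ i coordT ∈ unitary (FreeL2 μ →L[ℂ] FreeL2 μ) := fun i =>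
    mem_unitary_of_norm_le_one (U' := rightRep μ i (star coordT))
      (by rw [← map_mul, mul_comm, star_mul_coordT, map_one])
      (by rw [← map_mul, star_mul_coordT, map_one])
      ((norm_rightRep_le μ i _).trans norm_coordT)
      ((norm_rightRep_le μ i _).trans ((norm_star _).trans_le norm_coordT))
  have hc := fun i j => commute_leftRep_rightRep μ i j coordS coordT
  exact exists_isJointLaw (mul_mem (hu 0) (hu 1)) (mul_mem (hv 1) (hv 0))
    (((hc 0 1).mul_right (hc 0 0)).mul_left ((hc 1 1).mul_right (hc 1 0)))
    (norm_vacuum _)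

/-- Right variables can be traded for left ones on the vacuum. The order is reversed in the process,
so `v₂ v₁` becomes the left product `t₁ t₂`, parallel to `u₁ u₂`; this is what distinguishes the
opposite convolution. -/
theorem IsOppConv.moment {μ₁ μ₂ ν : ProbabilityMeasure Torus} (h : IsOppConv μ₁ μ₂ ν) (p q : ℕ) :
    ∫ x : Torus, (x.1 : ℂ) ^ p * (x.2 : ℂ) ^ q ∂ν
      = innerSL ℂ (vac ![μ₁, μ₂])
        (((leftRep ![μ₁, μ₂] 0 coordS * leftRep ![μ₁, μ₂] 1 coordS) ^ p)
          (((leftRep ![μ₁, μ₂] 0 coordT * leftRep ![μ₁, μ₂] 1 coordT) ^ q) (vac ![μ₁, μ₂]))) := by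
  set μ : Fin 2 → ProbabilityMeasure Torus := ![μ₁, μ₂] with hμ
  have h1 := h p 0 q 0
  simp only [pow_zero, mul_one] at h1
  rw [h1]
  set V := rightRep μ 1 coordT * rightRep μ 0 coordT with hV
  set T := leftRep μ 0 coordT * leftRep μ 1 coordT with hT
  have hc : Commute V T := by
    have := fun i j => (commute_leftRep_rightRep μ i j coordT coordT).symm
    exact ((this 0 1).mul_right (this 1 1)).mul_left ((this 0 0).mul_right (this 1 0))
  -- On the vacuum `v₂ v₁ ξ = v₂ t₁ ξ = t₁ v₂ ξ = t₁ t₂ ξ`.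
  have hΩ : V (vac μ) = T (vac μ) := by
    have h2 : rightRep μ 1 coordT (leftRep μ 0 coordT (vac μ))
        = leftRep μ 0 coordT (rightRep μ 1 coordT (vac μ)) :=
      DFunLike.congr_fun (commute_leftRep_rightRep μ 0 1 coordT coordT).eq.symm (vac μ)
    change rightRep μ 1 coordT (rightRep μ 0 coordT (vac μ)) = _
    rw [rightRep_vac, h2, rightRep_vac]
    rfl
  have hq : ∀ q : ℕ, (V ^ q) (vac μ) = (T ^ q) (vac μ) := by
    intro q
    induction q with
    | zero => rfl
    | succ n ih =>
      have h3 : V ((T ^ n) (vac μ)) = (T ^ n) (V (vac μ)) :=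
        DFunLike.congr_fun (hc.pow_right n).eq (vac μ)
      rw [pow_succ']
      change V ((V ^ n) (vac μ)) = _
      rw [ih, h3, hΩ, pow_succ]
      rfl
  rw [← hq]
  rfl

end Representation

end BiFree

end

noncomputable section

namespace BiFree

/-! ### Centred resolvents and the joint transform of the opposite convolution. -/

section CenteredResolvent

variable {X : Type} [TopologicalSpace X] [CompactSpace X] {x : C(X, ℂ)} {Z z : ℂ}

/-- The normalized resolvent minus one; it is centred if `Z` is the inverse `η`-transform at `z`. -/
def cres (x : C(X, ℂ)) (z Z : ℂ) : C(X, ℂ) := (1 - z) • res x Z - 1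

theorem mul_one_add_cres (hx : ‖x‖ ≤ 1) (hZ : ‖Z‖ < 1) :
    (1 - Z • x) * (1 + cres x z Z) = (1 - z) • (1 : C(X, ℂ)) := by
  rw [cres, add_sub_cancel, mul_smul_comm, mul_res hx hZ]

/-- Pointwise the function is `(Z x - z) / (1 - Z x)`, whose denominator is at least `1/2` in
modulus; hence the factor 2. -/
theorem norm_cres_le (hx : ‖x‖ ≤ 1) {C : ℝ} (hZ : ‖Z‖ ≤ 1 / 2) (hC : ‖Z‖ ≤ C * ‖z‖) :
    ‖cres x z Z‖ ≤ 2 * (C + 1) * ‖z‖ := by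
  have hZ1 : ‖Z‖ < 1 := hZ.trans_lt (by norm_num)
  refine (ContinuousMap.norm_le _ ?_).2 fun p => ?_
  · nlinarith [norm_nonneg Z, norm_nonneg z]
  have h0 := one_sub_mul_ne_zero hx hZ1 p
  have hxp : ‖x p‖ ≤ 1 := (x.norm_coe_le_norm p).trans hx
  have hZx : ‖Z * x p‖ ≤ ‖Z‖ := by
    rw [norm_mul]
    exact mul_le_of_le_one_right (norm_nonneg _) hxp
  have h1 : cres x z Z p = (Z * x p - z) / (1 - Z * x p) := by
    simp only [cres, ContinuousMap.sub_apply, ContinuousMap.smul_apply, ContinuousMap.one_apply,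
      res_apply hx hZ1, smul_eq_mul]
    field_simp
    ring
  have h2 : 1 / 2 ≤ ‖1 - Z * x p‖ := by
    have := norm_sub_norm_le 1 (Z * x p)
    rw [norm_one] at this
    linarith
  rw [h1, norm_div, div_le_iff₀ (by linarith)]
  have h3 : ‖Z * x p - z‖ ≤ (C + 1) * ‖z‖ := by
    refine (norm_sub_le _ _).trans ?_
    linarith
  nlinarith [norm_nonneg (Z * x p - z)]

end CenteredResolvent

theorem integral_cres_mul_cres (μ : ProbabilityMeasure Torus) {z w Z W κ : ℂ} (hZ : ‖Z‖ < 1)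
    (hW : ‖W‖ < 1) (hA : ∫ x, cres coordS z Z x ∂(μ : Measure Torus) = 0)
    (hB : ∫ x, cres coordT w W x ∂(μ : Measure Torus) = 0)
    (hκ : (1 - z) * (1 - w) * H μ Z W = 1 + κ) :
    ∫ x, (cres coordS z Z * cres coordT w W) x ∂(μ : Measure Torus) = κ := by
  rw [← integralL_apply] at *
  have h1 : cres coordS z Z * cres coordT w W
      = ((1 - z) * (1 - w)) • (res coordS Z * res coordT W) - 1 - cres coordS z Z
        - cres coordT w W := by
    have e1 : (1 - z) • res coordS Z = cres coordS z Z + 1 := by rw [cres, sub_add_cancel]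
    have e2 : (1 - w) • res coordT W = cres coordT w W + 1 := by rw [cres, sub_add_cancel]
    rw [← smul_mul_smul_comm, e1, e2]
    ring
  rw [h1, map_sub, map_sub, map_sub, map_smul, hA, hB, ← H_eq_integralL μ hZ hW, smul_eq_mul, hκ,
    integralL_apply]
  simp

section Joint

variable {μ₁ μ₂ ν : ProbabilityMeasure Torus}

theorem leftRep_mul_smul (μ : Fin 2 → ProbabilityMeasure Torus) (i : Fin 2) {x : C(Torus, ℂ)}
    {z Z : ℂ} (hx : ‖x‖ ≤ 1) (hZ : ‖Z‖ < 1) :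
    (1 - Z • leftRep μ i x) * (1 + leftRep μ i (cres x z Z)) = (1 - z) • 1 ∧
    (1 + leftRep μ i (cres x z Z)) * (1 - Z • leftRep μ i x) = (1 - z) • 1 := by
  have h := mul_one_add_cres (z := z) hx hZ
  have h' := h
  rw [mul_comm] at h'
  have e := congrArg (leftRep μ i) h
  have e' := congrArg (leftRep μ i) h'
  simp only [map_mul, map_sub, map_add, map_one, map_smul] at e e'
  exact ⟨e, e'⟩

/-- The transform `H` of the opposite bi-free convolution. -/
theorem IsOppConv.joint (h : IsOppConv μ₁ μ₂ ν) {z w Z₁ Z₂ W₁ W₂ Z W κ₁ κ₂ : ℂ}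
    (hz : z ≠ 0) (hz1 : z ≠ 1) (hw : w ≠ 0) (hw1 : w ≠ 1)
    (hZ : Z * z = Z₁ * Z₂) (hW : W * w = W₁ * W₂)
    (hZ₁n : ‖Z₁‖ < 1) (hZ₂n : ‖Z₂‖ < 1) (hZn : ‖Z‖ < 1)
    (hW₁n : ‖W₁‖ < 1) (hW₂n : ‖W₂‖ < 1) (hWn : ‖W‖ < 1)
    (hA₁ : ∫ x, cres coordS z Z₁ x ∂(μ₁ : Measure Torus) = 0)
    (hA₂ : ∫ x, cres coordS z Z₂ x ∂(μ₂ : Measure Torus) = 0)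
    (hB₁ : ∫ x, cres coordT w W₁ x ∂(μ₁ : Measure Torus) = 0)
    (hB₂ : ∫ x, cres coordT w W₂ x ∂(μ₂ : Measure Torus) = 0)
    (hA : ‖cres coordS z Z₁‖ * ‖cres coordS z Z₂‖ < ‖z‖)
    (hB : ‖cres coordT w W₁‖ * ‖cres coordT w W₂‖ < ‖w‖)
    (hκ₁ : (1 - z) * (1 - w) * H μ₁ Z₁ W₁ = 1 + κ₁)
    (hκ₂ : (1 - z) * (1 - w) * H μ₂ Z₂ W₂ = 1 + κ₂) :
    ∃ e₁ e₂ : ℂ, e₁ = 1 + z⁻¹ * κ₁ * e₂ ∧ e₂ = 1 + w⁻¹ * κ₂ * e₁ ∧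
      (1 - z) * (1 - w) * H ν Z W = 1 + κ₁ * e₂ + κ₂ * e₁ ∧
      (1 - z) * H ν Z 0 = 1 ∧ (1 - w) * H ν 0 W = 1 := by
  have hmom := h.moment
  set μ : Fin 2 → ProbabilityMeasure Torus := ![μ₁, μ₂] with hμ
  let F := freeFrame μ
  let A₁ := leftRep μ 0 (cres coordS z Z₁)
  let A₂ := leftRep μ 1 (cres coordS z Z₂)
  let B₁ := leftRep μ 0 (cres coordT w W₁)
  let B₂ := leftRep μ 1 (cres coordT w W₂)
  -- The hypotheses `hA` and `hB` make the two Neumann series converge.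
  have hsmall : ∀ {f g : C(Torus, ℂ)} {u : ℂ}, u ≠ 0 → ‖f‖ * ‖g‖ < ‖u‖ →
      ‖u⁻¹ • (leftRep μ 0 f * leftRep μ 1 g)‖ < 1 := by
    intro f g u hu hfg
    rw [norm_smul, norm_inv, inv_mul_lt_one₀ (norm_pos_iff.2 hu)]
    refine ((norm_mul_le _ _).trans ?_).trans_lt hfg
    exact mul_le_mul (norm_leftRep_le _ _ _) (norm_leftRep_le _ _ _) (norm_nonneg _)
      (norm_nonneg _)
  obtain ⟨P, hP1, hP2, -, hPinv⟩ := exists_inverse_one_sub (hsmall hz hA)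
  obtain ⟨Q, hQ1, hQ2, -, hQinv⟩ := exists_inverse_one_sub (hsmall hw hB)
  have cA₁ : ∀ v ∈ F.N₁, A₁ v ∈ F.M₁ := fun v hv => leftRep_mem μ 0 hA₁ hv
  have cA₂ : ∀ v ∈ F.N₂, A₂ v ∈ F.M₂ := fun v hv => leftRep_mem μ 1 hA₂ hv
  have cB₁ : ∀ v ∈ F.N₁, B₁ v ∈ F.M₁ := fun v hv => leftRep_mem μ 0 hB₁ hv
  have cB₂ : ∀ v ∈ F.N₂, B₂ v ∈ F.M₂ := fun v hv => leftRep_mem μ 1 hB₂ hv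
  have cAB₁ : ∀ v ∈ F.N₁, A₁ (B₁ v) - κ₁ • v ∈ F.M₁ := by
    intro v hv
    have := leftRep_sub_mem μ 0 (cres coordS z Z₁ * cres coordT w W₁) hv
    rw [map_mul] at this
    rwa [← integral_cres_mul_cres μ₁ hZ₁n hW₁n hA₁ hB₁ hκ₁]
  have cAB₂ : ∀ v ∈ F.N₂, A₂ (B₂ v) - κ₂ • v ∈ F.M₂ := by
    intro v hv
    have := leftRep_sub_mem μ 1 (cres coordS z Z₂ * cres coordT w W₂) hv
    rw [map_mul] at this
    rwa [← integral_cres_mul_cres μ₂ hZ₂n hW₂n hA₂ hB₂ hκ₂]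
  -- `A₁ A₂` sends words beginning with index 1 to words beginning with 2 and back, so it preserves
  -- `M₁`.
  have hPM : ∀ v ∈ F.M₁, P v ∈ F.M₁ := hPinv F.M₁ F.closed₁ fun v hv =>
    F.M₁.smul_mem _ (cA₁ _ (F.le₂ (cA₂ _ (F.le₁ hv))))
  have hQN : ∀ v ∈ F.N₂, Q v ∈ F.N₂ := hQinv F.N₂ F.closedN₂ fun v hv =>
    F.N₂.smul_mem _ (F.le₁ (cB₁ _ (F.le₂ (cB₂ _ hv))))
  obtain ⟨e₁, e₂, he₁, he₂, h1, h2, h3⟩ := F.pairing (κ₁ := κ₁) (κ₂ := κ₂) cA₁ cA₂ hz cB₁ cB₂ hw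
    cAB₁ cAB₂ hP2 hPM hQ1 hQN
  refine ⟨e₁, e₂, he₁, he₂, ?_⟩
  have RS := resolvent_mul hz hz1 hZ (leftRep_mul_smul μ 0 norm_coordS hZ₁n).1
    (leftRep_mul_smul μ 1 norm_coordS hZ₂n).2 (leftRep_mul_smul μ 1 norm_coordS hZ₂n).1 hP1
  have RT := resolvent_mul hw hw1 hW (leftRep_mul_smul μ 0 norm_coordT hW₁n).1
    (leftRep_mul_smul μ 1 norm_coordT hW₂n).2 (leftRep_mul_smul μ 1 norm_coordT hW₂n).1 hQ1
  have hle : ∀ {f : C(Torus, ℂ)}, ‖f‖ ≤ 1 → ‖leftRep μ 0 f * leftRep μ 1 f‖ ≤ 1 := by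
    intro f hf
    refine (norm_mul_le _ _).trans (mul_le_one₀ ?_ (norm_nonneg _) ?_)
    · exact (norm_leftRep_le _ _ _).trans hf
    · exact (norm_leftRep_le _ _ _).trans hf
  -- With one variable set to zero, the same moment formula gives the marginal identities.
  have R0 : ∀ S : FreeL2 μ →L[ℂ] FreeL2 μ, (1 - (0 : ℂ) • S) * 1 = 1 := by simp
  have n0 : ‖(0 : ℂ)‖ < 1 := by simp
  have hz' : (1 - z) ≠ 0 := sub_ne_zero.2 hz1.symm
  have hw' : (1 - w) ≠ 0 := sub_ne_zero.2 hw1.symm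
  refine ⟨?_, ?_, ?_⟩
  · rw [H_eq_of_moments ν _ _ hmom (hle norm_coordS) (hle norm_coordT) hZn hWn RS RT, ← h1]
    change (1 - z) * (1 - w) * F.φ ((1 - z)⁻¹ • ((1 + A₂) * P * (1 + A₁))
      ((1 - w)⁻¹ • ((1 + B₂) * Q * (1 + B₁)) F.Ω)) = _
    rw [map_smul, map_smul, map_smul, smul_eq_mul, smul_eq_mul]
    have : (1 - z) * (1 - w) * ((1 - z)⁻¹ * (1 - w)⁻¹) = 1 := by field_simp
    linear_combination (F.φ (((1 + A₂) * P * (1 + A₁)) (((1 + B₂) * Q * (1 + B₁)) F.Ω))) * this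
  · rw [H_eq_of_moments ν _ _ hmom (hle norm_coordS) (hle norm_coordT) hZn n0 RS (R0 _)]
    change (1 - z) * F.φ ((1 - z)⁻¹ • ((1 + A₂) * P * (1 + A₁)) F.Ω) = 1
    rw [map_smul, h2, smul_eq_mul, mul_one, mul_inv_cancel₀ hz']
  · rw [H_eq_of_moments ν _ _ hmom (hle norm_coordS) (hle norm_coordT) n0 hWn (R0 _) RT]
    change (1 - w) * F.φ ((1 - w)⁻¹ • ((1 + B₂) * Q * (1 + B₁)) F.Ω) = 1
    rw [map_smul, h3, smul_eq_mul, mul_one, mul_inv_cancel₀ hw']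

/-- The marginal means of the opposite bi-free convolution are the products of the means. -/
theorem IsOppConv.mean (h : IsOppConv μ₁ μ₂ ν) :
    ∫ x : Torus, (x.1 : ℂ) ∂ν = (∫ x : Torus, (x.1 : ℂ) ∂μ₁) * ∫ x : Torus, (x.1 : ℂ) ∂μ₂ ∧
    ∫ x : Torus, (x.2 : ℂ) ∂ν = (∫ x : Torus, (x.2 : ℂ) ∂μ₁) * ∫ x : Torus, (x.2 : ℂ) ∂μ₂ := by
  have hmom := h.moment
  set μ : Fin 2 → ProbabilityMeasure Torus := ![μ₁, μ₂] with hμ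
  let F := freeFrame μ
  have key : ∀ f : C(Torus, ℂ), F.φ (leftRep μ 0 f (leftRep μ 1 f F.Ω))
      = (∫ x, f x ∂(μ₁ : Measure Torus)) * ∫ x, f x ∂(μ₂ : Measure Torus) := by
    intro f
    set v := leftRep μ 1 f F.Ω - (∫ x, f x ∂(μ₂ : Measure Torus)) • F.Ω with hv
    have hvM : v ∈ F.M₂ := leftRep_sub_mem μ 1 f F.mem₂
    have h1 : leftRep μ 1 f F.Ω = v + (∫ x, f x ∂(μ₂ : Measure Torus)) • F.Ω := by
      rw [hv, sub_add_cancel]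
    have h2 := F.zero₁ _ (leftRep_sub_mem μ 0 f (F.le₂ hvM))
    have h3 := F.zero₁ _ (leftRep_sub_mem μ 0 f F.mem₁)
    rw [map_sub, map_smul, F.zero₂ _ hvM, smul_zero, sub_zero] at h2
    rw [map_sub, map_smul, F.φΩ, smul_eq_mul, mul_one, sub_eq_zero] at h3
    rw [h1, map_add, map_smul, map_add, map_smul, h2, h3, zero_add, smul_eq_mul, mul_comm]
    rfl
  have e1 := hmom 1 0
  have e2 := hmom 0 1
  simp only [pow_one, pow_zero, mul_one, one_mul] at e1 e2
  exact ⟨e1.trans (key coordS), e2.trans (key coordT)⟩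

end Joint

end BiFree

end

/-! ### The one-dimensional η-transform and its inverse near 0 and ∞. -/

noncomputable section

namespace BiFree

theorem mem_D {r : ℝ} {z : ℂ} : z ∈ D r ↔ ‖z‖ < r := Iff.rfl

theorem mem_Δ {r : ℝ} {z : ℂ} : z ∈ Δ r ↔ 1 / r < ‖z‖ := Iff.rfl

theorem D_eq_ball (r : ℝ) : D r = Metric.ball 0 r := by
  ext z; simp [D]

theorem isOpen_D (r : ℝ) : IsOpen (D r) := by
  rw [D_eq_ball]; exact Metric.isOpen_ball

theorem D_mem_nhds {r : ℝ} (hr : 0 < r) : D r ∈ 𝓝 (0 : ℂ) := by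
  rw [D_eq_ball]; exact Metric.ball_mem_nhds _ hr

theorem D_mono {r s : ℝ} (h : r ≤ s) : D r ⊆ D s := fun _ hz => lt_of_lt_of_le hz h

theorem Δ_mono {r s : ℝ} (hr : 0 < r) (h : r ≤ s) : Δ r ⊆ Δ s := fun _ hz =>
  lt_of_le_of_lt (one_div_le_one_div_of_le hr h) hz

theorem exists_D_of_eventually {p : ℂ → Prop} (h : ∀ᶠ z in 𝓝 0, p z) :
    ∃ r : ℝ, 0 < r ∧ r < 1 ∧ ∀ z ∈ D r, p z := by
  obtain ⟨ε, hε, h⟩ := Metric.eventually_nhds_iff.1 h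
  refine ⟨min ε (1 / 2), by positivity, (min_le_right _ _).trans_lt (by norm_num), fun z hz => ?_⟩
  exact h (by simpa using lt_of_lt_of_le hz (min_le_left _ _))

/-- The coordinate function on the circle. -/
def coordX : C(Circle, ℂ) := ⟨fun x => (x : ℂ), by fun_prop⟩

theorem norm_coordX : ‖coordX‖ ≤ 1 :=
  (ContinuousMap.norm_le _ zero_le_one).2 fun x => (Circle.norm_coe x).le

variable (ν : ProbabilityMeasure Circle)

/-- The quotient `ψ(z) / z`. -/
def psiQuot (z : ℂ) : ℂ := integralL (ν : Measure Circle) (coordX * res coordX z)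

variable {z : ℂ}

theorem psiQuot_zero : psiQuot ν 0 = mean ν := by
  rw [psiQuot, res_zero, mul_one]
  rfl

theorem psi_eq_mul_psiQuot (hz : ‖z‖ < 1) : psi ν z = z * psiQuot ν z := by
  rw [psiQuot, ← smul_eq_mul, ← map_smul, integralL_apply]
  refine integral_congr_ae (.of_forall fun x => ?_)
  simp only [ContinuousMap.smul_apply, ContinuousMap.mul_apply, res_apply norm_coordX hz,
    smul_eq_mul]
  rw [div_eq_mul_inv, mul_assoc]
  rfl

theorem one_add_psi_eq (hz : ‖z‖ < 1) :
    1 + psi ν z = ∫ x, (1 - z * (x : ℂ))⁻¹ ∂(ν : Measure Circle) := by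
  have h : res coordX z = 1 + z • (coordX * res coordX z) := by
    have := mul_res norm_coordX hz
    rw [sub_mul, one_mul, sub_eq_iff_eq_add, smul_mul_assoc] at this
    exact this
  have h1 : integralL (ν : Measure Circle) (res coordX z) = 1 + psi ν z := by
    conv_lhs => rw [h, map_add, map_smul]
    rw [psi_eq_mul_psiQuot ν hz, smul_eq_mul, integralL_apply]
    simp [psiQuot]
  rw [← h1, integralL_apply]
  refine integral_congr_ae (.of_forall fun x => ?_)
  exact res_apply norm_coordX hz x

theorem differentiableAt_psiQuot (hz : ‖z‖ < 1) : DifferentiableAt ℂ (psiQuot ν) z :=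
  (integralL (ν : Measure Circle)).differentiableAt.comp z
    ((differentiableAt_res norm_coordX hz).const_mul coordX)

theorem eventually_norm_lt_one : ∀ᶠ z : ℂ in 𝓝 0, ‖z‖ < 1 := D_mem_nhds one_pos

theorem differentiableAt_psi (hz : ‖z‖ < 1) : DifferentiableAt ℂ (psi ν) z := by
  have h : psi ν =ᶠ[𝓝 z] fun z => z * psiQuot ν z := by
    filter_upwards [(isOpen_D 1).mem_nhds hz] with u hu using psi_eq_mul_psiQuot ν hu
  exact (differentiableAt_id.mul (differentiableAt_psiQuot ν hz)).congr_of_eventuallyEq h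

theorem psi_zero : psi ν 0 = 0 := by simp [psi]

theorem eta_zero : eta ν 0 = 0 := by simp [eta, psi_zero]

theorem hasDerivAt_eta_zero : HasDerivAt (eta ν) (mean ν) 0 := by
  have hz : ‖(0 : ℂ)‖ < 1 := by simp
  have h1 : HasDerivAt (psi ν) (mean ν) 0 := by
    have h : psi ν =ᶠ[𝓝 0] fun z => z * psiQuot ν z := by
      filter_upwards [eventually_norm_lt_one] with u hu using psi_eq_mul_psiQuot ν hu
    have h2 := (hasDerivAt_id (0 : ℂ)).mul (differentiableAt_psiQuot ν hz).hasDerivAt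
    simp only [id, one_mul, zero_mul, add_zero, psiQuot_zero] at h2
    exact h2.congr_of_eventuallyEq h
  have h3 : HasDerivAt (eta ν) _ 0 := h1.div (h1.const_add 1) (by simp [psi_zero])
  simpa [psi_zero] using h3

theorem eventually_differentiableAt_eta : ∀ᶠ z in 𝓝 0, DifferentiableAt ℂ (eta ν) z := by
  have h1 : ∀ᶠ z in 𝓝 0, 1 + psi ν z ≠ 0 := by
    have : ContinuousAt (fun z => 1 + psi ν z) 0 :=
      continuousAt_const.add (differentiableAt_psi ν (by simp)).continuousAt
    exact this.eventually_ne (by simp [psi_zero])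
  filter_upwards [h1, eventually_norm_lt_one] with z hz hz1
  exact (differentiableAt_psi ν hz1).div ((differentiableAt_psi ν hz1).const_add 1) hz

variable {ν}

/-- The inverse function theorem at 0, where `η` has derivative `mean ν`. Injectivity near 0 is
recorded too, for the uniqueness of small inverses. -/
theorem exists_local_inverse (hν : mean ν ≠ 0) :
    (∃ g : ℂ → ℂ, g 0 = 0 ∧ ∀ᶠ z in 𝓝 0, DifferentiableAt ℂ g z ∧ eta ν (g z) = z) ∧
    ∃ U ∈ 𝓝 (0 : ℂ), Set.InjOn (eta ν) U := by
  have hc : ContDiffAt ℂ 1 (eta ν) 0 :=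
    (Complex.analyticAt_iff_eventually_differentiableAt.2 (eventually_differentiableAt_eta ν)).contDiffAt
  let f' : ℂ ≃L[ℂ] ℂ := ContinuousLinearEquiv.unitsEquivAut ℂ (Units.mk0 (mean ν) hν)
  have hf' : HasFDerivAt (eta ν) (f' : ℂ →L[ℂ] ℂ) 0 := by
    have : (f' : ℂ →L[ℂ] ℂ) = ContinuousLinearMap.toSpanSingleton ℂ (mean ν) := by
      ext
      simp [f']
    rw [this]
    exact (hasDerivAt_eta_zero ν).hasFDerivAt
  let e := hc.toOpenPartialHomeomorph (eta ν) hf' one_ne_zero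
  have he : ∀ z, e z = eta ν z := fun z => rfl
  have h0s : (0 : ℂ) ∈ e.source := hc.mem_toOpenPartialHomeomorph_source hf' one_ne_zero
  have h0t : (0 : ℂ) ∈ e.target := by
    have := hc.image_mem_toOpenPartialHomeomorph_target hf' one_ne_zero
    rwa [eta_zero] at this
  refine ⟨⟨e.symm, ?_, ?_⟩, e.source, e.open_source.mem_nhds h0s, e.injOn⟩
  · have := e.left_inv h0s
    rwa [he, eta_zero] at this
  · have h1 := hc.to_localInverse hf' one_ne_zero
    rw [eta_zero] at h1
    have h2 : ∀ᶠ z in 𝓝 (0 : ℂ), ContDiffAt ℂ 1 e.symm z := h1.eventually (by simp)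
    filter_upwards [h2, e.open_target.mem_nhds h0t] with z hz hz'
    exact ⟨hz.differentiableAt one_ne_zero, e.right_inv hz'⟩

variable (ν) in
/-- The reflected measure on the circle. -/
def circInv : ProbabilityMeasure Circle :=
  ν.map (f := fun x => x⁻¹) (Continuous.measurable (by fun_prop)).aemeasurable

theorem integral_circInv (f : Circle → ℂ) (hf : Measurable f) :
    ∫ x, f x ∂(circInv ν : Measure Circle) = ∫ x, f x⁻¹ ∂(ν : Measure Circle) :=
  integral_map (Continuous.measurable (by fun_prop)).aemeasurable hf.aestronglyMeasurable

theorem mean_circInv : mean (circInv ν) = star (mean ν) := by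
  rw [mean, integral_circInv _ (Continuous.measurable (by fun_prop)), mean, RCLike.star_def,
    ← integral_conj]
  exact integral_congr_ae (.of_forall fun x => Circle.coe_inv_eq_conj x)

/-- From `x / (z - x) = -1 / (1 - z / x)` one gets `ψ_ν(1/z) = -(1 + ψ(z))` with `ψ` taken for the
reflected measure. This transfers statements at infinity to the origin. -/
theorem eta_inv (hz : ‖z‖ < 1) (hz0 : z ≠ 0) : eta ν z⁻¹ = (eta (circInv ν) z)⁻¹ := by
  have h : psi ν z⁻¹ = -(1 + psi (circInv ν) z) := by
    rw [one_add_psi_eq _ hz, integral_circInv _ ?_, ← integral_neg]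
    · refine integral_congr_ae (.of_forall fun x => ?_)
      have hx : (x : ℂ) ≠ 0 := Circle.coe_ne_zero x
      have h1 : z - x ≠ 0 := by
        intro h
        rw [sub_eq_zero] at h
        rw [h, Circle.norm_coe] at hz
        exact lt_irrefl _ hz
      have h2 : (x : ℂ) - z ≠ 0 := by rwa [← neg_sub, neg_ne_zero]
      change z⁻¹ * (x : ℂ) / (1 - z⁻¹ * x) = -(1 - z * ((x⁻¹ : Circle) : ℂ))⁻¹
      rw [Circle.coe_inv]
      have h3 : 1 - z⁻¹ * (x : ℂ) = (z - x) / z := by field_simp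
      have h4 : 1 - z * (x : ℂ)⁻¹ = (x - z) / x := by field_simp
      rw [h3, h4, inv_div, ← neg_sub z (x : ℂ), div_neg, neg_neg]
      field_simp
    · exact Measurable.inv (Continuous.measurable (by fun_prop))
  rw [eta, eta, h, inv_div, neg_add_rev, add_comm (-psi _ _), add_neg_cancel_left, ← neg_add_rev,
    add_comm (psi _ _), neg_div_neg_eq]

theorem IsEtaInv.mono {r s : ℝ} {g : ℂ → ℂ} (h : IsEtaInv ν s g) (hr : 0 < r) (hrs : r ≤ s) :
    IsEtaInv ν r g :=
  have hsub := Set.union_subset_union (D_mono hrs) (Δ_mono hr hrs)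
  ⟨h.1.mono hsub, h.2.1.mono_left (D_mono hrs), h.2.2.1.mono_left (Δ_mono hr hrs), h.2.2.2.1,
    h.2.2.2.2.1, fun z hz => h.2.2.2.2.2 z (hsub hz)⟩

theorem isEtaInv_etaInv (hν : mean ν ≠ 0) : ∃ r : ℝ, 0 < r ∧ r < 1 ∧ IsEtaInv ν r (etaInv ν) := by
  refine Classical.epsilon_spec (p := fun g => ∃ r : ℝ, 0 < r ∧ r < 1 ∧ IsEtaInv ν r g) ?_
  have hν' : mean (circInv ν) ≠ 0 := by rw [mean_circInv]; exact star_ne_zero.2 hν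
  obtain ⟨⟨g₀, hg₀, h₀⟩, -⟩ := exists_local_inverse hν
  obtain ⟨⟨g₁, hg₁, h₁⟩, -⟩ := exists_local_inverse hν'
  have hn : ∀ {g : ℂ → ℂ} {ν : ProbabilityMeasure Circle}, g 0 = 0 →
      (∀ᶠ z in 𝓝 0, DifferentiableAt ℂ g z ∧ eta ν (g z) = z) →
      Tendsto g (𝓝 0) (𝓝 0) ∧ ∀ᶠ z in 𝓝 0, ‖g z‖ < 1 := by
    intro g ν hg h
    have h1 : Tendsto g (𝓝 0) (𝓝 0) := by
      have := h.self_of_nhds.1.continuousAt.tendsto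
      rwa [hg] at this
    exact ⟨h1, h1.eventually eventually_norm_lt_one⟩
  obtain ⟨r, hr0, hr1, hr⟩ := exists_D_of_eventually
    (h₀.and (h₁.and ((hn hg₀ h₀).2.and (hn hg₁ h₁).2)))
  have hinv : ∀ z ∈ Δ r, z⁻¹ ∈ D r ∧ z⁻¹ ≠ 0 ∧ g₁ z⁻¹ ≠ 0 ∧ 1 < ‖z‖ := by
    intro z hz
    have hz1 : 1 < ‖z‖ := ((one_lt_div hr0).2 hr1).trans hz
    have hzi : z⁻¹ ∈ D r := by
      rw [mem_D, norm_inv]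
      exact inv_lt_of_inv_lt₀ hr0 (by simpa [mem_Δ] using hz)
    have hz0 : z⁻¹ ≠ 0 := inv_ne_zero (norm_pos_iff.1 (by linarith))
    refine ⟨hzi, hz0, fun h => hz0 ?_, hz1⟩
    rw [← (hr _ hzi).2.1.2, h, eta_zero]
  -- Near infinity the inverse is the reciprocal of the local inverse for the reflected measure. The
  -- two regions are separated by the unit circle, so any definition in between is harmless.
  let g : ℂ → ℂ := fun z => if ‖z‖ < 1 then g₀ z else (g₁ z⁻¹)⁻¹
  have gD : ∀ {z}, ‖z‖ < 1 → g z = g₀ z := fun hz => if_pos hz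
  have gΔ : ∀ {z}, 1 < ‖z‖ → g z = (g₁ z⁻¹)⁻¹ := fun hz => if_neg hz.not_gt
  have hD1 : ∀ {z}, z ∈ D r → ‖z‖ < 1 := fun hz => lt_trans hz hr1
  refine ⟨g, r, hr0, hr1, ?_, ?_, ?_, ?_, ?_, ?_⟩
  · rintro z (hz | hz)
    · refine DifferentiableAt.differentiableWithinAt ?_
      refine (hr z hz).1.1.congr_of_eventuallyEq ?_
      filter_upwards [(isOpen_D 1).mem_nhds (hD1 hz)] with u hu using gD hu
    · obtain ⟨h1, h2, h3, h4⟩ := hinv z hz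
      refine DifferentiableAt.differentiableWithinAt ?_
      have : DifferentiableAt ℂ (fun z => (g₁ z⁻¹)⁻¹) z :=
        ((hr _ h1).2.1.1.comp z (differentiableAt_inv (by simpa using h2))).inv h3
      refine this.congr_of_eventuallyEq ?_
      filter_upwards [(isOpen_lt continuous_const continuous_norm).mem_nhds h4] with u hu
        using gΔ hu
  · intro z hz
    rw [gD (hD1 hz)]
    exact (hr z hz).2.2.1
  · intro z hz
    obtain ⟨h1, h2, h3, h4⟩ := hinv z hz
    rw [gΔ h4, mem_Δ, norm_inv, one_div_one]
    exact (one_lt_inv₀ (norm_pos_iff.2 h3)).2 (hr _ h1).2.2.2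
  · rw [gD (by simp), hg₀]
  · have h1 : ∀ᶠ z in Bornology.cobounded ℂ, z ∈ Δ r := by
      exact (tendsto_norm_cobounded_atTop (E := ℂ)).eventually (eventually_gt_atTop (1 / r))
    have h2 : Tendsto (fun z => g₁ z⁻¹) (Bornology.cobounded ℂ) (𝓝[≠] 0) := by
      refine tendsto_nhdsWithin_iff.2 ⟨(hn hg₁ h₁).1.comp tendsto_inv₀_cobounded, ?_⟩
      filter_upwards [h1] with z hz using (hinv z hz).2.2.1
    refine (tendsto_inv₀_nhdsNE_zero.comp h2).congr' ?_
    filter_upwards [h1] with z hz using (gΔ (hinv z hz).2.2.2).symm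
  · rintro z (hz | hz)
    · rw [gD (hD1 hz)]
      exact (hr z hz).1.2
    · obtain ⟨h1, h2, h3, h4⟩ := hinv z hz
      rw [gΔ h4, eta_inv (hr _ h1).2.2.2 h3, (hr _ h1).2.1.2, inv_inv]

theorem etaInv_zero (hν : mean ν ≠ 0) : etaInv ν 0 = 0 := by
  obtain ⟨r, -, -, h⟩ := isEtaInv_etaInv hν
  exact h.2.2.2.1

theorem eventually_etaInv (hν : mean ν ≠ 0) :
    ∀ᶠ z in 𝓝 0, DifferentiableAt ℂ (etaInv ν) z ∧ eta ν (etaInv ν z) = z := by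
  obtain ⟨r, hr, -, h⟩ := isEtaInv_etaInv hν
  filter_upwards [D_mem_nhds hr] with z hz
  have h1 : D r ∪ Δ r ∈ 𝓝 z :=
    mem_of_superset ((isOpen_D r).mem_nhds hz) Set.subset_union_left
  exact ⟨h.1.differentiableAt h1, h.2.2.2.2.2 z (Or.inl hz)⟩

theorem tendsto_etaInv (hν : mean ν ≠ 0) : Tendsto (etaInv ν) (𝓝 0) (𝓝 0) := by
  have := (eventually_etaInv hν).self_of_nhds.1.continuousAt.tendsto
  rwa [etaInv_zero hν] at this

/-- A right inverse of `η` tending to 0 is the chosen one, because `η` is injective near 0. The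
general filter `l` admits right inverses known only on a punctured neighbourhood. -/
theorem eventually_eq_etaInv (hν : mean ν ≠ 0) {l : Filter ℂ} (hl : l ≤ 𝓝 0) {h : ℂ → ℂ}
    (h0 : Tendsto h l (𝓝 0)) (hη : ∀ᶠ z in l, eta ν (h z) = z) :
    ∀ᶠ z in l, h z = etaInv ν z := by
  obtain ⟨-, U, hU, hinj⟩ := exists_local_inverse hν
  filter_upwards [h0.eventually hU, hη, hl ((tendsto_etaInv hν).eventually hU),
    hl (eventually_etaInv hν)] with z h1 h2 h3 h4
  exact hinj h1 h3 (h2.trans h4.2.symm)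

theorem eventually_one_add_psi_etaInv (hν : mean ν ≠ 0) :
    ∀ᶠ z in 𝓝 0, (1 - z) * (1 + psi ν (etaInv ν z)) = 1 := by
  -- Needed because the quotient defining `eta` has the default value 0 where its denominator
  -- vanishes.
  have h1 : ∀ᶠ z in 𝓝 0, 1 + psi ν (etaInv ν z) ≠ 0 := by
    have : Tendsto (fun z => 1 + psi ν (etaInv ν z)) (𝓝 0) (𝓝 (1 + 0)) := by
      have h2 := (differentiableAt_psi ν (z := 0) (by simp)).continuousAt.tendsto
      rw [psi_zero] at h2
      exact tendsto_const_nhds.add (h2.comp (tendsto_etaInv hν))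
    exact this.eventually_ne (by simp)
  filter_upwards [h1, eventually_etaInv hν] with z hz h
  have h2 := h.2
  rw [eta, div_eq_iff hz] at h2
  linear_combination h2

/-- The quotient `η⁻¹(z) / z`. -/
theorem exists_etaInv_quot (hν : mean ν ≠ 0) : ∃ k : ℂ → ℂ, (∀ z, etaInv ν z = z * k z) ∧
    ∀ᶠ z in 𝓝 0, DifferentiableAt ℂ k z ∧ k z ≠ 0 := by
  refine ⟨dslope (etaInv ν) 0, fun z => ?_, ?_⟩
  · have := sub_smul_dslope (etaInv ν) 0 z
    rw [etaInv_zero hν, sub_zero, sub_zero, smul_eq_mul] at this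
    exact this.symm
  obtain ⟨r, hr, -, h⟩ := exists_D_of_eventually (eventually_etaInv hν)
  have hd : DifferentiableOn ℂ (dslope (etaInv ν) 0) (D r) :=
    (Complex.differentiableOn_dslope (D_mem_nhds hr)).2 fun z hz =>
      (h z hz).1.differentiableWithinAt
  -- The value at 0 is the derivative of the inverse, nonzero by the chain rule applied to `η ∘ η⁻¹
  -- = id`.
  have h0 : dslope (etaInv ν) 0 0 ≠ 0 := by
    rw [dslope_same]
    intro h0
    have h1 := (eventually_etaInv hν).self_of_nhds.1.hasDerivAt
    rw [h0] at h1
    have h2 : HasDerivAt (fun z => eta ν (etaInv ν z)) (mean ν * 0) 0 := by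
      have h := hasDerivAt_eta_zero ν
      rw [← etaInv_zero hν] at h
      exact h.comp 0 h1
    have h3 : HasDerivAt (fun z => eta ν (etaInv ν z)) 1 0 :=
      (hasDerivAt_id 0).congr_of_eventuallyEq
        ((eventually_etaInv hν).mono fun z hz => hz.2)
    simpa using h2.unique h3
  have hc := (hd.differentiableAt (D_mem_nhds hr)).continuousAt.eventually_ne h0
  filter_upwards [hc, D_mem_nhds hr] with z hz hzr
  exact ⟨hd.differentiableAt ((isOpen_D r).mem_nhds hzr), hz⟩

end BiFree

end

noncomputable section

namespace BiFree

/-! ### Marginals, reflection and divided differences of `H`. -/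

section Marginals

variable (μ : ProbabilityMeasure Torus)

theorem integral_marg₁ (f : Circle → ℂ) (hf : Measurable f) :
    ∫ x, f x ∂(marg₁ μ : Measure Circle) = ∫ p : Torus, f p.1 ∂(μ : Measure Torus) :=
  integral_map measurable_fst.aemeasurable hf.aestronglyMeasurable

theorem integral_marg₂ (f : Circle → ℂ) (hf : Measurable f) :
    ∫ x, f x ∂(marg₂ μ : Measure Circle) = ∫ p : Torus, f p.2 ∂(μ : Measure Torus) :=
  integral_map measurable_snd.aemeasurable hf.aestronglyMeasurable

theorem mean_marg₁ : mean (marg₁ μ) = ∫ p : Torus, (p.1 : ℂ) ∂(μ : Measure Torus) :=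
  integral_marg₁ μ _ (Continuous.measurable (by fun_prop))

theorem mean_marg₂ : mean (marg₂ μ) = ∫ p : Torus, (p.2 : ℂ) ∂(μ : Measure Torus) :=
  integral_marg₂ μ _ (Continuous.measurable (by fun_prop))

theorem measurable_inv_one_sub (z : ℂ) : Measurable fun x : Circle => (1 - z * (x : ℂ))⁻¹ :=
  Measurable.inv (Continuous.measurable (by fun_prop))

theorem measurable_circle_inv : Measurable fun x : Circle => x⁻¹ :=
  Continuous.measurable (by fun_prop)

theorem H_zero_right {Z : ℂ} (hZ : ‖Z‖ < 1) : H μ Z 0 = 1 + psi (marg₁ μ) Z := by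
  rw [one_add_psi_eq _ hZ, integral_marg₁ _ _ (measurable_inv_one_sub _)]
  simp [H]

theorem H_zero_left {W : ℂ} (hW : ‖W‖ < 1) : H μ 0 W = 1 + psi (marg₂ μ) W := by
  rw [one_add_psi_eq _ hW, integral_marg₂ _ _ (measurable_inv_one_sub _)]
  simp [H]

theorem measurable_reflect : Measurable fun p : Torus => (p.1, p.2⁻¹) :=
  Continuous.measurable (by fun_prop)

theorem marg₁_reflect : marg₁ (reflect μ) = marg₁ μ := by
  refine Subtype.ext ?_
  exact Measure.map_map measurable_fst measurable_reflect

theorem marg₂_reflect : marg₂ (reflect μ) = circInv (marg₂ μ) := by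
  refine Subtype.ext ?_
  refine (Measure.map_map measurable_snd measurable_reflect).trans ?_
  exact (Measure.map_map measurable_circle_inv measurable_snd).symm

theorem integrable_coe (f : C(Torus, ℂ)) : Integrable (fun x => f x) (μ : Measure Torus) :=
  (BoundedContinuousFunction.mkOfCompact f).integrable _

/-- Integrate the identity `1 / (1 - t/V) = 1 - 1 / (1 - V/t)` against the resolvent in `s`, using
`1/t = star t` on the circle. -/
theorem H_inv {Z V : ℂ} (hZ : ‖Z‖ < 1) (hV : ‖V‖ < 1) (hV0 : V ≠ 0) :
    H μ Z V⁻¹ = H μ Z 0 - H (reflect μ) Z V := by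
  have hT : ‖star coordT‖ ≤ 1 := (norm_star _).trans_le norm_coordT
  have h1 : H (reflect μ) Z V
      = ∫ p, (res coordS Z * res (star coordT) V) p ∂(μ : Measure Torus) := by
    rw [H]
    refine (integral_map measurable_reflect.aemeasurable
      (Measurable.aestronglyMeasurable ?_)).trans (integral_congr_ae (.of_forall fun p => ?_))
    · simp_rw [one_div]
      exact Measurable.inv (Continuous.measurable (by fun_prop))
    · change 1 / ((1 - Z * (p.1 : ℂ)) * (1 - V * ((p.2⁻¹ : Circle) : ℂ)))
        = res coordS Z p * res (star coordT) V p
      rw [res_apply norm_coordS hZ, res_apply hT hV, Circle.coe_inv_eq_conj, one_div, mul_inv]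
      rfl
  have h2 : H μ Z 0 = ∫ p, res coordS Z p ∂(μ : Measure Torus) := by
    refine integral_congr_ae (.of_forall fun p => ?_)
    rw [res_apply norm_coordS hZ]
    simp [coordS]
  rw [h1, h2, ← integral_sub (integrable_coe μ _) (integrable_coe μ _)]
  refine integral_congr_ae (.of_forall fun p => ?_)
  change 1 / ((1 - Z * (p.1 : ℂ)) * (1 - V⁻¹ * (p.2 : ℂ)))
    = res coordS Z p - res coordS Z p * res (star coordT) V p
  have hs : 1 - Z * (p.1 : ℂ) ≠ 0 := one_sub_mul_ne_zero norm_coordS hZ p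
  have ht : (p.2 : ℂ) ≠ 0 := Circle.coe_ne_zero _
  have ht' : star coordT p = (p.2 : ℂ)⁻¹ := by
    rw [← Circle.coe_inv, Circle.coe_inv_eq_conj]
    rfl
  have hVt : 1 - V * (p.2 : ℂ)⁻¹ ≠ 0 := by
    rw [← ht']; exact one_sub_mul_ne_zero hT hV p
  rw [res_apply norm_coordS hZ, res_apply hT hV, ht']
  change _ = (1 - Z * (p.1 : ℂ))⁻¹ - (1 - Z * (p.1 : ℂ))⁻¹ * _
  have h3 : (p.2 : ℂ) - V ≠ 0 := by
    intro h
    apply hVt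
    rw [← sub_eq_zero.1 h, mul_inv_cancel₀ ht, sub_self]
  have h4 : 1 - V⁻¹ * (p.2 : ℂ) = -((p.2 : ℂ) - V) / V := by field_simp; ring
  have h5 : 1 - V * (p.2 : ℂ)⁻¹ = ((p.2 : ℂ) - V) / p.2 := by field_simp
  rw [h4, h5]
  field_simp
  ring

/-- The quotient `(H(Z, W) - H(0, W)) / Z`. -/
def Hquot₁ (p : ℂ × ℂ) : ℂ :=
  integralL (μ : Measure Torus) (coordS * (res coordS p.1 * res coordT p.2))

/-- The quotient `(H(Z, W) - H(Z, 0)) / W`. -/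
def Hquot₂ (p : ℂ × ℂ) : ℂ :=
  integralL (μ : Measure Torus) (coordT * (res coordS p.1 * res coordT p.2))

theorem res_sub_one {x : C(Torus, ℂ)} (hx : ‖x‖ ≤ 1) {Z : ℂ} (hZ : ‖Z‖ < 1) :
    res x Z = 1 + Z • (x * res x Z) := by
  have := mul_res hx hZ
  rwa [sub_mul, one_mul, sub_eq_iff_eq_add, smul_mul_assoc] at this

theorem H_sub_left {Z W : ℂ} (hZ : ‖Z‖ < 1) (hW : ‖W‖ < 1) :
    H μ Z W - H μ 0 W = Z * Hquot₁ μ (Z, W) := by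
  rw [H_eq_integralL μ hZ hW, H_eq_integralL μ (by simp) hW, res_zero, one_mul, Hquot₁]
  have h : res coordS Z * res coordT W
      = res coordT W + Z • (coordS * (res coordS Z * res coordT W)) := by
    conv_lhs => rw [res_sub_one norm_coordS hZ]
    rw [add_mul, one_mul, smul_mul_assoc, mul_assoc]
  conv_lhs => rw [h, map_add, map_smul, add_sub_cancel_left, smul_eq_mul]

theorem H_sub_right {Z W : ℂ} (hZ : ‖Z‖ < 1) (hW : ‖W‖ < 1) :
    H μ Z W - H μ Z 0 = W * Hquot₂ μ (Z, W) := by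
  rw [H_eq_integralL μ hZ hW, H_eq_integralL μ hZ (by simp), res_zero, mul_one, Hquot₂]
  have h : res coordS Z * res coordT W
      = res coordS Z + W • (coordT * (res coordS Z * res coordT W)) := by
    conv_lhs => rw [res_sub_one norm_coordT hW]
    rw [mul_add, mul_one, mul_smul_comm, mul_left_comm]
  conv_lhs => rw [h, map_add, map_smul, add_sub_cancel_left, smul_eq_mul]

theorem Hquot₂_zero : Hquot₂ μ (0, 0) = mean (marg₂ μ) := by
  rw [mean_marg₂, Hquot₂, res_zero, res_zero, mul_one, mul_one]
  rfl

theorem differentiableAt_res_mul_res {p : ℂ × ℂ} (h1 : ‖p.1‖ < 1) (h2 : ‖p.2‖ < 1) :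
    DifferentiableAt ℂ (fun p : ℂ × ℂ => res coordS p.1 * res coordT p.2) p :=
  ((differentiableAt_res norm_coordS h1).comp p differentiableAt_fst).mul
    ((differentiableAt_res norm_coordT h2).comp p differentiableAt_snd)

theorem differentiableAt_Hquot₁ {p : ℂ × ℂ} (h1 : ‖p.1‖ < 1) (h2 : ‖p.2‖ < 1) :
    DifferentiableAt ℂ (Hquot₁ μ) p :=
  (integralL (μ : Measure Torus)).differentiableAt.comp p
    ((differentiableAt_res_mul_res h1 h2).const_mul coordS)

theorem differentiableAt_Hquot₂ {p : ℂ × ℂ} (h1 : ‖p.1‖ < 1) (h2 : ‖p.2‖ < 1) :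
    DifferentiableAt ℂ (Hquot₂ μ) p :=
  (integralL (μ : Measure Torus)).differentiableAt.comp p
    ((differentiableAt_res_mul_res h1 h2).const_mul coordT)

end Marginals

/-! ### The holomorphic form of the opposite Σ-transform. -/

theorem exists_D_prod_of_eventually {p : ℂ × ℂ → Prop} (h : ∀ᶠ q in 𝓝 (0, 0), p q) :
    ∃ r : ℝ, 0 < r ∧ r < 1 ∧ ∀ z ∈ D r, ∀ w ∈ D r, p (z, w) := by
  obtain ⟨ε, hε, h⟩ := Metric.eventually_nhds_iff.1 h
  refine ⟨min ε (1 / 2), by positivity, (min_le_right _ _).trans_lt (by norm_num),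
    fun z hz w hw => h ?_⟩
  rw [Prod.dist_eq]
  simpa using ⟨lt_of_lt_of_le hz (min_le_left _ _), lt_of_lt_of_le hw (min_le_left _ _)⟩

/-- The normalized joint transform. -/
def kappa (μ : ProbabilityMeasure Torus) (z w : ℂ) : ℂ :=
  (1 - z) * (1 - w) * H μ (etaInv (marg₁ μ) z) (etaInv (marg₂ μ) w) - 1

/-- `F` is the opposite `Σ`-transform of `μ` on `D_r × D_r`, the singularities removed. -/
structure IsSigmaOp (μ : ProbabilityMeasure Torus) (r : ℝ) (F : ℂ × ℂ → ℂ) : Prop where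
  pos : 0 < r
  lt_one : r < 1
  diff : DifferentiableOn ℂ F (D r ×ˢ D r)
  inv₁ : IsEtaInv (marg₁ μ) r (etaInv (marg₁ μ))
  inv₂ : IsEtaInv (marg₂ μ) r (etaInv (marg₂ μ))
  norm₁ : ∀ z ∈ D r, (1 - z) * (1 + psi (marg₁ μ) (etaInv (marg₁ μ) z)) = 1
  ne_zero : ∀ z ∈ D r, ∀ w ∈ D r, w ≠ 0 → kappa μ z w + w ≠ 0
  eq : ∀ z ∈ D r, ∀ w ∈ D r, z ≠ 0 → w ≠ 0 →
    F (z, w) = w * (kappa μ z w + z) / (z * (kappa μ z w + w))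

theorem IsSigmaOp.mono {μ : ProbabilityMeasure Torus} {r s : ℝ} {F : ℂ × ℂ → ℂ}
    (h : IsSigmaOp μ s F) (hr : 0 < r) (hrs : r ≤ s) : IsSigmaOp μ r F where
  pos := hr
  lt_one := hrs.trans_lt h.lt_one
  diff := h.diff.mono (Set.prod_mono (D_mono hrs) (D_mono hrs))
  inv₁ := h.inv₁.mono hr hrs
  inv₂ := h.inv₂.mono hr hrs
  norm₁ z hz := h.norm₁ z (D_mono hrs hz)
  ne_zero z hz w hw := h.ne_zero z (D_mono hrs hz) w (D_mono hrs hw)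
  eq z hz w hw := h.eq z (D_mono hrs hz) w (D_mono hrs hw)

theorem one_sub_ne_zero_of_norm {z : ℂ} (hz : ‖z‖ < 1) : 1 - z ≠ 0 := by
  intro h
  rw [← sub_eq_zero.1 h, norm_one] at hz
  exact lt_irrefl _ hz

/-- Both `κ + z` and `κ + w` factor through divided differences of `H`, so the apparent poles on the
axes cancel. The divided difference in the denominator equals the second marginal mean at the
origin. -/
theorem exists_isSigmaOp {μ : ProbabilityMeasure Torus} (h₁ : mean (marg₁ μ) ≠ 0)
    (h₂ : mean (marg₂ μ) ≠ 0) : ∃ r F, IsSigmaOp μ r F := by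
  obtain ⟨r₁, hr₁, hr₁', hi₁⟩ := isEtaInv_etaInv h₁
  obtain ⟨r₂, hr₂, hr₂', hi₂⟩ := isEtaInv_etaInv h₂
  obtain ⟨k₁, hk₁, hk₁'⟩ := exists_etaInv_quot h₁
  obtain ⟨k₂, hk₂, hk₂'⟩ := exists_etaInv_quot h₂
  set g₁ := etaInv (marg₁ μ) with hg₁
  set g₂ := etaInv (marg₂ μ) with hg₂
  have hfst : Tendsto (Prod.fst : ℂ × ℂ → ℂ) (𝓝 (0, 0)) (𝓝 0) := continuous_fst.tendsto _
  have hsnd : Tendsto (Prod.snd : ℂ × ℂ → ℂ) (𝓝 (0, 0)) (𝓝 0) := continuous_snd.tendsto _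
  have hnorm₁ := (tendsto_etaInv h₁).eventually eventually_norm_lt_one
  have hnorm₂ := (tendsto_etaInv h₂).eventually eventually_norm_lt_one
  have hne : ∀ᶠ p : ℂ × ℂ in 𝓝 (0, 0), Hquot₂ μ (g₁ p.1, g₂ p.2) ≠ 0 := by
    have hc : ContinuousAt (Hquot₂ μ) (0, 0) :=
      (differentiableAt_Hquot₂ μ (p := (0, 0)) (by simp) (by simp)).continuousAt
    have ht : Tendsto (fun p : ℂ × ℂ => (g₁ p.1, g₂ p.2)) (𝓝 (0, 0)) (𝓝 (0, 0)) :=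
      ((tendsto_etaInv h₁).comp hfst).prodMk_nhds ((tendsto_etaInv h₂).comp hsnd)
    refine ht.eventually (hc.eventually_ne ?_)
    rwa [Hquot₂_zero]
  obtain ⟨r, hr0, hr1, hr⟩ := exists_D_prod_of_eventually
    ((hfst.eventually (hk₁'.and ((eventually_etaInv h₁).and
      (hnorm₁.and (eventually_one_add_psi_etaInv h₁))))).and
    ((hsnd.eventually (hk₂'.and ((eventually_etaInv h₂).and
      (hnorm₂.and (eventually_one_add_psi_etaInv h₂))))).and hne))
  -- The quotient after cancelling `z` against `η⁻¹(z) = z k₁(z)` and `w` against `η⁻¹(w) = w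
  -- k₂(w)`.
  let F : ℂ × ℂ → ℂ := fun p => k₁ p.1 * Hquot₁ μ (g₁ p.1, g₂ p.2)
    / (k₂ p.2 * Hquot₂ μ (g₁ p.1, g₂ p.2))
  let ρ := min r (min r₁ r₂)
  have hρ : 0 < ρ := lt_min hr0 (lt_min hr₁ hr₂)
  have hρr : D ρ ⊆ D r := D_mono (min_le_left _ _)
  have hlt : ∀ {z : ℂ}, z ∈ D ρ → ‖z‖ < 1 := fun hz => (hρr hz).trans hr1
  -- Since `(1-z) H(Z,0) = 1 = (1-w) H(0,W)`, the terms `w - 1` and `z - 1` are the subtracted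
  -- values of `H` in disguise.
  have key : ∀ z ∈ D ρ, ∀ w ∈ D ρ,
      kappa μ z w + w = (1 - z) * (1 - w) * (g₂ w * Hquot₂ μ (g₁ z, g₂ w)) ∧
      kappa μ z w + z = (1 - z) * (1 - w) * (g₁ z * Hquot₁ μ (g₁ z, g₂ w)) := by
    intro z hz w hw
    obtain ⟨⟨-, -, n1, e1⟩, ⟨-, -, n2, e2⟩, -⟩ := hr z (hρr hz) w (hρr hw)
    dsimp only at n1 e1 n2 e2
    rw [← H_sub_left μ n1 n2, ← H_sub_right μ n1 n2, H_zero_right μ n1, H_zero_left μ n2, kappa]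
    constructor
    · linear_combination (1 - w) * e1
    · linear_combination (1 - z) * e2
  refine ⟨ρ, F, hρ, (min_le_left _ _).trans_lt hr1, ?_,
    hi₁.mono hρ ((min_le_right _ _).trans (min_le_left _ _)),
    hi₂.mono hρ ((min_le_right _ _).trans (min_le_right _ _)), ?_, ?_, ?_⟩
  · rintro ⟨z, w⟩ ⟨hz, hw⟩
    obtain ⟨⟨⟨dk1, -⟩, ⟨dg1, -⟩, n1, -⟩, ⟨⟨dk2, hk2⟩, ⟨dg2, -⟩, n2, -⟩, hne⟩ :=
      hr z (hρr hz) w (hρr hw)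
    refine DifferentiableAt.differentiableWithinAt ?_
    have hg : DifferentiableAt ℂ (fun p : ℂ × ℂ => (g₁ p.1, g₂ p.2)) (z, w) :=
      (DifferentiableAt.comp (f := Prod.fst) (z, w) dg1 differentiableAt_fst).prodMk
        (DifferentiableAt.comp (f := Prod.snd) (z, w) dg2 differentiableAt_snd)
    have hk1 : DifferentiableAt ℂ (fun p : ℂ × ℂ => k₁ p.1) (z, w) :=
      DifferentiableAt.comp (f := Prod.fst) (z, w) dk1 differentiableAt_fst
    have hk2' : DifferentiableAt ℂ (fun p : ℂ × ℂ => k₂ p.2) (z, w) :=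
      DifferentiableAt.comp (f := Prod.snd) (z, w) dk2 differentiableAt_snd
    have hnum : DifferentiableAt ℂ (fun p : ℂ × ℂ => k₁ p.1 * Hquot₁ μ (g₁ p.1, g₂ p.2)) (z, w) :=
      hk1.mul (DifferentiableAt.comp (g := Hquot₁ μ) (z, w)
        (differentiableAt_Hquot₁ μ n1 n2) hg)
    have hden : DifferentiableAt ℂ (fun p : ℂ × ℂ => k₂ p.2 * Hquot₂ μ (g₁ p.1, g₂ p.2)) (z, w) :=
      hk2'.mul (DifferentiableAt.comp (g := Hquot₂ μ) (z, w)
        (differentiableAt_Hquot₂ μ n1 n2) hg)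
    have hF : F = fun p : ℂ × ℂ => k₁ p.1 * Hquot₁ μ (g₁ p.1, g₂ p.2)
        * (k₂ p.2 * Hquot₂ μ (g₁ p.1, g₂ p.2))⁻¹ := funext fun p => div_eq_mul_inv _ _
    rw [hF]
    exact hnum.mul (hden.inv (mul_ne_zero hk2 hne))
  · intro z hz
    exact (hr z (hρr hz) z (hρr hz)).1.2.2.2
  · intro z hz w hw hw0
    obtain ⟨-, ⟨⟨-, hk2⟩, -⟩, hne⟩ := hr z (hρr hz) w (hρr hw)
    have hg0 : g₂ w ≠ 0 := by rw [hk₂]; exact mul_ne_zero hw0 hk2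
    rw [(key z hz w hw).1]
    exact mul_ne_zero (mul_ne_zero (one_sub_ne_zero_of_norm (hlt hz))
      (one_sub_ne_zero_of_norm (hlt hw))) (mul_ne_zero hg0 hne)
  · intro z hz w hw hz0 hw0
    obtain ⟨-, ⟨⟨-, hk2⟩, -⟩, hne⟩ := hr z (hρr hz) w (hρr hw)
    dsimp only at hne hk2
    rw [(key z hz w hw).1, (key z hz w hw).2]
    have a1 := one_sub_ne_zero_of_norm (hlt hz)
    have a2 := one_sub_ne_zero_of_norm (hlt hw)
    change k₁ z * Hquot₁ μ (g₁ z, g₂ w) / (k₂ w * Hquot₂ μ (g₁ z, g₂ w)) = _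
    have b1 : g₁ z = z * k₁ z := hk₁ z
    have b2 : g₂ w = w * k₂ w := hk₂ w
    generalize Hquot₁ μ (g₁ z, g₂ w) = G₁ at *
    generalize Hquot₂ μ (g₁ z, g₂ w) = G₂ at *
    rw [b1, b2]
    field_simp

end BiFree

end

/-! ### Removing the singularities and passing between the `S`- and Σ-variables. -/

noncomputable section

namespace BiFree

/-- The complement of the coordinate axes. -/
abbrev offAxes : Set (ℂ × ℂ) := {q : ℂ × ℂ | q.1 ≠ 0 ∧ q.2 ≠ 0}

theorem mem_closure_offAxes (p : ℂ × ℂ) : p ∈ closure offAxes := by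
  have h : offAxes = ({0}ᶜ : Set ℂ) ×ˢ ({0}ᶜ : Set ℂ) := rfl
  rw [h, closure_prod_eq, closure_compl_singleton, Set.univ_prod_univ]
  trivial

/-- The complement of the axes is dense, so the limit defining the extension is the value of any
continuous function that agrees with `f` there. -/
theorem extendAxes_eq {f F : ℂ × ℂ → ℂ} {p : ℂ × ℂ} (hF : ContinuousAt F p)
    (h : ∀ᶠ q in 𝓝 p, q.1 ≠ 0 → q.2 ≠ 0 → f q = F q) : extendAxes f p = F p := by
  rw [extendAxes]
  split_ifs with hp
  · exact h.self_of_nhds hp.1 hp.2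
  · refine extendFrom_eq (mem_closure_offAxes p) ?_
    refine (hF.tendsto.mono_left nhdsWithin_le_nhds).congr' ?_
    filter_upwards [nhdsWithin_le_nhds h, self_mem_nhdsWithin] with q hq hq'
    exact (hq hq'.1 hq'.2).symm

theorem eq_of_eq_offAxes {F G : ℂ × ℂ → ℂ} {r : ℝ} (hF : DifferentiableOn ℂ F (D r ×ˢ D r))
    (hG : DifferentiableOn ℂ G (D r ×ˢ D r))
    (h : ∀ z ∈ D r, ∀ w ∈ D r, z ≠ 0 → w ≠ 0 → F (z, w) = G (z, w)) :
    ∀ p ∈ D r ×ˢ D r, F p = G p := by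
  intro p hp
  have hopen : D r ×ˢ D r ∈ 𝓝 p := ((isOpen_D r).prod (isOpen_D r)).mem_nhds hp
  have : (𝓝[offAxes] p).NeBot := mem_closure_iff_nhdsWithin_neBot.1 (mem_closure_offAxes p)
  have hFc := ((hF.differentiableAt hopen).continuousAt.tendsto).mono_left
    (nhdsWithin_le_nhds (s := offAxes))
  have hGc := ((hG.differentiableAt hopen).continuousAt.tendsto).mono_left
    (nhdsWithin_le_nhds (s := offAxes))
  refine tendsto_nhds_unique_of_eventuallyEq hFc hGc ?_
  filter_upwards [nhdsWithin_le_nhds hopen, self_mem_nhdsWithin] with q hq hq'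
  exact h q.1 hq.1 q.2 hq.2 hq'.1 hq'.2

/-- The inverse change of variables. -/
def mob (z : ℂ) : ℂ := z / (1 + z)

theorem mob_div_one_sub {z : ℂ} (hz : 1 - z ≠ 0) :
    1 + z / (1 - z) = (1 - z)⁻¹ ∧ mob (z / (1 - z)) = z := by
  have h : 1 + z / (1 - z) = (1 - z)⁻¹ := by field_simp; ring
  refine ⟨h, ?_⟩
  rw [mob, h]
  field_simp

theorem eq_of_mob {ζ : ℂ} (h : 1 + ζ ≠ 0) :
    1 - mob ζ = (1 + ζ)⁻¹ ∧ ζ = mob ζ / (1 - mob ζ) := by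
  have h1 : 1 - mob ζ = (1 + ζ)⁻¹ := by rw [mob]; field_simp; ring
  refine ⟨h1, ?_⟩
  rw [h1, mob]
  field_simp

theorem differentiableAt_mob {ζ : ℂ} (h : 1 + ζ ≠ 0) : DifferentiableAt ℂ mob ζ :=
  differentiableAt_id.div (differentiableAt_id.const_add 1) h

variable {μ : ProbabilityMeasure Torus} {r : ℝ} {F : ℂ × ℂ → ℂ}

/-- With `ζ = z/(1-z)` and `ω = w/(1-w)`, both `H - ζ - 1` and `ζ - ω` have denominator
`(1-z)(1-w)`, with numerators `κ + w` and `z - w`. The bracket becomes `(κ+z)/(κ+w)` and the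
prefactor `w/z`. -/
theorem IsSigmaOp.sopDefinedAt (h : IsSigmaOp μ r F) {p : ℂ × ℂ} (h₁ : 1 + p.1 ≠ 0)
    (h₂ : 1 + p.2 ≠ 0) (hz : mob p.1 ∈ D r) (hw : mob p.2 ∈ D r) :
    SopDefinedAt μ p ∧ (p.1 ≠ 0 → p.2 ≠ 0 →
      p.2 * (p.1 + 1) / (p.1 * (p.2 + 1)) *
      (1 + (p.1 - p.2) / (H μ (psiInv (marg₁ μ) p.1) (psiInv (marg₂ μ) p.2) - p.1 - 1))
        = F (mob p.1, mob p.2)) := by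
  obtain ⟨ζ, ω⟩ := p
  dsimp only at *
  obtain ⟨a1, b1⟩ := eq_of_mob h₁
  obtain ⟨a2, b2⟩ := eq_of_mob h₂
  have hk : kappa μ (mob ζ) (mob ω)
      = (1 - mob ζ) * (1 - mob ω) * H μ (psiInv (marg₁ μ) ζ) (psiInv (marg₂ μ) ω) - 1 := rfl
  have hne := h.ne_zero _ hz _ hw
  have heq := h.eq _ hz _ hw
  rw [hk] at hne heq
  generalize hHv : H μ (psiInv (marg₁ μ) ζ) (psiInv (marg₂ μ) ω) = Hv at *
  set z := mob ζ with hzdef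
  set w := mob ω with hwdef
  have hz1 : 1 - z ≠ 0 := by rw [a1]; exact inv_ne_zero h₁
  have hw1 : 1 - w ≠ 0 := by rw [a2]; exact inv_ne_zero h₂
  have c1 : ζ + 1 = (1 - z)⁻¹ := by rw [a1, inv_inv, add_comm]
  have c2 : ω + 1 = (1 - w)⁻¹ := by rw [a2, inv_inv, add_comm]
  have hz0 : ζ ≠ 0 → z ≠ 0 := fun h0 hz => h0 (by rw [b1, hz, zero_div])
  have hw0 : ω ≠ 0 → w ≠ 0 := fun h0 hw => h0 (by rw [b2, hw, zero_div])
  have e1 : Hv - ζ - 1 = ((1 - z) * (1 - w) * Hv - 1 + w) / ((1 - z) * (1 - w)) := by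
    have : Hv - ζ - 1 = Hv - (1 - z)⁻¹ := by rw [← c1]; ring
    rw [this]
    field_simp
    ring
  refine ⟨⟨⟨h₁, r, h.pos, h.lt_one, h.inv₁, Or.inl hz⟩, ⟨h₂, r, h.pos, h.lt_one, h.inv₂,
    Or.inl hw⟩, fun _ h0 => ?_⟩, fun hζ hω => ?_⟩
  · dsimp only
    rw [hHv, e1]
    exact div_ne_zero (hne (hw0 h0)) (mul_ne_zero hz1 hw1)
  · have hn := hne (hw0 hω)
    have z0 := hz0 hζ
    rw [heq z0 (hw0 hω), e1, c1, c2, b1, b2]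
    generalize (1 - z) * (1 - w) * Hv - 1 = κ at *
    field_simp
    ring

theorem IsSigmaOp.eventually_mob (r : ℝ) {p : ℂ × ℂ} (h₁ : 1 + p.1 ≠ 0)
    (h₂ : 1 + p.2 ≠ 0) (hz : mob p.1 ∈ D r) (hw : mob p.2 ∈ D r) :
    ∀ᶠ q : ℂ × ℂ in 𝓝 p, 1 + q.1 ≠ 0 ∧ 1 + q.2 ≠ 0 ∧ mob q.1 ∈ D r ∧ mob q.2 ∈ D r := by
  have c1 : Tendsto (fun q : ℂ × ℂ => q.1) (𝓝 p) (𝓝 p.1) := continuous_fst.tendsto _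
  have c2 : Tendsto (fun q : ℂ × ℂ => q.2) (𝓝 p) (𝓝 p.2) := continuous_snd.tendsto _
  have n : ∀ {ζ : ℂ}, 1 + ζ ≠ 0 → ∀ᶠ u in 𝓝 ζ, 1 + u ≠ 0 := fun {ζ} h =>
    (continuous_const.add continuous_id).continuousAt.eventually_ne (x := ζ) h
  exact (c1.eventually (n h₁)).and ((c2.eventually (n h₂)).and
    ((c1.eventually ((differentiableAt_mob h₁).continuousAt.eventually_mem
      ((isOpen_D r).mem_nhds hz))).and
    (c2.eventually ((differentiableAt_mob h₂).continuousAt.eventually_mem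
      ((isOpen_D r).mem_nhds hw)))))

theorem IsSigmaOp.differentiableAt_comp_mob (h : IsSigmaOp μ r F) {p : ℂ × ℂ} (h₁ : 1 + p.1 ≠ 0)
    (h₂ : 1 + p.2 ≠ 0) (hz : mob p.1 ∈ D r) (hw : mob p.2 ∈ D r) :
    DifferentiableAt ℂ (fun q : ℂ × ℂ => F (mob q.1, mob q.2)) p := by
  have hd : DifferentiableAt ℂ F (mob p.1, mob p.2) :=
    h.diff.differentiableAt (((isOpen_D r).prod (isOpen_D r)).mem_nhds ⟨hz, hw⟩)
  exact DifferentiableAt.comp (f := fun q : ℂ × ℂ => (mob q.1, mob q.2)) p hd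
    ((DifferentiableAt.comp (f := Prod.fst) p (differentiableAt_mob h₁)
      differentiableAt_fst).prodMk
      (DifferentiableAt.comp (f := Prod.snd) p (differentiableAt_mob h₂) differentiableAt_snd))

theorem IsSigmaOp.sopTransform_eq (h : IsSigmaOp μ r F) {p : ℂ × ℂ} (h₁ : 1 + p.1 ≠ 0)
    (h₂ : 1 + p.2 ≠ 0) (hz : mob p.1 ∈ D r) (hw : mob p.2 ∈ D r) :
    SopTransform μ p = F (mob p.1, mob p.2) := by
  refine extendAxes_eq (F := fun q : ℂ × ℂ => F (mob q.1, mob q.2))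
    (h.differentiableAt_comp_mob h₁ h₂ hz hw).continuousAt ?_
  filter_upwards [IsSigmaOp.eventually_mob r h₁ h₂ hz hw] with q ⟨q1, q2, q3, q4⟩
  exact (h.sopDefinedAt q1 q2 q3 q4).2

theorem IsSigmaOp.sigma (h : IsSigmaOp μ r F) {p : ℂ × ℂ} (hp : p ∈ D r ×ˢ D r) :
    SopDefinedAt μ (changeVar p) ∧ SigmaOpTransform μ p = F p := by
  have hz := one_sub_ne_zero_of_norm (hp.1.trans h.lt_one)
  have hw := one_sub_ne_zero_of_norm (hp.2.trans h.lt_one)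
  obtain ⟨a1, b1⟩ := mob_div_one_sub hz
  obtain ⟨a2, b2⟩ := mob_div_one_sub hw
  have n1 : 1 + (changeVar p).1 ≠ 0 := by
    change 1 + p.1 / (1 - p.1) ≠ 0
    rw [a1]; exact inv_ne_zero hz
  have n2 : 1 + (changeVar p).2 ≠ 0 := by
    change 1 + p.2 / (1 - p.2) ≠ 0
    rw [a2]; exact inv_ne_zero hw
  have m1 : mob (changeVar p).1 = p.1 := b1
  have m2 : mob (changeVar p).2 = p.2 := b2
  have d1 : mob (changeVar p).1 ∈ D r := by rw [m1]; exact hp.1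
  have d2 : mob (changeVar p).2 ∈ D r := by rw [m2]; exact hp.2
  refine ⟨(h.sopDefinedAt n1 n2 d1 d2).1, ?_⟩
  rw [SigmaOpTransform, h.sopTransform_eq n1 n2 d1 d2, m1, m2]

theorem IsSigmaOp.differentiableOn (h : IsSigmaOp μ r F) :
    DifferentiableOn ℂ (SigmaOpTransform μ) (D r ×ˢ D r) :=
  h.diff.congr fun _ hp => (h.sigma hp).2

theorem mob_mem {z : ℂ} (hr : r < 1) (hz : z ∈ D (r / 2)) : 1 + z ≠ 0 ∧ mob z ∈ D r := by
  have hz' : ‖z‖ < r / 2 := hz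
  -- From `‖z‖ < r/2 < 1/2`; this is why halving the radius suffices.
  have h1 : 1 / 2 < ‖1 + z‖ := by
    have := norm_sub_norm_le 1 (-z)
    rw [norm_one, norm_neg, sub_neg_eq_add] at this
    linarith
  have h2 : 0 < ‖1 + z‖ := by linarith
  refine ⟨norm_pos_iff.1 h2, ?_⟩
  rw [mem_D, mob, norm_div, div_lt_iff₀ h2]
  nlinarith [norm_nonneg z]

theorem IsSigmaOp.sop (h : IsSigmaOp μ r F) :
    (∀ p ∈ D (r / 2) ×ˢ D (r / 2), SopDefinedAt μ p) ∧
      DifferentiableOn ℂ (SopTransform μ) (D (r / 2) ×ˢ D (r / 2)) := by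
  constructor
  · rintro p ⟨h1, h2⟩
    obtain ⟨n1, d1⟩ := mob_mem h.lt_one h1
    obtain ⟨n2, d2⟩ := mob_mem h.lt_one h2
    exact (h.sopDefinedAt n1 n2 d1 d2).1
  · refine DifferentiableOn.congr (f := fun q : ℂ × ℂ => F (mob q.1, mob q.2)) ?_ ?_
    · rintro p ⟨h1, h2⟩
      obtain ⟨n1, d1⟩ := mob_mem h.lt_one h1
      obtain ⟨n2, d2⟩ := mob_mem h.lt_one h2
      exact (h.differentiableAt_comp_mob n1 n2 d1 d2).differentiableWithinAt
    · rintro p ⟨h1, h2⟩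
      obtain ⟨n1, d1⟩ := mob_mem h.lt_one h1
      obtain ⟨n2, d2⟩ := mob_mem h.lt_one h2
      exact h.sopTransform_eq n1 n2 d1 d2

end BiFree

end

noncomputable section

namespace BiFree

/-! ### The reflection formula. -/

section Reflection

variable {μ : ProbabilityMeasure Torus} {r : ℝ} {F : ℂ × ℂ → ℂ}

/-- The inverse `η`-transform near infinity in terms of the reflected measure. -/
theorem eventually_etaInv_inv {ν : ProbabilityMeasure Circle} (hν : mean ν ≠ 0) :
    ∀ᶠ w in 𝓝[≠] 0, (etaInv ν w⁻¹)⁻¹ = etaInv (circInv ν) w ∧ ‖etaInv (circInv ν) w‖ < 1 ∧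
      etaInv (circInv ν) w ≠ 0 := by
  have hν' : mean (circInv ν) ≠ 0 := by rw [mean_circInv]; exact star_ne_zero.2 hν
  obtain ⟨r, hr0, hr1, -, -, h3, -, h5, h6⟩ := isEtaInv_etaInv hν
  have hinf : Tendsto (fun w : ℂ => etaInv ν w⁻¹) (𝓝[≠] 0) (Bornology.cobounded ℂ) :=
    h5.comp tendsto_inv₀_nhdsNE_zero
  have h0 : Tendsto (fun w : ℂ => (etaInv ν w⁻¹)⁻¹) (𝓝[≠] 0) (𝓝 0) :=
    tendsto_inv₀_cobounded.comp hinf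
  have hD : ∀ᶠ w : ℂ in 𝓝[≠] 0, w ∈ D r ∧ w ≠ 0 :=
    inter_mem (nhdsWithin_le_nhds (D_mem_nhds hr0)) self_mem_nhdsWithin
  have hne : ∀ᶠ w : ℂ in 𝓝[≠] 0, etaInv ν w⁻¹ ≠ 0 ∧ ‖(etaInv ν w⁻¹)⁻¹‖ < 1 ∧
      eta ν (etaInv ν w⁻¹) = w⁻¹ := by
    filter_upwards [hD] with w ⟨hw, hw0⟩
    have hw1 : w⁻¹ ∈ Δ r := by
      rw [mem_Δ, norm_inv, one_div]
      exact (inv_lt_inv₀ hr0 (norm_pos_iff.2 hw0)).2 hw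
    have h7 : 1 / 1 < ‖etaInv ν w⁻¹‖ := h3 hw1
    rw [one_div_one] at h7
    refine ⟨norm_pos_iff.1 (by linarith), ?_, h6 _ (Or.inr hw1)⟩
    rw [norm_inv]
    exact inv_lt_one_of_one_lt₀ h7
  have hη : ∀ᶠ w : ℂ in 𝓝[≠] 0, eta (circInv ν) (etaInv ν w⁻¹)⁻¹ = w := by
    filter_upwards [hne] with w ⟨h7, h8, h9⟩
    have := eta_inv (ν := ν) h8 (inv_ne_zero h7)
    rw [inv_inv, h9] at this
    exact (inv_injective this).symm
  filter_upwards [eventually_eq_etaInv hν' nhdsWithin_le_nhds h0 hη, hne] with w h7 h8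
  rw [← h7]
  exact ⟨rfl, h8.2.1, inv_ne_zero h8.1⟩

/-- Here `ω` corresponds to `1/w`, so `ω = -1/(1-w)`, `(1+ω)/ω = w` and `1+ζ+ω =
(z-w)/((1-z)(1-w))`. Together with `H_inv` the formula for `S` collapses to the one for the opposite
transform of the reflected measure. -/
theorem IsSigmaOp.sDefinedAt (h : IsSigmaOp (reflect μ) r F)
    (h₁ : IsEtaInv (marg₁ μ) r (etaInv (marg₁ μ))) (h₂ : IsEtaInv (marg₂ μ) r (etaInv (marg₂ μ)))
    {ζ ω w : ℂ} (hζ : 1 + ζ ≠ 0) (hz : mob ζ ∈ D r) (hwr : w ∈ D r) (hw0 : w ≠ 0)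
    (hω : mob ω = w⁻¹) (hω1 : 1 + ω ≠ 0)
    (hinv : (etaInv (marg₂ μ) w⁻¹)⁻¹ = etaInv (circInv (marg₂ μ)) w ∧
      ‖etaInv (circInv (marg₂ μ)) w‖ < 1 ∧ etaInv (circInv (marg₂ μ)) w ≠ 0) :
    SDefinedAt μ (ζ, ω) ∧ (ζ ≠ 0 → (1 + ζ) / ζ * ((1 + ω) / ω) *
      (1 - (1 + ζ + ω) / H μ (psiInv (marg₁ μ) ζ) (psiInv (marg₂ μ) ω)) = F (mob ζ, w)) := by
  obtain ⟨i1, i2, i3⟩ := hinv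
  set V := etaInv (circInv (marg₂ μ)) w with hV
  obtain ⟨a1, b1⟩ := eq_of_mob hζ
  set z := mob ζ with hzdef
  have hz1 : 1 - z ≠ 0 := by rw [a1]; exact inv_ne_zero hζ
  have hw1 : 1 - w ≠ 0 := one_sub_ne_zero_of_norm (hwr.trans h.lt_one)
  have p2 : psiInv (marg₂ μ) ω = V⁻¹ := by
    change etaInv (marg₂ μ) (mob ω) = _
    rw [hω, ← i1, inv_inv]
  have p1 : psiInv (marg₁ μ) ζ = etaInv (marg₁ μ) z := rfl
  set Z := etaInv (marg₁ μ) z with hZ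
  have hZ1 : ‖Z‖ < 1 := h₁.2.1 hz
  have hk : kappa (reflect μ) z w = (1 - z) * (1 - w) * H (reflect μ) Z V - 1 := by
    rw [kappa, marg₁_reflect, marg₂_reflect]
  have hn := h.norm₁ z hz
  rw [marg₁_reflect, ← H_zero_right μ hZ1] at hn
  have hHv := H_inv μ hZ1 i2 i3
  have hne := h.ne_zero z hz w hwr hw0
  have heq := fun h0 => h.eq z hz w hwr h0 hw0
  -- Combines `H_inv` with `(1-z) H(Z,0) = 1`; it also shows that the denominator of `S` does not
  -- vanish.
  have hH : H μ Z V⁻¹ = -(kappa (reflect μ) z w + w) / ((1 - z) * (1 - w)) := by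
    rw [eq_div_iff (mul_ne_zero hz1 hw1), hHv, hk]
    linear_combination (1 - w) * hn
  have hω' : ω = (1 + ω) * w⁻¹ := by
    rw [mob, div_eq_iff hω1] at hω
    rw [mul_comm]
    exact hω
  have hω2 : ω = -(1 - w)⁻¹ := by
    field_simp at hω' ⊢
    linear_combination -hω'
  have hω3 : (1 + ω) / ω = w := by
    rw [← inv_inv w, ← hω, mob, inv_div]
  refine ⟨⟨⟨hζ, r, h.pos, h.lt_one, h₁, Or.inl hz⟩, ⟨hω1, r, h.pos, h.lt_one, h₂, Or.inr ?_⟩, ?_⟩,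
    fun h0 => ?_⟩
  · change mob ω ∈ Δ r
    rw [hω, mem_Δ, norm_inv, one_div]
    exact (inv_lt_inv₀ h.pos (norm_pos_iff.2 hw0)).2 hwr
  · dsimp only
    rw [p2, p1, hH]
    exact div_ne_zero (neg_ne_zero.2 hne) (mul_ne_zero hz1 hw1)
  · have hz0 : z ≠ 0 := fun hz => h0 (by rw [b1, hz, zero_div])
    have c1 : (1 + ζ) = (1 - z)⁻¹ := by rw [a1, inv_inv]
    rw [p2, p1, hH, heq hz0, hω3, c1, hω2]
    have c2 : (1 - z)⁻¹ / ζ = z⁻¹ := by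
      rw [b1]
      field_simp
    rw [c2]
    generalize kappa (reflect μ) z w = κ at *
    field_simp
    ring

theorem IsSigmaOp.sTransform_eq (h : IsSigmaOp (reflect μ) r F)
    (h₁ : IsEtaInv (marg₁ μ) r (etaInv (marg₁ μ))) (h₂ : IsEtaInv (marg₂ μ) r (etaInv (marg₂ μ)))
    (hinv : ∀ w ∈ D r, w ≠ 0 → (etaInv (marg₂ μ) w⁻¹)⁻¹ = etaInv (circInv (marg₂ μ)) w ∧
      ‖etaInv (circInv (marg₂ μ)) w‖ < 1 ∧ etaInv (circInv (marg₂ μ)) w ≠ 0)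
    {z w : ℂ} (hz : z ∈ D r) (hw : w ∈ D r) (hw0 : w ≠ 0) :
    SDefinedAt μ (changeVar (z, 1 / w)) ∧ SigmaTransform μ (z, 1 / w) = F (z, w) := by
  have hz1 : 1 - z ≠ 0 := one_sub_ne_zero_of_norm (hz.trans h.lt_one)
  have hw1 : 1 - w ≠ 0 := one_sub_ne_zero_of_norm (hw.trans h.lt_one)
  have hw1' : 1 - 1 / w ≠ 0 := by
    rw [one_sub_div hw0]
    exact div_ne_zero (by rwa [← neg_sub, neg_ne_zero]) hw0
  obtain ⟨a1, b1⟩ := mob_div_one_sub hz1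
  obtain ⟨a2, b2⟩ := mob_div_one_sub hw1'
  set ζ := z / (1 - z) with hζ
  set ω := 1 / w / (1 - 1 / w) with hω
  have hζ1 : 1 + ζ ≠ 0 := by rw [a1]; exact inv_ne_zero hz1
  have hω1 : 1 + ω ≠ 0 := by rw [a2]; exact inv_ne_zero hw1'
  have hω0 : ω ≠ 0 := div_ne_zero (one_div_ne_zero hw0) hw1'
  have hωw : (1 + ω) / ω = w := by
    rw [mob] at b2
    rw [← inv_div, b2, one_div, inv_inv]
  have hcv : changeVar (z, 1 / w) = (ζ, ω) := rfl
  refine ⟨?_, ?_⟩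
  · rw [hcv]
    exact (h.sDefinedAt h₁ h₂ hζ1 (by rwa [b1]) hw hw0 (by rw [b2, one_div]) hω1
      (hinv w hw hw0)).1
  · rw [SigmaTransform, hcv]
    -- The continuous extension near `(ζ, ω)`: the second argument recovers `w` from `ω`. As `ω ≠
    -- 0`, only the axis `ζ = 0` can matter.
    let c : ℂ × ℂ → ℂ := fun q => F (mob q.1, (1 + q.2) / q.2)
    have hc : c (ζ, ω) = F (z, w) := by
      change F (mob ζ, (1 + ω) / ω) = _
      rw [b1, hωw]
    have hpair : ContinuousAt (fun q : ℂ × ℂ => (mob q.1, (1 + q.2) / q.2)) (ζ, ω) := by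
      refine ContinuousAt.prodMk ?_ ?_
      · exact ContinuousAt.comp (g := mob) (f := Prod.fst) (x := (ζ, ω))
          (differentiableAt_mob hζ1).continuousAt continuousAt_fst
      · exact (continuousAt_const.add continuousAt_snd).div continuousAt_snd hω0
    have hval : (mob ζ, (1 + ω) / ω) = (z, w) := by
      rw [b1, hωw]
    have hmem : D r ×ˢ D r ∈ 𝓝 (z, w) := ((isOpen_D r).prod (isOpen_D r)).mem_nhds ⟨hz, hw⟩
    have hcc : ContinuousAt c (ζ, ω) := by
      refine ContinuousAt.comp (g := F) ?_ hpair
      change ContinuousAt F (mob ζ, (1 + ω) / ω)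
      rw [hval]
      exact (h.diff.differentiableAt hmem).continuousAt
    rw [← hc]
    refine extendAxes_eq hcc ?_
    have e1 : ∀ᶠ q : ℂ × ℂ in 𝓝 (ζ, ω), (mob q.1, (1 + q.2) / q.2) ∈ D r ×ˢ D r := by
      refine hpair.eventually_mem ?_
      change D r ×ˢ D r ∈ 𝓝 (mob ζ, (1 + ω) / ω)
      rw [hval]
      exact hmem
    have e2 : ∀ᶠ q : ℂ × ℂ in 𝓝 (ζ, ω), 1 + q.1 ≠ 0 :=
      (continuousAt_const.add continuousAt_fst).eventually_ne hζ1
    have e3 : ∀ᶠ q : ℂ × ℂ in 𝓝 (ζ, ω), 1 + q.2 ≠ 0 :=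
      (continuousAt_const.add continuousAt_snd).eventually_ne hω1
    filter_upwards [e1, e2, e3] with q ⟨d1, d2⟩ n1 n2 q1 q2
    have hm : mob q.2 = ((1 + q.2) / q.2)⁻¹ := by rw [mob, inv_div]
    have h0 : (1 + q.2) / q.2 ≠ 0 := div_ne_zero n2 q2
    exact (h.sDefinedAt h₁ h₂ n1 d1 d2 h0 hm n2 (hinv _ d2 h0)).2 q1

end Reflection

/-! ### Multiplicativity under the opposite convolution. -/

section Convolution

variable {μ₁ μ₂ : ProbabilityMeasure Torus}

theorem integral_cres_coordS (μ : ProbabilityMeasure Torus) {z Z : ℂ} (hZ : ‖Z‖ < 1)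
    (h : (1 - z) * (1 + psi (marg₁ μ) Z) = 1) :
    ∫ x, cres coordS z Z x ∂(μ : Measure Torus) = 0 := by
  have h1 : integralL (μ : Measure Torus) (res coordS Z) = H μ Z 0 := by
    rw [H_eq_integralL μ hZ (by simp), res_zero, mul_one]
  rw [← integralL_apply, cres, map_sub, map_smul, h1, H_zero_right μ hZ, smul_eq_mul, h,
    integralL_apply]
  simp

theorem integral_cres_coordT (μ : ProbabilityMeasure Torus) {w W : ℂ} (hW : ‖W‖ < 1)
    (h : (1 - w) * (1 + psi (marg₂ μ) W) = 1) :
    ∫ x, cres coordT w W x ∂(μ : Measure Torus) = 0 := by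
  have h1 : integralL (μ : Measure Torus) (res coordT W) = H μ 0 W := by
    rw [H_eq_integralL μ (by simp) hW, res_zero, one_mul]
  rw [← integralL_apply, cres, map_sub, map_smul, h1, H_zero_left μ hW, smul_eq_mul, h,
    integralL_apply]
  simp

theorem exists_norm_cres_le {ν : ProbabilityMeasure Circle} (hν : mean ν ≠ 0) :
    ∃ C : ℝ, ∀ᶠ z in 𝓝 0, ∀ x : C(Torus, ℂ), ‖x‖ ≤ 1 → ‖cres x z (etaInv ν z)‖ ≤ C * ‖z‖ := by
  obtain ⟨k, hk, hk'⟩ := exists_etaInv_quot hν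
  have hc : ∀ᶠ z in 𝓝 0, ‖k z‖ < ‖k 0‖ + 1 :=
    hk'.self_of_nhds.1.continuousAt.norm.eventually_lt continuousAt_const (by simp)
  have hn : ∀ᶠ z in 𝓝 0, ‖etaInv ν z‖ < 1 / 2 :=
    (tendsto_etaInv hν).eventually (D_mem_nhds (by norm_num))
  refine ⟨2 * (‖k 0‖ + 1 + 1), ?_⟩
  filter_upwards [hc, hn] with z h1 h2 x hx
  refine norm_cres_le hx h2.le ?_
  rw [hk, norm_mul, mul_comm]
  gcongr

/-- Each factor is `O(z)`, so the product is `O(z²)` and beats `‖z‖`. This is the convergence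
condition of `IsOppConv.joint`. -/
theorem eventually_norm_cres_mul_lt {ν₁ ν₂ : ProbabilityMeasure Circle} (h₁ : mean ν₁ ≠ 0)
    (h₂ : mean ν₂ ≠ 0) : ∀ᶠ z in 𝓝 0, ∀ x : C(Torus, ℂ), ‖x‖ ≤ 1 → z ≠ 0 →
      ‖cres x z (etaInv ν₁ z)‖ * ‖cres x z (etaInv ν₂ z)‖ < ‖z‖ := by
  obtain ⟨C₁, hC₁⟩ := exists_norm_cres_le h₁
  obtain ⟨C₂, hC₂⟩ := exists_norm_cres_le h₂
  have ht : ∀ᶠ z : ℂ in 𝓝 0, C₁ * C₂ * ‖z‖ < 1 := by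
    have : ContinuousAt (fun z : ℂ => C₁ * C₂ * ‖z‖) 0 := by fun_prop
    exact this.eventually_lt continuousAt_const (by simp)
  filter_upwards [hC₁, hC₂, ht] with z h1 h2 h3 x hx hz
  have hz' : 0 < ‖z‖ := norm_pos_iff.2 hz
  calc ‖cres x z (etaInv ν₁ z)‖ * ‖cres x z (etaInv ν₂ z)‖
      ≤ (C₁ * ‖z‖) * (C₂ * ‖z‖) :=
        mul_le_mul (h1 x hx) (h2 x hx) (norm_nonneg _) ((norm_nonneg _).trans (h1 x hx))
    _ = (C₁ * C₂ * ‖z‖) * ‖z‖ := by ring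
    _ < 1 * ‖z‖ := by gcongr
    _ = ‖z‖ := one_mul _

theorem eta_eq_of_one_add_psi {ν : ProbabilityMeasure Circle} {z Z : ℂ}
    (h : (1 - z) * (1 + psi ν Z) = 1) : eta ν Z = z := by
  have h0 : 1 + psi ν Z ≠ 0 := right_ne_zero_of_mul_eq_one h
  rw [eta, div_eq_iff h0]
  linear_combination h

/-- The subordination data for one of the two variables. -/
theorem eventually_good {ν₁ ν₂ : ProbabilityMeasure Circle} (h₁ : mean ν₁ ≠ 0)
    (h₂ : mean ν₂ ≠ 0) : ∃ Z : ℂ → ℂ, Tendsto Z (𝓝 0) (𝓝 0) ∧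
      ∀ᶠ z in 𝓝 0, Z z * z = etaInv ν₁ z * etaInv ν₂ z ∧ z ≠ 1 ∧ ‖Z z‖ < 1 ∧
        ‖etaInv ν₁ z‖ < 1 ∧ ‖etaInv ν₂ z‖ < 1 ∧
        (1 - z) * (1 + psi ν₁ (etaInv ν₁ z)) = 1 ∧ (1 - z) * (1 + psi ν₂ (etaInv ν₂ z)) = 1 ∧
        ∀ x : C(Torus, ℂ), ‖x‖ ≤ 1 → z ≠ 0 →
          ‖cres x z (etaInv ν₁ z)‖ * ‖cres x z (etaInv ν₂ z)‖ < ‖z‖ := by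
  obtain ⟨k, hk, hk'⟩ := exists_etaInv_quot h₂
  have ht : Tendsto (fun z => etaInv ν₁ z * k z) (𝓝 0) (𝓝 0) := by
    simpa using (tendsto_etaInv h₁).mul hk'.self_of_nhds.1.continuousAt.tendsto
  -- This is `η₁⁻¹(z) η₂⁻¹(z) / z`, with the division performed inside the second factor.
  refine ⟨fun z => etaInv ν₁ z * k z, ht, ?_⟩
  filter_upwards [eventually_norm_lt_one, ht.eventually eventually_norm_lt_one,
    (tendsto_etaInv h₁).eventually eventually_norm_lt_one,
    (tendsto_etaInv h₂).eventually eventually_norm_lt_one,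
    eventually_one_add_psi_etaInv h₁, eventually_one_add_psi_etaInv h₂,
    eventually_norm_cres_mul_lt h₁ h₂] with z n1 n2 n3 n4 n5 n6 n7
  refine ⟨?_, ?_, n2, n3, n4, n5, n6, n7⟩
  · rw [hk]; ring
  · rintro rfl
    simp at n1

/-- The marginal identities of `IsOppConv.joint` say that `η` of the marginals of `ν` takes the
values `z` and `w` at the points `Z(z)` and `W(w)`. By uniqueness these are the inverse transforms
of `ν`, so the joint formula becomes a relation between the three functions κ. -/
theorem eventually_kappa_oppConv {ν : ProbabilityMeasure Torus} (h : IsOppConv μ₁ μ₂ ν)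
    (h₁ : mean (marg₁ μ₁) ≠ 0) (h₁' : mean (marg₂ μ₁) ≠ 0) (h₂ : mean (marg₁ μ₂) ≠ 0)
    (h₂' : mean (marg₂ μ₂) ≠ 0) (hν : mean (marg₁ ν) ≠ 0) (hν' : mean (marg₂ ν) ≠ 0) :
    ∃ r : ℝ, 0 < r ∧ r < 1 ∧ ∀ z ∈ D r, ∀ w ∈ D r, z ≠ 0 → w ≠ 0 → ∃ e₁ e₂ : ℂ,
      e₁ = 1 + z⁻¹ * kappa μ₁ z w * e₂ ∧ e₂ = 1 + w⁻¹ * kappa μ₂ z w * e₁ ∧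
      kappa ν z w = kappa μ₁ z w * e₂ + kappa μ₂ z w * e₁ := by
  obtain ⟨Z, hZ, gZ⟩ := eventually_good h₁ h₂
  obtain ⟨W, hW, gW⟩ := eventually_good h₁' h₂'
  obtain ⟨r, hr0, hr1, hr⟩ := exists_D_of_eventually (gZ.and gW)
  have key : ∀ z ∈ D r, ∀ w ∈ D r, z ≠ 0 → w ≠ 0 → ∃ e₁ e₂ : ℂ,
      e₁ = 1 + z⁻¹ * kappa μ₁ z w * e₂ ∧ e₂ = 1 + w⁻¹ * kappa μ₂ z w * e₁ ∧
      (1 - z) * (1 - w) * H ν (Z z) (W w) = 1 + kappa μ₁ z w * e₂ + kappa μ₂ z w * e₁ ∧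
      (1 - z) * H ν (Z z) 0 = 1 ∧ (1 - w) * H ν 0 (W w) = 1 := by
    intro z hz w hw hz0 hw0
    obtain ⟨a1, a2, a3, a4, a5, a6, a7, a8⟩ := (hr z hz).1
    obtain ⟨b1, b2, b3, b4, b5, b6, b7, b8⟩ := (hr w hw).2
    exact h.joint hz0 a2 hw0 b2 a1 b1 a4 a5 a3 b4 b5 b3 (integral_cres_coordS _ a4 a6)
      (integral_cres_coordS _ a5 a7) (integral_cres_coordT _ b4 b6) (integral_cres_coordT _ b5 b7)
      (a8 _ norm_coordS hz0) (b8 _ norm_coordT hw0) (by rw [kappa]; ring) (by rw [kappa]; ring)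
  have hD : ∀ᶠ z : ℂ in 𝓝[≠] 0, z ∈ D r ∧ z ≠ 0 :=
    inter_mem (nhdsWithin_le_nhds (D_mem_nhds hr0)) self_mem_nhdsWithin
  have eZ : ∀ᶠ z in 𝓝[≠] 0, Z z = etaInv (marg₁ ν) z := by
    refine eventually_eq_etaInv hν nhdsWithin_le_nhds (hZ.mono_left nhdsWithin_le_nhds) ?_
    filter_upwards [hD] with z ⟨hz, hz0⟩
    obtain ⟨-, -, -, -, -, h3, -⟩ := key z hz z hz hz0 hz0
    rw [H_zero_right ν (hr z hz).1.2.2.1] at h3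
    exact eta_eq_of_one_add_psi h3
  have eW : ∀ᶠ w in 𝓝[≠] 0, W w = etaInv (marg₂ ν) w := by
    refine eventually_eq_etaInv hν' nhdsWithin_le_nhds (hW.mono_left nhdsWithin_le_nhds) ?_
    filter_upwards [hD] with w ⟨hw, hw0⟩
    obtain ⟨-, -, -, -, -, -, h3⟩ := key w hw w hw hw0 hw0
    rw [H_zero_left ν (hr w hw).2.2.2.1] at h3
    exact eta_eq_of_one_add_psi h3
  obtain ⟨s, hs0, hs1, hs⟩ := exists_D_of_eventually
    ((eventually_nhdsWithin_iff.1 eZ).and (eventually_nhdsWithin_iff.1 eW))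
  refine ⟨min r s, lt_min hr0 hs0, (min_le_left _ _).trans_lt hr1, fun z hz w hw hz0 hw0 => ?_⟩
  obtain ⟨e₁, e₂, he₁, he₂, h3, -⟩ := key z (D_mono (min_le_left _ _) hz) w
    (D_mono (min_le_left _ _) hw) hz0 hw0
  refine ⟨e₁, e₂, he₁, he₂, ?_⟩
  rw [(hs z (D_mono (min_le_right _ _) hz)).1 hz0, (hs w (D_mono (min_le_right _ _) hw)).2 hw0]
    at h3
  rw [kappa, h3]
  ring

/-- The system for `e₁`, `e₂` factors both `κ + z` and `κ + w`, and eliminating the constants from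
it determines the ratio `e₁/e₂`. That `e₂` is nonzero follows from `κ + w ≠ 0`. -/
theorem sigma_mul_algebra {z w κ₁ κ₂ κ e₁ e₂ : ℂ} (hz : z ≠ 0) (hw : w ≠ 0)
    (h₁ : e₁ = 1 + z⁻¹ * κ₁ * e₂) (h₂ : e₂ = 1 + w⁻¹ * κ₂ * e₁) (hκ : κ = κ₁ * e₂ + κ₂ * e₁)
    (n : κ + w ≠ 0) (n₁ : κ₁ + w ≠ 0) (n₂ : κ₂ + w ≠ 0) :
    w * (κ + z) / (z * (κ + w))
      = w * (κ₁ + z) / (z * (κ₁ + w)) * (w * (κ₂ + z) / (z * (κ₂ + w))) := by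
  have h₁' : z * e₁ = z + κ₁ * e₂ := by
    conv_lhs => rw [h₁]
    field_simp
  have h₂' : w * e₂ = w + κ₂ * e₁ := by
    conv_lhs => rw [h₂]
    field_simp
  have a : κ + z = e₁ * (κ₂ + z) := by linear_combination hκ - h₁'
  have b : κ + w = e₂ * (κ₁ + w) := by linear_combination hκ - h₂'
  have c : e₁ * z * (κ₂ + w) = e₂ * w * (κ₁ + z) := by
    linear_combination w * h₁' - z * h₂'
  rw [b] at n
  have ne : e₂ ≠ 0 := left_ne_zero_of_mul n
  rw [a, b, div_mul_div_comm, div_eq_div_iff (by positivity) (by positivity)]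
  linear_combination w * (κ₂ + z) * z * (κ₁ + w) * c

end Convolution

end BiFree

end

/-! ### Assembly of the proposition. -/

open BiFree in
theorem proposition2p8 :
    -- the opposite transforms are well defined and holomorphic near the origin, and the
    -- reflection formula
    (∀ μ ∈ PTimes, ∃ r : ℝ, 0 < r ∧ r < 1 ∧
      (∀ p ∈ D r ×ˢ D r, SopDefinedAt μ p ∧ SopDefinedAt μ (changeVar p)) ∧
      DifferentiableOn ℂ (SigmaOpTransform μ) (D r ×ˢ D r) ∧
      DifferentiableOn ℂ (SopTransform μ) (D r ×ˢ D r) ∧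
      ∀ z ∈ D r, ∀ w ∈ D r, w ≠ 0 →
        SopDefinedAt (reflect μ) (changeVar (z, w)) ∧ SDefinedAt μ (changeVar (z, 1 / w)) ∧
        SigmaOpTransform (reflect μ) (z, w) = SigmaTransform μ (z, 1 / w)) ∧
    -- the opposite convolution is the law of its defining pair, and multiplicativity
    (∀ μ₁ ∈ PTimes, ∀ μ₂ ∈ PTimes, IsOppConv μ₁ μ₂ (oppConv μ₁ μ₂) ∧
      ∃ r : ℝ, 0 < r ∧ r < 1 ∧
        (∀ p ∈ D r ×ˢ D r, SopDefinedAt μ₁ (changeVar p) ∧ SopDefinedAt μ₂ (changeVar p) ∧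
          SopDefinedAt (oppConv μ₁ μ₂) (changeVar p)) ∧
        DifferentiableOn ℂ (SigmaOpTransform (oppConv μ₁ μ₂)) (D r ×ˢ D r) ∧
        ∀ p ∈ D r ×ˢ D r,
          SigmaOpTransform (oppConv μ₁ μ₂) p = SigmaOpTransform μ₁ p * SigmaOpTransform μ₂ p) := by
  constructor
  · rintro μ ⟨h₁, h₂, -⟩
    have h₂' : mean (marg₂ (reflect μ)) ≠ 0 := by
      rw [marg₂_reflect, mean_circInv]
      exact star_ne_zero.2 h₂
    obtain ⟨r₁, F, hF⟩ := exists_isSigmaOp h₁ h₂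
    obtain ⟨r₂, G, hG⟩ := exists_isSigmaOp (by rwa [marg₁_reflect]) h₂'
    obtain ⟨r₃, h3, -, hr₃⟩ := exists_D_of_eventually
      (eventually_nhdsWithin_iff.1 (eventually_etaInv_inv h₂))
    let s := min r₁ (min r₂ r₃)
    have hs : 0 < s := lt_min hF.pos (lt_min hG.pos h3)
    have hF' : IsSigmaOp μ s F := hF.mono hs (min_le_left _ _)
    have hG' : IsSigmaOp (reflect μ) s G := hG.mono hs
      ((min_le_right _ _).trans (min_le_left _ _))
    have hs3 : D s ⊆ D r₃ := D_mono ((min_le_right _ _).trans (min_le_right _ _))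
    have hsub : D (s / 2) ⊆ D s := D_mono (by linarith)
    have hsub2 : D (s / 2) ×ˢ D (s / 2) ⊆ D s ×ˢ D s := Set.prod_mono hsub hsub
    -- The half radius serves the `S`-variables, which `mob` carries into the disk of radius `s`;
    -- the Σ-statements hold on the larger bidisk.
    refine ⟨s / 2, by positivity, by linarith [hF'.lt_one], fun p hp =>
      ⟨hF'.sop.1 p hp, (hF'.sigma (hsub2 hp)).1⟩, hF'.differentiableOn.mono hsub2, hF'.sop.2, ?_⟩
    intro z hz w hw hw0
    have hG1 := hG'.sigma (p := (z, w)) ⟨hsub hz, hsub hw⟩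
    have hG2 := hG'.sTransform_eq hF'.inv₁ hF'.inv₂ (fun w hw => hr₃ w (hs3 hw)) (hsub hz)
      (hsub hw) hw0
    exact ⟨hG1.1, hG2.1, hG1.2.trans hG2.2.symm⟩
  · rintro μ₁ ⟨h₁, h₁', -⟩ μ₂ ⟨h₂, h₂', -⟩
    have hopp := isOppConv_oppConv μ₁ μ₂
    refine ⟨hopp, ?_⟩
    have hm := hopp.mean
    rw [← mean_marg₁, ← mean_marg₁, ← mean_marg₁, ← mean_marg₂, ← mean_marg₂, ← mean_marg₂] at hm
    have hν : mean (marg₁ (oppConv μ₁ μ₂)) ≠ 0 := by rw [hm.1]; exact mul_ne_zero h₁ h₂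
    have hν' : mean (marg₂ (oppConv μ₁ μ₂)) ≠ 0 := by rw [hm.2]; exact mul_ne_zero h₁' h₂'
    obtain ⟨r₁, F₁, hF₁⟩ := exists_isSigmaOp h₁ h₁'
    obtain ⟨r₂, F₂, hF₂⟩ := exists_isSigmaOp h₂ h₂'
    obtain ⟨r₃, F, hF⟩ := exists_isSigmaOp hν hν'
    obtain ⟨r₄, hr₄, -, hk⟩ := eventually_kappa_oppConv hopp h₁ h₁' h₂ h₂' hν hν'
    let s := min (min r₁ r₂) (min r₃ r₄)
    have hs : 0 < s := lt_min (lt_min hF₁.pos hF₂.pos) (lt_min hF.pos hr₄)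
    replace hF₁ := hF₁.mono hs ((min_le_left _ _).trans (min_le_left _ _))
    replace hF₂ := hF₂.mono hs ((min_le_left _ _).trans (min_le_right _ _))
    replace hF := hF.mono hs ((min_le_right _ _).trans (min_le_left _ _))
    have hs4 : D s ⊆ D r₄ := D_mono ((min_le_right _ _).trans (min_le_right _ _))
    refine ⟨s, hs, hF.lt_one, fun p hp => ⟨(hF₁.sigma hp).1, (hF₂.sigma hp).1, (hF.sigma hp).1⟩,
      hF.differentiableOn, fun p hp => ?_⟩
    rw [(hF₁.sigma hp).2, (hF₂.sigma hp).2, (hF.sigma hp).2]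
    -- Both sides are holomorphic, hence continuous, so the explicit formulas off the axes decide
    -- the identity everywhere.
    refine eq_of_eq_offAxes hF.diff (hF₁.diff.mul hF₂.diff) (fun z hz w hw hz0 hw0 => ?_) p hp
    obtain ⟨e₁, e₂, he₁, he₂, hκ⟩ := hk z (hs4 hz) w (hs4 hw) hz0 hw0
    change _ = F₁ (z, w) * F₂ (z, w)
    rw [hF.eq z hz w hw hz0 hw0, hF₁.eq z hz w hw hz0 hw0, hF₂.eq z hz w hw hz0 hw0]
    exact sigma_mul_algebra hz0 hw0 he₁ he₂ hκ (hF.ne_zero z hz w hw hw0)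
      (hF₁.ne_zero z hz w hw hw0) (hF₂.ne_zero z hz w hw hw0)
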